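/- Let $D=\{z\in\mathbb C:|z|<1\}$, let $\gamma$ be Euler's constant and $\zeta$ the Riemann zeta function, and for $z\in D$ put $$\ell_1(z)=\gamma z-\sum_{k\ge2}\zeta(k)\frac{(-z)^k}{k},\qquad \ell_r(z)=-\sum_{k\ge1}\zeta(kr)\frac{(-z^r)^k}{k}\quad(r\ge2),$$ and $\Gamma_{y_r}(1+z)=e^{-\ell_r(z)}$. Let $L=\mathrm{span}_{\mathbb C}\{\ell_r\}_{r\ge1}$ and $E=\mathrm{span}_{\mathbb C}\{e^{\ell_r}\}_{r\ge1}$, as spaces of functions on $D$, and let $1$ be the constant function. Let $Y=\{y_r\}_{r\ge1}$ be an alphabet, $\mathbb CY=\mathrm{span}_{\mathbb C}\{y_r\}_{r\ge1}$, and let $y_r^*=\sum_{n\ge0}y_r^n$ be the Kleene star of $y_r$ among the noncommutative formal power series over $Y$. For holomorphic functions $u_{y_r}$ on $D$ ($r\ge1$) put, for words, $$\alpha_0^z(y_{i_1}\cdots y_{i_k})=\int_0^z u_{y_{i_1}}(z_1)\,dz_1\int_0^{z_1}u_{y_{i_2}}(z_2)\,dz_2\cdots\int_0^{z_{k-1}}u_{y_{i_k}}(z_k)\,dz_k$$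 (with value $1$ on the empty word), and $\alpha_0^z(S)=\sum_w\langle S|w\rangle\,\alpha_0^z(w)$ for the series $S$ for which this sum converges. Then: 1. The families $(\ell_r)_{r\ge1}$ and $(e^{\ell_r})_{r\ge1}$ are $\mathbb C$-linearly free, and free from $1$ (that is, $1\notin L$ and $1\notin E$). Moreover: (a) With $u_{y_r}=e^{\ell_r}\partial\ell_r$ one has $\alpha_0^z(y_r)=e^{\ell_r(z)}-1$ and $\alpha_0^z(y_r^*)=e^{e^{\ell_r(z)}-1}$ for all $r\ge1$ and $z\in D$, and the restriction $\alpha_0^z:\mathbb CY\to E+\mathbb C\cdot1$ is (well defined and) injective. (b) With $u_{y_r}=\partial\ell_r$ one has $\alpha_0^z(y_r)=\ell_r(z)$ and $\alpha_0^z(y_r^*)=e^{\ell_r(z)}$ for all $r\ge1$ and $z\in D$, and the restrictions $\alpha_0^z:\mathbb CY\to L$ and $\alpha_0^z:\mathrm{span}_{\mathbb C}\{y_r^*\}_{r\ge1}\to E$ are (well defined and) injective. (Here $\alpha_0^z(S)$ is regarded as a function of $z\in D$.) 2. The family $(\ell_r)_{r\ge1}$ is $\mathbb C$-algebraically independent,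 and so is the family $(e^{\ell_r})_{r\ge1}$. 3. For every $r\ge1$: (a) the two functions $\ell_r$ and $e^{\ell_r}$ are $\mathbb C$-algebraically independent; (b) the series defining $\ell_r$ converges on $D$, and $\ell_r$ is holomorphic on $D$; (c) $e^{\ell_r}=\Gamma_{y_r}(1+z)^{-1}$ extends to an entire function and $e^{-\ell_r}=\Gamma_{y_r}(1+z)$ extends to a meromorphic function on $\mathbb C$; the set of zeros of the former and the set of poles of the latter are both equal to $\biguplus_{\chi\in G_r}\chi\,\mathbb Z_{\le-1}$ (a disjoint union), which is countable and consists of isolated points, where $G_r=\{\chi\in\mathbb C:\chi^r=(-1)^{r-1}\}$. -/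

import Mathlib

open Topology

namespace Eulerian

noncomputable section

/-- The open unit disc `D` of the complex plane. -/
abbrev disc : Set ℂ := Metric.ball (0 : ℂ) 1

/-- The `k`-th term of the power series defining `ℓ_r`. For `r = 1` it is the term of
index `k + 2` of `∑_{k ≥ 2} ζ(k) (-z)^k / k`; for `r ≥ 2` it is the term of index `k + 1` of
`∑_{k ≥ 1} ζ(kr) (-z^r)^k / k`. -/
def ellTerm (r : ℕ+) (z : ℂ) (k : ℕ) : ℂ :=
  if r = 1 then riemannZeta ((k + 2 : ℕ) : ℂ) * (-z) ^ (k + 2) / ((k + 2 : ℕ) : ℂ)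
  else riemannZeta (((k + 1) * (r : ℕ) : ℕ) : ℂ) * (-z ^ (r : ℕ)) ^ (k + 1) / ((k + 1 : ℕ) : ℂ)

/-- `ℓ_1(z) = γ z - ∑_{k ≥ 2} ζ(k) (-z)^k / k` and, for `r ≥ 2`,
`ℓ_r(z) = - ∑_{k ≥ 1} ζ(kr) (-z^r)^k / k`; meaningful for `|z| < 1`. -/
def ell (r : ℕ+) (z : ℂ) : ℂ :=
  (if r = 1 then (Real.eulerMascheroniConstant : ℂ) * z else 0) - ∑' k : ℕ, ellTerm r z k

/-- The function `Γ_{y_r}`, given by `Γ_{y_r}(1 + z) = e^{-ℓ_r(z)}` for `|z| < 1`. -/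
def gammaY (r : ℕ+) (w : ℂ) : ℂ := Complex.exp (-ell r (w - 1))

/-- `ℓ_r` as an element of the algebra of complex functions on the disc. -/
def ellD (r : ℕ+) : disc → ℂ := fun z => ell r z

/-- `e^{ℓ_r}` as an element of the algebra of complex functions on the disc. -/
def expEllD (r : ℕ+) : disc → ℂ := fun z => Complex.exp (ell r z)

/-- `L`, the linear span of the functions `ℓ_r`. -/
def spanL : Submodule ℂ (disc → ℂ) := Submodule.span ℂ (Set.range ellD)

/-- `E`, the linear span of the functions `e^{ℓ_r}`. -/
def spanE : Submodule ℂ (disc → ℂ) := Submodule.span ℂ (Set.range expEllD)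

/-- `G_r`, the set of solutions of `χ^r = (-1)^(r-1)`. -/
def rootsG (r : ℕ+) : Set ℂ := {χ | χ ^ (r : ℕ) = (-1) ^ ((r : ℕ) - 1)}

/-- The set `χ ℤ_{≤ -1}`. -/
def negRay (χ : ℂ) : Set ℂ := {z | ∃ n : ℤ, n ≤ -1 ∧ z = χ * (n : ℂ)}

/-- Words over the alphabet `Y = {y_r : r ≥ 1}`, the letter `y_r` being represented by `r`. -/
abbrev Word : Type := List ℕ+

/-- Noncommutative formal power series over `Y` with complex coefficients. -/
abbrev Series : Type := Word → ℂ

/-- The series reduced to the letter `y_r`. -/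
def letter (r : ℕ+) : Series := fun w => if w = [r] then 1 else 0

/-- The unit series, reduced to the empty word. -/
def oneSeries : Series := fun w => if w = [] then 1 else 0

/-- The concatenation product, `⟨ST|w⟩ = ∑_{uv = w} ⟨S|u⟩⟨T|v⟩`. -/
def conc (S T : Series) : Series := fun w =>
  ∑ i ∈ Finset.range (w.length + 1), S (w.take i) * T (w.drop i)

/-- The powers of a series for concatenation. -/
def concPow (S : Series) : ℕ → Series
  | 0 => oneSeries
  | n + 1 => conc S (concPow S n)

/-- The Kleene star `S^* = 1 + S + S^2 + ...` of a series `S` without constant term: then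
`⟨S^n|w⟩ = 0` as soon as `n` exceeds the length of `w`. -/
def kleeneStar (S : Series) : Series := fun w =>
  ∑ n ∈ Finset.range (w.length + 1), concPow S n w

/-- The iterated integral `α_0^z(y_{i_1} ... y_{i_k}) =
∫_0^z u_{i_1}(z_1) dz_1 ∫_0^{z_1} u_{i_2}(z_2) dz_2 ... ∫_0^{z_{k-1}} u_{i_k}(z_k) dz_k` of the
forms `u_r(z) dz`, along line segments issued from `0`
(`∫_0^z f(s) ds = z ∫_0^1 f(tz) dt`). -/
def iterInt (u : ℕ+ → ℂ → ℂ) : Word → ℂ → ℂ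
  | [], _ => 1
  | r :: w, z => z * ∫ t in (0 : ℝ)..1, u r ((t : ℂ) * z) * iterInt u w ((t : ℂ) * z)

/-- The extension of `α_0^z` to series, `α_0^z(S) = ∑_w ⟨S|w⟩ α_0^z(w)`
(for the series `S` for which this sum converges), as a function of `z` in the disc. -/
def alpha (u : ℕ+ → ℂ → ℂ) (S : Series) : disc → ℂ := fun z =>
  ∑' w : Word, S w * iterInt u w z

/-- The inputs `u_{y_r} = e^{ℓ_r} ∂ℓ_r`. -/
def inputExp (r : ℕ+) (z : ℂ) : ℂ := Complex.exp (ell r z) * deriv (ell r) z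

/-- The inputs `u_{y_r} = ∂ℓ_r`. -/
def inputLog (r : ℕ+) (z : ℂ) : ℂ := deriv (ell r) z

/-- The linear span of the letters. -/
def spanY : Submodule ℂ Series := Submodule.span ℂ (Set.range letter)

/-- The linear span of the series `y_r^*`. -/
def spanYStar : Submodule ℂ Series := Submodule.span ℂ (Set.range fun r => kleeneStar (letter r))

end

end Eulerian

/-!
For each `r` the series `ℓ_r` sums to a logarithm of an entire function `F_r`, a Weierstrass
product over the zero set `⋃ χ ℤ_{≤ -1}`, and this gives the zeros of `e^{ℓ_r}` and the poles of
`e^{-ℓ_r}`.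

The functions `ℓ_r` are separated by their logarithmic singularities. The point `e^{iπ/n}` of the
unit circle is a zero of `F_n` but of no `F_r` with `r < n`, so in a polynomial relation between
`ℓ_1, …, ℓ_n` every function except `ℓ_n` continues analytically to that point, while `ℓ_n` tends
to infinity there more slowly than every negative power of the distance. Hence all coefficients of
the relation, as a polynomial in `ℓ_n`, vanish. The same singularity makes `ℓ_r` transcendental
over `e^{ℓ_r}`.

The functions `F_r` are separated by their growth on the negative axis: `log |F_1 (-x)|` is
superlinear, and for `r ≥ 2` one has `log |F_r (-x)| ∼ π C_r x` along the half-integers, with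
`C_r = 1 / sin (π / r)` for even `r` and `C_r = cot (π / r)` for odd `r`. Since
`1 / sin θ = cot (θ / 2) - cot θ`, the `C_r` are combinations of cotangents `cot (π / N)` with `N`
odd or divisible by `4`. A rational relation between these is stable under Galois conjugation;
pairing its conjugates with an odd primitive character `χ` leaves multiples of `L(1, χ) ≠ 0`. Among
these `N`, only `1` and `12` are not the modulus of an odd primitive character, and the exception
`12` accounts for the only relation, `C_6 = 2 C_2`. That tie between `F_6` and `F_2 ^ 2` is broken
by the algebraic factors `x ^ (-3)` and `x ^ (-2)`. Two distinct monomials in the `F_r` are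
therefore never of comparable size.
-/

namespace Eulerian

open Filter Asymptotics

section PowerSeries

theorem two_le_of_ne_one {r : ℕ+} (h : r ≠ 1) : 2 ≤ (r : ℕ) := by
  have h1 : (r : ℕ) ≠ 1 := fun h' => h (PNat.coe_eq_one_iff.mp h')
  have := r.pos
  omega

theorem mem_disc {z : ℂ} : z ∈ disc ↔ ‖z‖ < 1 := by simp [disc]

theorem hasSum_zeta_nat {k : ℕ} (hk : 1 < k) :
    HasSum (fun n : ℕ => (((n + 1 : ℕ) : ℂ) ^ k)⁻¹) (riemannZeta k) := by
  have hs : Summable (fun n : ℕ => 1 / (n : ℂ) ^ k) := by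
    rw [← summable_norm_iff]
    simpa using (Real.summable_one_div_nat_pow.mpr hk)
  have h := hs.hasSum
  rw [← zeta_nat_eq_tsum_of_gt_one hk, ← hasSum_nat_add_iff' 1] at h
  simpa [show k ≠ 0 by omega] using h

theorem norm_zeta_nat_le {k : ℕ} (hk : 1 < k) : ‖riemannZeta k‖ ≤ 2 := by
  have h2 : HasSum (fun n : ℕ => (((n + 1 : ℕ) : ℝ) ^ 2)⁻¹) (Real.pi ^ 2 / 6) := by
    have h := hasSum_zeta_two
    rw [← hasSum_nat_add_iff' 1] at h
    simpa using h
  have h1 := (hasSum_zeta_nat hk).tsum_eq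
  rw [← h1]
  refine (tsum_of_norm_bounded h2 fun n => ?_).trans ?_
  · rw [norm_inv, norm_pow, Complex.norm_natCast]
    exact inv_anti₀ (by positivity) (pow_le_pow_right₀ (by simp) hk)
  · nlinarith [Real.pi_lt_d2, Real.pi_pos]

theorem norm_ellTerm_le (r : ℕ+) {z : ℂ} (hz : ‖z‖ ≤ 1) (k : ℕ) :
    ‖ellTerm r z k‖ ≤ 2 * (‖z‖ ^ (k + 1) / (k + 1)) := by
  unfold ellTerm
  split_ifs with h
  · rw [norm_div, norm_mul, norm_pow, norm_neg, Complex.norm_natCast, mul_div_assoc]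
    refine mul_le_mul (norm_zeta_nat_le (by omega)) (div_le_div₀ (by positivity)
      (pow_le_pow_of_le_one (norm_nonneg _) hz (by omega)) (by positivity) ?_)
      (by positivity) (by norm_num)
    push_cast; linarith
  · have hr := two_le_of_ne_one h
    rw [norm_div, norm_mul, norm_pow, norm_neg, norm_pow, Complex.norm_natCast, mul_div_assoc,
      ← pow_mul]
    refine mul_le_mul (norm_zeta_nat_le (by nlinarith)) (div_le_div₀ (by positivity)
      (pow_le_pow_of_le_one (norm_nonneg _) hz (by nlinarith)) (by positivity) ?_)
      (by positivity) (by norm_num)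
    push_cast; linarith

theorem hasSum_pow_succ_div {x : ℝ} (h0 : 0 ≤ x) (hx : x < 1) :
    HasSum (fun k : ℕ => 2 * (x ^ (k + 1) / (k + 1))) (2 * (-Real.log (1 - x))) :=
  (Real.hasSum_pow_div_log_of_abs_lt_one (by rwa [abs_of_nonneg h0])).mul_left 2

theorem summable_ellTerm (r : ℕ+) {z : ℂ} (hz : z ∈ disc) : Summable (ellTerm r z) :=
  Summable.of_norm_bounded (hasSum_pow_succ_div (norm_nonneg z) (mem_disc.mp hz)).summable
    fun k => norm_ellTerm_le r (mem_disc.mp hz).le k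

theorem norm_ell_le (r : ℕ+) {z : ℂ} (hz : z ∈ disc) :
    ‖ell r z‖ ≤ 1 + 2 * (-Real.log (1 - ‖z‖)) := by
  have hz' := mem_disc.mp hz
  unfold ell
  refine (norm_sub_le _ _).trans (add_le_add ?_ ?_)
  · split_ifs
    · rw [norm_mul, Complex.norm_real, Real.norm_of_nonneg
        (Real.one_half_lt_eulerMascheroniConstant.le.trans' (by norm_num))]
      have := Real.eulerMascheroniConstant_lt_two_thirds
      have := Real.one_half_lt_eulerMascheroniConstant
      nlinarith [norm_nonneg z]
    · simp
  · exact tsum_of_norm_bounded (hasSum_pow_succ_div (norm_nonneg z) hz')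
      fun k => norm_ellTerm_le r hz'.le k

theorem ell_zero (r : ℕ+) : ell r 0 = 0 := by
  have h : ∀ k, ellTerm r 0 k = 0 := fun k => by
    have := norm_ellTerm_le r (z := 0) (by simp) k
    simpa using this
  simp [ell, h]

theorem differentiableOn_ell (r : ℕ+) : DifferentiableOn ℂ (ell r) disc := by
  intro z hz
  obtain ⟨ρ, hzρ, hρ⟩ := exists_between (mem_disc.mp hz)
  have hρ0 : 0 ≤ ρ := (norm_nonneg z).trans hzρ.le
  have h : DifferentiableOn ℂ (fun w => ∑' k, ellTerm r w k) (Metric.ball 0 ρ) := by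
    refine Complex.differentiableOn_tsum_of_summable_norm
      (hasSum_pow_succ_div hρ0 hρ).summable (fun k => ?_) Metric.isOpen_ball fun k w hw => ?_
    · unfold ellTerm
      split_ifs <;> fun_prop
    · have hw' : ‖w‖ < ρ := by simpa using hw
      refine (norm_ellTerm_le r (hw'.le.trans hρ.le) k).trans ?_
      gcongr
  have h' : DifferentiableOn ℂ (ell r) (Metric.ball 0 ρ) := by
    refine DifferentiableOn.sub ?_ h
    split_ifs <;> fun_prop
  exact (h'.differentiableAt
    (Metric.isOpen_ball.mem_nhds (by simpa using hzρ))).differentiableWithinAt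

theorem summable_inv_succ_sq : Summable (fun n : ℕ => (((n + 1 : ℕ) : ℝ) ^ 2)⁻¹) :=
  (summable_nat_add_iff (f := fun n : ℕ => ((n : ℝ) ^ 2)⁻¹) 1).mpr
    (Real.summable_nat_pow_inv.mpr one_lt_two)

theorem summable_mul_inv_pow {x : ℝ} (h0 : 0 ≤ x) (hx : x < 1) (a : ℕ → ℕ) (ha : ∀ k, 2 ≤ a k)
    (c : ℕ → ℂ) (hc : ∀ k, ‖c k‖ ≤ x ^ k) :
    Summable (fun p : ℕ × ℕ => c p.1 * (((p.2 + 1 : ℕ) : ℂ) ^ a p.1)⁻¹) := by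
  have hg : Summable (fun k : ℕ => x ^ k) := summable_geometric_of_lt_one h0 hx
  have hm := hg.mul_of_nonneg summable_inv_succ_sq (fun k => by positivity)
    (fun n => by positivity)
  refine Summable.of_norm_bounded hm fun p => ?_
  rw [norm_mul, norm_inv, norm_pow, Complex.norm_natCast]
  exact mul_le_mul (hc _) (inv_anti₀ (by positivity) (pow_le_pow_right₀ (by simp) (ha _)))
    (by positivity) (by positivity)

theorem hasSum_zeta_mul {x : ℝ} (h0 : 0 ≤ x) (hx : x < 1) (a : ℕ → ℕ) (ha : ∀ k, 2 ≤ a k)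
    (c : ℕ → ℂ) (hc : ∀ k, ‖c k‖ ≤ x ^ k) :
    HasSum (fun n : ℕ => ∑' k, c k * (((n + 1 : ℕ) : ℂ) ^ a k)⁻¹)
      (∑' k, riemannZeta (a k) * c k) := by
  have hsum := summable_mul_inv_pow h0 hx a ha c hc
  have h1 : ∀ k, riemannZeta (a k) * c k = ∑' n : ℕ, c k * (((n + 1 : ℕ) : ℂ) ^ a k)⁻¹ := by
    intro k
    rw [tsum_mul_left, (hasSum_zeta_nat (ha k)).tsum_eq, mul_comm]
  rw [tsum_congr h1]
  have h2 := hsum.prod_symm.prod.hasSum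
  rwa [← Summable.tsum_comm (f := fun k n => c k * (((n + 1 : ℕ) : ℂ) ^ a k)⁻¹) hsum]

end PowerSeries

section EntireExtension

/-- The entire function extending `e^{ℓ_r}`. -/
noncomputable def entireExp (r : ℕ+) (z : ℂ) : ℂ :=
  if r = 1 then (Complex.Gamma (1 + z))⁻¹
  else ∏' n : ℕ, (1 + z ^ (r : ℕ) / ((n + 1 : ℕ) : ℂ) ^ (r : ℕ))

theorem summable_norm_pow_div {r : ℕ} (hr : 2 ≤ r) (z : ℂ) :
    Summable (fun n : ℕ => ‖z ^ r / ((n + 1 : ℕ) : ℂ) ^ r‖) := by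
  have h2 : Summable (fun n : ℕ => (((n + 1 : ℕ) : ℝ) ^ r)⁻¹) :=
    (summable_nat_add_iff 1).mpr (Real.summable_nat_pow_inv.mpr hr)
  refine (h2.mul_left (‖z‖ ^ r)).congr fun n => ?_
  rw [norm_div, norm_pow, norm_pow, Complex.norm_natCast, div_eq_mul_inv]

theorem differentiable_tprod_one_add {r : ℕ} (hr : 2 ≤ r) :
    Differentiable ℂ (fun z : ℂ => ∏' n : ℕ, (1 + z ^ r / ((n + 1 : ℕ) : ℂ) ^ r)) := by
  intro z
  set ρ : ℝ := ‖z‖ + 1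
  have hu := summable_norm_pow_div hr (ρ : ℂ)
  have h := (hu.hasProdLocallyUniformlyOn_nat_one_add
    (f := fun n (w : ℂ) => w ^ r / ((n + 1 : ℕ) : ℂ) ^ r) (K := Metric.ball 0 ρ)
    Metric.isOpen_ball (.of_forall fun n w hw => ?_) (fun n => by fun_prop)).differentiableOn
    (.of_forall fun _ => by simpa [Finset.prod_fn] using
      DifferentiableOn.finsetProd (fun _ _ => by fun_prop)) Metric.isOpen_ball
  · exact h.differentiableAt (Metric.isOpen_ball.mem_nhds (by simp [ρ]))
  · rw [norm_div, norm_div, norm_pow, norm_pow, norm_pow, Complex.norm_real]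
    have hw' : ‖w‖ ≤ ‖ρ‖ := by
      rw [Real.norm_of_nonneg (by positivity)]
      simpa using (Metric.mem_ball.mp hw).le
    gcongr

theorem entireExp_one : entireExp 1 = fun z => (Complex.Gamma (1 + z))⁻¹ := by
  ext; simp [entireExp]

theorem entireExp_of_ne_one {r : ℕ+} (h : r ≠ 1) :
    entireExp r = fun z => ∏' n : ℕ, (1 + z ^ (r : ℕ) / ((n + 1 : ℕ) : ℂ) ^ (r : ℕ)) := by
  ext; simp [entireExp, h]

theorem differentiable_entireExp (r : ℕ+) : Differentiable ℂ (entireExp r) := by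
  rcases eq_or_ne r 1 with rfl | h
  · rw [entireExp_one]
    exact Complex.differentiable_one_div_Gamma.comp (differentiable_id.const_add 1)
  · rw [entireExp_of_ne_one h]
    exact differentiable_tprod_one_add (two_le_of_ne_one h)

theorem analyticAt_entireExp (r : ℕ+) (z : ℂ) : AnalyticAt ℂ (entireExp r) z :=
  (differentiable_entireExp r).analyticAt z

theorem hasProd_entireExp {r : ℕ+} (h : r ≠ 1) (z : ℂ) :
    HasProd (fun n : ℕ => 1 + z ^ (r : ℕ) / ((n + 1 : ℕ) : ℂ) ^ (r : ℕ)) (entireExp r z) := by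
  rw [entireExp_of_ne_one h]
  exact (multipliable_one_add_of_summable
    (summable_norm_pow_div (two_le_of_ne_one h) z)).hasProd

theorem norm_pow_div_lt_one {r : ℕ} (hr : r ≠ 0) {z : ℂ} (hz : z ∈ disc) (n : ℕ) :
    ‖z ^ r / ((n + 1 : ℕ) : ℂ) ^ r‖ < 1 := by
  rw [norm_div, norm_pow, norm_pow, Complex.norm_natCast]
  exact (div_le_self (by positivity) (one_le_pow₀ (by simp))).trans_lt
    (pow_lt_one₀ (norm_nonneg _) (mem_disc.mp hz) hr)

theorem one_add_ne_zero_of_norm_lt_one {w : ℂ} (hw : ‖w‖ < 1) : 1 + w ≠ 0 :=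
  Complex.slitPlane_ne_zero (Complex.mem_slitPlane_of_norm_lt_one hw)

theorem hasSum_neg_pow_add_div {w : ℂ} (hw : ‖w‖ < 1) (m : ℕ) :
    HasSum (fun k : ℕ => (-w) ^ (k + m) / ((k + m : ℕ) : ℂ))
      (-Complex.log (1 + w) - ∑ k ∈ Finset.range m, (-w) ^ k / (k : ℂ)) := by
  have h := Complex.hasSum_taylorSeries_neg_log (z := -w) (by rwa [norm_neg])
  rw [sub_neg_eq_add] at h
  exact (hasSum_nat_add_iff' m).mpr h

theorem hasSum_log_one_add_pow_div {r : ℕ+} (h : r ≠ 1) {z : ℂ} (hz : z ∈ disc) :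
    HasSum (fun n : ℕ => Complex.log (1 + z ^ (r : ℕ) / ((n + 1 : ℕ) : ℂ) ^ (r : ℕ)))
      (ell r z) := by
  have hr := two_le_of_ne_one h
  have hz' := mem_disc.mp hz
  have hzeta := hasSum_zeta_mul (norm_nonneg z) hz' (fun k => (k + 1) * (r : ℕ))
    (fun k => by nlinarith) (fun k => (-z ^ (r : ℕ)) ^ (k + 1) / ((k + 1 : ℕ) : ℂ)) (fun k => by
      rw [norm_div, norm_pow, norm_neg, norm_pow, Complex.norm_natCast, ← pow_mul]
      exact (div_le_self (by positivity) (by simp)).trans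
        (pow_le_pow_of_le_one (norm_nonneg _) hz'.le (by nlinarith)))
  have hlog (n : ℕ) : ∑' k : ℕ, (-z ^ (r : ℕ)) ^ (k + 1) / ((k + 1 : ℕ) : ℂ) *
      (((n + 1 : ℕ) : ℂ) ^ ((k + 1) * (r : ℕ)))⁻¹
      = -Complex.log (1 + z ^ (r : ℕ) / ((n + 1 : ℕ) : ℂ) ^ (r : ℕ)) := by
    have h1 := hasSum_neg_pow_add_div (norm_pow_div_lt_one r.ne_zero hz n) 1
    simp only [Finset.sum_range_one, Nat.cast_zero, div_zero, sub_zero] at h1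
    rw [← h1.tsum_eq]
    refine tsum_congr fun k => ?_
    rw [← neg_div, div_pow, ← pow_mul, mul_comm (k + 1)]
    field_simp
  simp_rw [hlog] at hzeta
  simpa only [neg_neg, ell, ellTerm, if_neg h, zero_sub, mul_div_assoc] using hzeta.neg

theorem exp_ell_of_ne_one {r : ℕ+} (h : r ≠ 1) {z : ℂ} (hz : z ∈ disc) :
    Complex.exp (ell r z) = entireExp r z := by
  rw [entireExp_of_ne_one h]
  exact (Complex.hasProd_of_hasSum_log
    (fun n => one_add_ne_zero_of_norm_lt_one (norm_pow_div_lt_one r.ne_zero hz n))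
    (hasSum_log_one_add_pow_div h hz)).tprod_eq.symm

theorem hasSum_sub_log_one_add_div {z : ℂ} (hz : z ∈ disc) :
    HasSum (fun n : ℕ => z / ((n + 1 : ℕ) : ℂ) - Complex.log (1 + z / ((n + 1 : ℕ) : ℂ)))
      (Real.eulerMascheroniConstant * z - ell 1 z) := by
  have hz' := mem_disc.mp hz
  have hzeta := hasSum_zeta_mul (norm_nonneg z) hz' (fun k => k + 2)
    (fun k => by omega) (fun k => (-z) ^ (k + 2) / ((k + 2 : ℕ) : ℂ)) (fun k => by
      rw [norm_div, norm_pow, norm_neg, Complex.norm_natCast]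
      exact (div_le_self (by positivity) (by push_cast; linarith)).trans
        (pow_le_pow_of_le_one (norm_nonneg _) hz'.le (by omega)))
  have hlog (n : ℕ) : ∑' k : ℕ, (-z) ^ (k + 2) / ((k + 2 : ℕ) : ℂ) *
      (((n + 1 : ℕ) : ℂ) ^ (k + 2))⁻¹
      = z / ((n + 1 : ℕ) : ℂ) - Complex.log (1 + z / ((n + 1 : ℕ) : ℂ)) := by
    have h1 := hasSum_neg_pow_add_div (w := z / ((n + 1 : ℕ) : ℂ))
      (by simpa using norm_pow_div_lt_one one_ne_zero hz n) 2
    simp only [Finset.sum_range_succ, Finset.range_zero, Finset.sum_empty, Nat.cast_zero, div_zero,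
      Nat.cast_one, div_one, pow_one, zero_add, sub_neg_eq_add] at h1
    rw [sub_eq_neg_add, ← h1.tsum_eq]
    refine tsum_congr fun k => ?_
    rw [← neg_div, div_pow]
    field_simp
  simp_rw [hlog] at hzeta
  convert hzeta using 1
  simp only [ell, ellTerm, if_true, mul_div_assoc, sub_sub_cancel]

theorem prod_range_one_add_add {M : ℕ} (z : ℂ) :
    ∏ j ∈ Finset.range M, (1 + z + j)
      = (M.factorial : ℂ) * ∏ n ∈ Finset.range M, (1 + z / ((n + 1 : ℕ) : ℂ)) := by
  induction M with
  | zero => simp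
  | succ M ih =>
    have hM : (M : ℂ) + 1 ≠ 0 := Nat.cast_add_one_ne_zero M
    rw [Finset.prod_range_succ, ih, Finset.prod_range_succ, Nat.factorial_succ]
    push_cast
    field_simp
    ring

theorem tendsto_prod_inv_Gamma {z : ℂ} (hz : Complex.Gamma (1 + z) ≠ 0) :
    Tendsto (fun N : ℕ => (N : ℂ) ^ (-z) * ∏ n ∈ Finset.range N, (1 + z / ((n + 1 : ℕ) : ℂ)))
      atTop (𝓝 (Complex.Gamma (1 + z))⁻¹) := by
  have h1 : Tendsto (fun N : ℕ => 1 + (1 + z) * ((N : ℂ))⁻¹) atTop (𝓝 1) := by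
    simpa using (tendsto_inv_atTop_nhds_zero_nat (𝕜 := ℂ)).const_mul (1 + z) |>.const_add 1
  have h2 := ((Complex.GammaSeq_tendsto_Gamma (1 + z)).inv₀ hz).div h1 one_ne_zero
  rw [div_one] at h2
  refine h2.congr' ?_
  filter_upwards [eventually_gt_atTop 0, h1.eventually_ne one_ne_zero] with N hN hN1
  have hN0 : (N : ℂ) ≠ 0 := Nat.cast_ne_zero.mpr hN.ne'
  have hfac : (N.factorial : ℂ) ≠ 0 := Nat.cast_ne_zero.mpr (Nat.factorial_ne_zero N)
  have hpow : (N : ℂ) ^ z ≠ 0 := Complex.cpow_ne_zero_iff.mpr (.inl hN0)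
  rw [Pi.div_apply, Complex.GammaSeq, inv_div, Finset.prod_range_succ, prod_range_one_add_add,
    Complex.cpow_add _ _ hN0, Complex.cpow_one, Complex.cpow_neg, div_eq_iff hN1]
  field_simp
  ring

theorem cpow_neg_mul_prod_eq_exp {z : ℂ} (hz : z ∈ disc) {N : ℕ} (hN : N ≠ 0) :
    (N : ℂ) ^ (-z) * ∏ n ∈ Finset.range N, (1 + z / ((n + 1 : ℕ) : ℂ))
      = Complex.exp (((harmonic N : ℝ) - Real.log N : ℝ) * z -
        ∑ n ∈ Finset.range N,
          (z / ((n + 1 : ℕ) : ℂ) - Complex.log (1 + z / ((n + 1 : ℕ) : ℂ)))) := by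
  have hprod : ∏ n ∈ Finset.range N, (1 + z / ((n + 1 : ℕ) : ℂ))
      = Complex.exp (∑ n ∈ Finset.range N, Complex.log (1 + z / ((n + 1 : ℕ) : ℂ))) := by
    rw [Complex.exp_sum]
    refine Finset.prod_congr rfl fun n _ =>
      (Complex.exp_log (one_add_ne_zero_of_norm_lt_one ?_)).symm
    simpa using norm_pow_div_lt_one one_ne_zero hz n
  have hharm : ((harmonic N : ℝ) : ℂ) * z = ∑ n ∈ Finset.range N, z / ((n + 1 : ℕ) : ℂ) := by
    rw [harmonic, Finset.sum_congr rfl fun n _ => div_eq_mul_inv z _, ← Finset.mul_sum, mul_comm]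
    push_cast
    rfl
  rw [hprod, Complex.cpow_def_of_ne_zero (Nat.cast_ne_zero.mpr hN), ← Complex.exp_add,
    Finset.sum_sub_distrib, Complex.ofReal_sub, sub_mul, hharm, ← Complex.natCast_log]
  congr 1
  ring

theorem exp_ell_one {z : ℂ} (hz : z ∈ disc) : Complex.exp (ell 1 z) = entireExp 1 z := by
  have hγ : Tendsto (fun N : ℕ => (((harmonic N : ℝ) - Real.log N : ℝ) : ℂ)) atTop
      (𝓝 (Real.eulerMascheroniConstant : ℂ)) :=
    (Complex.continuous_ofReal.tendsto _).comp Real.tendsto_harmonic_sub_log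
  have hexp := (Complex.continuous_exp.tendsto _).comp
    ((hγ.mul_const z).sub (hasSum_sub_log_one_add_div hz).tendsto_sum_nat)
  rw [sub_sub_cancel] at hexp
  have hGamma := tendsto_prod_inv_Gamma (z := z) (Complex.Gamma_ne_zero_of_re_pos (by
    have := (abs_lt.mp ((Complex.abs_re_le_norm z).trans_lt (mem_disc.mp hz))).1
    simp only [Complex.add_re, Complex.one_re]
    linarith))
  rw [entireExp_one]
  refine tendsto_nhds_unique (hexp.congr' ?_) hGamma
  filter_upwards [eventually_ne_atTop 0] with N hN
  exact (cpow_neg_mul_prod_eq_exp hz hN).symm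

theorem exp_ell (r : ℕ+) {z : ℂ} (hz : z ∈ disc) : Complex.exp (ell r z) = entireExp r z := by
  rcases eq_or_ne r 1 with rfl | h
  · exact exp_ell_one hz
  · exact exp_ell_of_ne_one h hz

theorem entireExp_zero (r : ℕ+) : entireExp r 0 = 1 := by
  rw [← exp_ell r (mem_disc.mpr (by simp)), ell_zero, Complex.exp_zero]

theorem entireExp_ne_zero_of_mem_disc (r : ℕ+) {z : ℂ} (hz : z ∈ disc) : entireExp r z ≠ 0 := by
  rw [← exp_ell r hz]
  exact Complex.exp_ne_zero _

end EntireExtension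

section ZeroSet

theorem tprod_one_add_eq_zero_iff {u : ℕ → ℂ} (hu : Summable fun n => ‖u n‖) :
    ∏' n, (1 + u n) = 0 ↔ ∃ n, 1 + u n = 0 := by
  constructor
  · intro h
    by_contra! hne
    exact tprod_one_add_ne_zero_of_summable hne hu h
  · exact tprod_of_exists_eq_zero

theorem entireExp_one_eq_zero_iff (z : ℂ) :
    entireExp 1 z = 0 ↔ z ∈ ⋃ χ ∈ rootsG 1, negRay χ := by
  simp only [Set.mem_iUnion, exists_prop, rootsG, negRay, Set.mem_ofPred_eq, entireExp_one,
    inv_eq_zero, Complex.Gamma_eq_zero_iff, PNat.one_coe, pow_one, Nat.sub_self, pow_zero,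
    exists_eq_left, one_mul]
  constructor
  · rintro ⟨m, hm⟩
    exact ⟨-(m + 1), by omega, by push_cast; linear_combination hm⟩
  · rintro ⟨n, hn, rfl⟩
    refine ⟨(-1 - n).toNat, ?_⟩
    rw [← Int.cast_natCast (R := ℂ), Int.toNat_of_nonneg (by omega)]
    push_cast; ring

theorem neg_pow_eq_neg_one_iff_mem_rootsG {r : ℕ+} {χ : ℂ} :
    (-χ) ^ (r : ℕ) = -1 ↔ χ ∈ rootsG r := by
  obtain ⟨k, hk⟩ : ∃ k, (r : ℕ) = k + 1 := ⟨r - 1, by have := r.pos; omega⟩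
  rw [rootsG, Set.mem_ofPred_eq, hk, Nat.add_sub_cancel, neg_pow]
  rcases neg_one_pow_eq_or ℂ k with h | h <;> simp [pow_succ' (-1 : ℂ), h, neg_eq_iff_eq_neg]

theorem entireExp_eq_zero_iff_of_ne_one {r : ℕ+} (h : r ≠ 1) (z : ℂ) :
    entireExp r z = 0 ↔ z ∈ ⋃ χ ∈ rootsG r, negRay χ := by
  simp only [Set.mem_iUnion, exists_prop, negRay, Set.mem_ofPred_eq, entireExp_of_ne_one h,
    tprod_one_add_eq_zero_iff (summable_norm_pow_div (two_le_of_ne_one h) z)]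
  constructor
  · rintro ⟨n, hn⟩
    have hn0 : ((n + 1 : ℕ) : ℂ) ≠ 0 := Nat.cast_ne_zero.mpr (by omega)
    refine ⟨-(z / ((n + 1 : ℕ) : ℂ)), neg_pow_eq_neg_one_iff_mem_rootsG.mp ?_, -(n + 1),
      by omega, ?_⟩
    · rw [neg_neg, div_pow, eq_neg_of_add_eq_zero_right hn]
    · push_cast at hn0 ⊢
      field_simp
  · rintro ⟨χ, hχ, n, hn, rfl⟩
    obtain ⟨m, rfl⟩ : ∃ m : ℕ, n = -((m + 1 : ℕ) : ℤ) := ⟨(-1 - n).toNat, by omega⟩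
    have hm0 : ((m + 1 : ℕ) : ℂ) ≠ 0 := Nat.cast_ne_zero.mpr (by omega)
    refine ⟨m, ?_⟩
    rw [Int.cast_neg, Int.cast_natCast, mul_neg, ← neg_mul, mul_pow,
      neg_pow_eq_neg_one_iff_mem_rootsG.mpr hχ, mul_div_assoc, div_self (pow_ne_zero _ hm0)]
    ring

theorem entireExp_eq_zero_iff (r : ℕ+) (z : ℂ) :
    entireExp r z = 0 ↔ z ∈ ⋃ χ ∈ rootsG r, negRay χ := by
  rcases eq_or_ne r 1 with rfl | h
  · exact entireExp_one_eq_zero_iff z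
  · exact entireExp_eq_zero_iff_of_ne_one h z

theorem eventually_entireExp_ne_zero (r : ℕ+) (z : ℂ) : ∀ᶠ w in 𝓝[≠] z, entireExp r w ≠ 0 := by
  refine (analyticAt_entireExp r z).eventually_eq_zero_or_eventually_ne_zero.resolve_left
    fun h => ?_
  have h1 : AnalyticOnNhd ℂ (entireExp r) Set.univ := fun w _ => analyticAt_entireExp r w
  have h2 := h1.eqOn_zero_of_preconnected_of_eventuallyEq_zero isPreconnected_univ
    (Set.mem_univ z) h (Set.mem_univ 0)
  rw [entireExp_zero] at h2
  exact one_ne_zero h2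

theorem meromorphicOrderAt_inv_neg_iff {f : ℂ → ℂ} {z : ℂ} (hf : AnalyticAt ℂ f z)
    (hne : ∀ᶠ w in 𝓝[≠] z, f w ≠ 0) : meromorphicOrderAt f⁻¹ z < 0 ↔ f z = 0 := by
  have hcont : Tendsto f (𝓝[≠] z) (𝓝 (f z)) := hf.continuousAt.tendsto.mono_left nhdsWithin_le_nhds
  rw [← tendsto_cobounded_iff_meromorphicOrderAt_neg hf.meromorphicAt.inv]
  constructor
  · intro h
    refine tendsto_nhds_unique hcont ?_
    simpa [Function.comp_def] using tendsto_inv₀_cobounded.comp h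
  · intro h
    refine tendsto_inv₀_nhdsNE_zero.comp (tendsto_nhdsWithin_iff.mpr ⟨h ▸ hcont, hne⟩)

theorem meromorphicOrderAt_inv_entireExp_neg_iff (r : ℕ+) (z : ℂ) :
    meromorphicOrderAt (entireExp r)⁻¹ z < 0 ↔ entireExp r z = 0 :=
  meromorphicOrderAt_inv_neg_iff (analyticAt_entireExp r z) (eventually_entireExp_ne_zero r z)

theorem norm_eq_one_of_mem_rootsG {r : ℕ+} {χ : ℂ} (h : χ ∈ rootsG r) : ‖χ‖ = 1 := by
  have h1 : ‖χ‖ ^ (r : ℕ) = 1 := by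
    rw [← norm_pow, show χ ^ (r : ℕ) = _ from h]
    simp
  exact (pow_eq_one_iff_of_nonneg (norm_nonneg _) r.pos.ne').mp h1

theorem pairwiseDisjoint_negRay (r : ℕ+) : (rootsG r).PairwiseDisjoint negRay := by
  intro χ hχ χ' hχ' hne
  refine Set.disjoint_left.mpr ?_
  rintro z ⟨n, hn, rfl⟩ ⟨m, hm, h⟩
  have h1 := congrArg norm h
  rw [norm_mul, norm_mul, norm_eq_one_of_mem_rootsG hχ, norm_eq_one_of_mem_rootsG hχ', one_mul,
    one_mul, Complex.norm_intCast, Complex.norm_intCast] at h1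
  have h2 : |n| = |m| := by exact_mod_cast h1
  rw [abs_of_neg (by omega), abs_of_neg (by omega), neg_inj] at h2
  subst h2
  exact hne (mul_right_cancel₀ (Int.cast_ne_zero.mpr (by omega)) h)

theorem finite_rootsG (r : ℕ+) : (rootsG r).Finite :=
  (Polynomial.nthRootsFinset (r : ℕ) ((-1 : ℂ) ^ ((r : ℕ) - 1))).finite_toSet.subset
    fun _ hχ => (Polynomial.mem_nthRootsFinset r.pos _).mpr hχ

theorem countable_iUnion_negRay (r : ℕ+) : (⋃ χ ∈ rootsG r, negRay χ).Countable := by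
  refine (finite_rootsG r).countable.biUnion fun χ _ => ?_
  refine (Set.countable_range fun n : ℤ => χ * (n : ℂ)).mono ?_
  rintro z ⟨n, -, rfl⟩
  exact ⟨n, rfl⟩

theorem eventually_notMem_iUnion_negRay (r : ℕ+) (z : ℂ) :
    ∀ᶠ w in 𝓝[≠] z, w ∉ ⋃ χ ∈ rootsG r, negRay χ :=
  (eventually_entireExp_ne_zero r z).mono fun w hw h => hw ((entireExp_eq_zero_iff r w).mpr h)

end ZeroSet

section LogarithmicSingularities

theorem exists_eq_pow_mul_of_analyticAt {ι : Type*} {T : Finset ι} (hT : T.Nonempty)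
    {F : ι → ℂ → ℂ} {z₀ : ℂ} (hF : ∀ i, AnalyticAt ℂ (F i) z₀)
    (hne : ∀ i ∈ T, ¬ ∀ᶠ z in 𝓝 z₀, F i z = 0) :
    ∃ (m : ℕ) (G : ι → ℂ → ℂ), (∀ i ∈ T, AnalyticAt ℂ (G i) z₀) ∧
      (∀ i ∈ T, ∀ᶠ z in 𝓝 z₀, F i z = (z - z₀) ^ m * G i z) ∧ ∃ i ∈ T, G i z₀ ≠ 0 := by
  classical
  obtain ⟨i₀, hi₀, hmin⟩ := T.exists_min_image (fun i => analyticOrderAt (F i) z₀) hT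
  obtain ⟨m, hm⟩ := ENat.ne_top_iff_exists.mp (mt analyticOrderAt_eq_top.mp (hne i₀ hi₀))
  obtain ⟨g, hg, hg0, hFg⟩ := (hF i₀).analyticOrderAt_eq_natCast.mp hm.symm
  have hex : ∀ i ∈ T, ∃ G : ℂ → ℂ, AnalyticAt ℂ G z₀ ∧
      ∀ᶠ z in 𝓝 z₀, F i z = (z - z₀) ^ m • G z := fun i hi =>
    (natCast_le_analyticOrderAt (hF i)).mp (hm.trans_le (hmin i hi))
  choose! G hG hFG using hex
  refine ⟨m, Function.update G i₀ g, fun i hi => ?_, fun i hi => ?_, i₀, hi₀, by simpa⟩ <;>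
    rcases eq_or_ne i i₀ with rfl | h
  · simpa
  · simpa [h] using hG i hi
  · simpa using hFg
  · simpa [h] using hFG i hi

theorem tendsto_sum_mul_pow_div_pow {α : Type*} {l : Filter α} {T : Finset ℕ}
    {g : ℕ → α → ℂ} {c : ℕ → ℂ} {L : α → ℂ} (hL : Tendsto (fun x => ‖L x‖) l atTop)
    (hg : ∀ k ∈ T, Tendsto (g k) l (𝓝 (c k))) {K : ℕ} (hK : K ∈ T)
    (hgL : ∀ k ∈ T, K < k → ∀ j : ℕ, Tendsto (fun x => g k x * L x ^ j) l (𝓝 0)) :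
    Tendsto (fun x => (∑ k ∈ T, g k x * L x ^ k) / L x ^ K) l (𝓝 (c K)) := by
  have hL0 : ∀ᶠ x in l, L x ≠ 0 :=
    (hL.eventually_gt_atTop 0).mono fun x hx => norm_pos_iff.mp hx
  have hLinv : Tendsto (fun x => (L x)⁻¹) l (𝓝 0) :=
    tendsto_zero_iff_norm_tendsto_zero.mpr (by
      simp only [norm_inv]; exact hL.inv_tendsto_atTop)
  have hterm : ∀ k ∈ T, Tendsto (fun x => g k x * L x ^ k / L x ^ K) l
      (𝓝 (if k = K then c K else 0)) := by
    intro k hk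
    rcases lt_trichotomy k K with hlt | rfl | hgt
    · have h := (hg k hk).mul (hLinv.pow (K - k))
      rw [zero_pow (by omega), mul_zero] at h
      rw [if_neg hlt.ne]
      refine h.congr' ?_
      filter_upwards [hL0] with x hx
      rw [← pow_mul_pow_sub (L x) hlt.le, inv_pow]
      field_simp
    · rw [if_pos rfl]
      refine (hg k hk).congr' ?_
      filter_upwards [hL0] with x hx
      field_simp
    · rw [if_neg hgt.ne']
      refine (hgL k hk hgt (k - K)).congr' ?_
      filter_upwards [hL0] with x hx
      rw [← pow_mul_pow_sub (L x) hgt.le]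
      field_simp
  simpa only [Finset.sum_div, Finset.sum_ite_eq', if_pos hK] using tendsto_finsetSum T hterm

theorem not_eventually_sum_mul_pow_eq_zero {α : Type*} {l : Filter α} [l.NeBot] {T : Finset ℕ}
    {g : ℕ → α → ℂ} {c : ℕ → ℂ} {L : α → ℂ} (hL : Tendsto (fun x => ‖L x‖) l atTop)
    (hg : ∀ k ∈ T, Tendsto (g k) l (𝓝 (c k))) (hc : ∃ k ∈ T, c k ≠ 0)
    (hgL : ∀ k ∈ T, c k = 0 → ∀ j : ℕ, Tendsto (fun x => g k x * L x ^ j) l (𝓝 0)) :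
    ¬ ∀ᶠ x in l, ∑ k ∈ T, g k x * L x ^ k = 0 := by
  classical
  intro h0
  obtain ⟨k, hk, hck⟩ := hc
  obtain ⟨K, hK, hmax⟩ := (T.filter (c · ≠ 0)).exists_max_image id ⟨k, by simp [hk, hck]⟩
  rw [Finset.mem_filter] at hK
  have h1 := tendsto_sum_mul_pow_div_pow hL hg hK.1 fun k hk hlt => hgL k hk (by
    by_contra hne
    exact hlt.not_ge (hmax k (Finset.mem_filter.mpr ⟨hk, hne⟩)))
  refine hK.2 (tendsto_nhds_unique h1 (tendsto_const_nhds.congr' ?_))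
  filter_upwards [h0] with x hx
  rw [hx, zero_div]

/-- The algebra of functions on the disc which are holomorphic and continue analytically to a
neighbourhood of `z₀`. -/
def analyticSubalgebra (z₀ : ℂ) : Subalgebra ℂ (disc → ℂ) where
  carrier := {f | ∃ F : ℂ → ℂ, DifferentiableOn ℂ F disc ∧ AnalyticAt ℂ F z₀ ∧
    ∀ z : disc, f z = F z}
  mul_mem' := by
    rintro f g ⟨F, hF, hF', hf⟩ ⟨G, hG, hG', hg⟩
    exact ⟨fun z => F z * G z, hF.mul hG, hF'.mul hG', fun z => by simp [hf, hg]⟩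
  add_mem' := by
    rintro f g ⟨F, hF, hF', hf⟩ ⟨G, hG, hG', hg⟩
    exact ⟨fun z => F z + G z, hF.add hG, hF'.add hG', fun z => by simp [hf, hg]⟩
  algebraMap_mem' c := ⟨fun _ => c, differentiableOn_const c, analyticAt_const, fun _ => rfl⟩

/-- The radial path `s ↦ (1 - e^{-s}) z₀` from `0` to the boundary point `z₀` of the disc; in this
parametrization a logarithmic singularity at `z₀` grows linearly in `s`. -/
noncomputable def radial (z₀ : ℂ) (s : ℝ) : ℂ := ((1 - Real.exp (-s) : ℝ) : ℂ) * z₀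

theorem norm_radial {z₀ : ℂ} (h : ‖z₀‖ = 1) {s : ℝ} (hs : 0 ≤ s) :
    ‖radial z₀ s‖ = 1 - Real.exp (-s) := by
  rw [radial, norm_mul, h, mul_one, Complex.norm_real, Real.norm_of_nonneg]
  have := Real.exp_le_one_iff.mpr (neg_nonpos.mpr hs)
  linarith

theorem radial_mem_disc {z₀ : ℂ} (h : ‖z₀‖ = 1) {s : ℝ} (hs : 0 ≤ s) : radial z₀ s ∈ disc := by
  rw [mem_disc, norm_radial h hs]
  linarith [Real.exp_pos (-s)]

theorem radial_sub (z₀ : ℂ) (s : ℝ) : radial z₀ s - z₀ = -(Real.exp (-s) : ℂ) * z₀ := by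
  rw [radial]; push_cast; ring

theorem tendsto_radial (z₀ : ℂ) : Tendsto (radial z₀) atTop (𝓝 z₀) := by
  have h1 : Tendsto (fun s : ℝ => Real.exp (-s)) atTop (𝓝 0) :=
    Real.tendsto_exp_atBot.comp tendsto_neg_atTop_atBot
  have h2 := ((Complex.continuous_ofReal.tendsto _).comp (h1.const_sub 1)).mul_const z₀
  rwa [sub_zero, Complex.ofReal_one, one_mul] at h2

theorem eqOn_zero_of_eventuallyEq_zero {z₀ : ℂ} (h : ‖z₀‖ = 1) {F : ℂ → ℂ}
    (hF : DifferentiableOn ℂ F disc) (h0 : ∀ᶠ z in 𝓝 z₀, F z = 0) : ∀ z ∈ disc, F z = 0 := by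
  obtain ⟨s, hs, hs0⟩ := (((tendsto_radial z₀).eventually h0.eventually_nhds).and
    (eventually_ge_atTop (0 : ℝ))).exists
  exact (hF.analyticOnNhd Metric.isOpen_ball).eqOn_zero_of_preconnected_of_eventuallyEq_zero
    (convex_ball 0 1).isPreconnected (radial_mem_disc h hs0) hs

theorem tendsto_mul_pow_radial {z₀ : ℂ} (h : ‖z₀‖ = 1) {f g : ℂ → ℂ} (hg : AnalyticAt ℂ g z₀)
    (hg0 : g z₀ = 0) {j : ℕ}
    (hf : Tendsto (fun s => Real.exp (-s) * ‖f (radial z₀ s)‖ ^ j) atTop (𝓝 0)) :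
    Tendsto (fun s => g (radial z₀ s) * f (radial z₀ s) ^ j) atTop (𝓝 0) := by
  have hO : (fun s => g (radial z₀ s)) =O[atTop] fun s => Real.exp (-s) := by
    have h1 := hg.differentiableAt.isBigO_sub.comp_tendsto (tendsto_radial z₀)
    simp only [hg0, sub_zero, Function.comp_def, radial_sub] at h1
    refine h1.trans (isBigO_of_le _ fun s => ?_)
    rw [norm_mul, norm_neg, h, mul_one, Complex.norm_real]
  refine (hO.mul (isBigO_refl (fun s => f (radial z₀ s) ^ j) atTop).norm_right).trans_tendsto ?_
  simpa only [norm_pow] using hf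

/- Powers of `z - z₀` decay exponentially along the radius, faster than any power of `f`. After a
common power of `z - z₀` is removed from the coefficients of a relation, it is therefore dominated
by the highest power of `f` whose coefficient does not vanish at `z₀`. -/
theorem transcendental_of_radial_growth {z₀ : ℂ} (h : ‖z₀‖ = 1) (f : ℂ → ℂ)
    (hinf : Tendsto (fun s => ‖f (radial z₀ s)‖) atTop atTop)
    (hsmall : ∀ k : ℕ, Tendsto (fun s => Real.exp (-s) * ‖f (radial z₀ s)‖ ^ k) atTop (𝓝 0)) :
    Transcendental (analyticSubalgebra z₀) (fun z : disc => f z) := by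
  rintro ⟨p, hp, hp0⟩
  have hz0 : z₀ ≠ 0 := by rintro rfl; simp at h
  choose F hFd hFa hF using fun k => (p.coeff k).2
  obtain ⟨m, G, hG, hFG, hG0⟩ := exists_eq_pow_mul_of_analyticAt
    (Polynomial.support_nonempty.mpr hp) hFa fun k hk h0 => Polynomial.mem_support_iff.mp hk
      (Subtype.ext (funext fun z => (hF k z).trans
        (eqOn_zero_of_eventuallyEq_zero h (hFd k) h0 z z.2)))
  refine not_eventually_sum_mul_pow_eq_zero hinf
    (fun k hk => ((hG k hk).continuousAt.tendsto).comp (tendsto_radial z₀)) hG0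
    (fun k hk hk0 j => tendsto_mul_pow_radial h (hG k hk) hk0 (hsmall j)) ?_
  have hFG' : ∀ᶠ s in atTop, ∀ k ∈ p.support,
      F k (radial z₀ s) = (radial z₀ s - z₀) ^ m * G k (radial z₀ s) :=
    (Filter.eventually_all_finset _).mpr fun k hk => (tendsto_radial z₀).eventually (hFG k hk)
  filter_upwards [hFG', eventually_ge_atTop (0 : ℝ)] with s hs hs0
  have hrel : ∑ k ∈ p.support, F k (radial z₀ s) * f (radial z₀ s) ^ k = 0 := by
    have h1 := congrFun hp0 ⟨radial z₀ s, radial_mem_disc h hs0⟩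
    rw [Polynomial.aeval_def, Polynomial.eval₂_eq_sum, Polynomial.sum_def, Finset.sum_apply] at h1
    rw [← Pi.zero_apply (M := fun _ : disc => ℂ) ⟨radial z₀ s, radial_mem_disc h hs0⟩, ← h1]
    refine Finset.sum_congr rfl fun k _ => ?_
    rw [← hF k ⟨radial z₀ s, radial_mem_disc h hs0⟩]
    rfl
  rw [Finset.sum_congr rfl fun k hk => by rw [hs k hk, mul_assoc], ← Finset.mul_sum] at hrel
  refine (mul_eq_zero.mp hrel).resolve_left (pow_ne_zero m ?_)
  rw [radial_sub]
  exact mul_ne_zero (neg_ne_zero.mpr (by exact_mod_cast (Real.exp_pos _).ne')) hz0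

theorem mem_analyticSubalgebra_of_hasDerivAt {z₀ : ℂ} {f f' : ℂ → ℂ}
    (hf : ∀ z ∈ disc, HasDerivAt f (f' z) z) (hf' : AnalyticAt ℂ f' z₀) :
    (fun z : disc => f z) ∈ analyticSubalgebra z₀ := by
  classical
  obtain ⟨ε, hε, hball⟩ := hf'.exists_ball_analyticOnNhd
  obtain ⟨g, hg⟩ := hball.differentiableOn.isExactOn_ball
  obtain ⟨c, hc⟩ : ∃ c : ℂ, ∀ z ∈ disc ∩ Metric.ball z₀ ε, f z - g z = c :=
    (Metric.isOpen_ball.inter Metric.isOpen_ball).exists_is_const_of_deriv_eq_zero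
      ((convex_ball 0 1).inter (convex_ball z₀ ε)).isPreconnected
      (fun z hz => ((hf z hz.1).sub (hg z hz.2)).differentiableAt.differentiableWithinAt)
      (fun z hz => ((hf z hz.1).sub (hg z hz.2)).deriv.trans (sub_self _))
  refine ⟨fun z => if z ∈ disc then f z else g z + c, ?_, ?_, fun z => by simp⟩
  · exact DifferentiableOn.congr (fun z hz => (hf z hz).differentiableAt.differentiableWithinAt)
      fun z hz => if_pos hz
  · have h1 : DifferentiableOn ℂ (fun z => g z + c) (Metric.ball z₀ ε) := fun z hz =>
      ((hg z hz).add_const c).differentiableAt.differentiableWithinAt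
    refine (h1.analyticAt (Metric.ball_mem_nhds z₀ hε)).congr ?_
    filter_upwards [Metric.ball_mem_nhds z₀ hε] with z hz
    split_ifs with hzd
    · rw [← hc z ⟨hzd, hz⟩, add_sub_cancel]
    · rfl

theorem expEllD_mem_analyticSubalgebra (r : ℕ+) (z₀ : ℂ) :
    expEllD r ∈ analyticSubalgebra z₀ :=
  ⟨entireExp r, (differentiable_entireExp r).differentiableOn, analyticAt_entireExp r z₀,
    fun z => exp_ell r z.2⟩

theorem hasDerivAt_ell (r : ℕ+) {z : ℂ} (hz : z ∈ disc) :
    HasDerivAt (ell r) (deriv (entireExp r) z / entireExp r z) z := by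
  have h1 := ((differentiableOn_ell r).differentiableAt
    (Metric.isOpen_ball.mem_nhds hz)).hasDerivAt
  have h2 : deriv (entireExp r) z = Complex.exp (ell r z) * deriv (ell r) z := by
    rw [← h1.cexp.deriv]
    refine EventuallyEq.deriv_eq ?_
    filter_upwards [Metric.isOpen_ball.mem_nhds hz] with w hw
    exact (exp_ell r hw).symm
  rwa [h2, ← exp_ell r hz, mul_div_cancel_left₀ _ (Complex.exp_ne_zero _)]

theorem ellD_mem_analyticSubalgebra (r : ℕ+) {z₀ : ℂ} (hr : entireExp r z₀ ≠ 0) :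
    ellD r ∈ analyticSubalgebra z₀ :=
  mem_analyticSubalgebra_of_hasDerivAt (fun _ hz => hasDerivAt_ell r hz)
    ((analyticAt_entireExp r z₀).deriv.div (analyticAt_entireExp r z₀) hr)

theorem tendsto_norm_ell_radial (r : ℕ+) {z₀ : ℂ} (h : ‖z₀‖ = 1) (hr : entireExp r z₀ = 0) :
    Tendsto (fun s => ‖ell r (radial z₀ s)‖) atTop atTop := by
  have h1 : Tendsto (fun s => ‖entireExp r (radial z₀ s)‖) atTop (𝓝[>] 0) := by
    rw [tendsto_nhdsWithin_iff]
    constructor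
    · have := ((analyticAt_entireExp r z₀).continuousAt.tendsto.comp (tendsto_radial z₀)).norm
      rwa [hr, norm_zero] at this
    · filter_upwards [eventually_ge_atTop (0 : ℝ)] with s hs
      exact norm_pos_iff.mpr (entireExp_ne_zero_of_mem_disc r (radial_mem_disc h hs))
  have h2 := tendsto_neg_atBot_atTop.comp (Real.tendsto_log_nhdsGT_zero.comp h1)
  refine tendsto_atTop_mono' _ ?_ h2
  filter_upwards [eventually_ge_atTop (0 : ℝ)] with s hs
  simp only [Function.comp_apply]
  rw [← exp_ell r (radial_mem_disc h hs), Complex.norm_exp, Real.log_exp]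
  exact (neg_le_abs _).trans (Complex.abs_re_le_norm _)

theorem tendsto_exp_mul_norm_ell_radial (r : ℕ+) {z₀ : ℂ} (h : ‖z₀‖ = 1) (k : ℕ) :
    Tendsto (fun s => Real.exp (-s) * ‖ell r (radial z₀ s)‖ ^ k) atTop (𝓝 0) := by
  have h1 := (Real.tendsto_pow_mul_exp_neg_atTop_nhds_zero k).const_mul ((3 : ℝ) ^ k)
  rw [mul_zero] at h1
  refine squeeze_zero' (Eventually.of_forall fun s => by positivity) ?_ h1
  filter_upwards [eventually_ge_atTop (1 : ℝ)] with s hs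
  have hs0 : 0 ≤ s := by linarith
  have h2 := norm_ell_le r (radial_mem_disc h hs0)
  rw [norm_radial h hs0, sub_sub_cancel, Real.log_exp, neg_neg] at h2
  rw [← mul_assoc, ← mul_pow, mul_comm]
  gcongr
  linarith

theorem transcendental_ellD (r : ℕ+) {z₀ : ℂ} (h : ‖z₀‖ = 1) (hr : entireExp r z₀ = 0) :
    Transcendental (analyticSubalgebra z₀) (ellD r) :=
  transcendental_of_radial_growth h (ell r) (tendsto_norm_ell_radial r h hr)
    (tendsto_exp_mul_norm_ell_radial r h)

/-- The zero `e^{iπ/n}` of `e^{ℓ_n}` on the unit circle. -/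
noncomputable def circleZero (n : ℕ+) : ℂ := Complex.exp (Real.pi / (n : ℕ) * Complex.I)

theorem norm_circleZero (n : ℕ+) : ‖circleZero n‖ = 1 := by
  rw [circleZero, show ((Real.pi : ℂ) / (n : ℕ) * Complex.I)
    = ((Real.pi / (n : ℕ) : ℝ) : ℂ) * Complex.I by push_cast; rfl, Complex.norm_exp_ofReal_mul_I]

theorem entireExp_eq_zero_iff_of_norm_eq_one (r : ℕ+) {z : ℂ} (hz : ‖z‖ = 1) :
    entireExp r z = 0 ↔ z ^ (r : ℕ) = -1 := by
  rw [entireExp_eq_zero_iff]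
  simp only [Set.mem_iUnion, exists_prop]
  constructor
  · rintro ⟨χ, hχ, n, hn, rfl⟩
    rw [norm_mul, norm_eq_one_of_mem_rootsG hχ, one_mul, Complex.norm_intCast] at hz
    have habs : |n| = 1 := by exact_mod_cast hz
    obtain rfl : n = -1 := by rw [abs_of_neg (by omega)] at habs; omega
    simpa using neg_pow_eq_neg_one_iff_mem_rootsG.mpr hχ
  · intro h
    exact ⟨-z, neg_pow_eq_neg_one_iff_mem_rootsG.mp (by rwa [neg_neg]), -1, le_rfl, by simp⟩

theorem circleZero_pow (n : ℕ+) (k : ℕ) :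
    circleZero n ^ k = Complex.exp (((Real.pi * k / (n : ℕ) : ℝ) : ℂ) * Complex.I) := by
  rw [circleZero, ← Complex.exp_nat_mul]
  congr 1
  push_cast
  ring

theorem entireExp_circleZero (n : ℕ+) : entireExp n (circleZero n) = 0 := by
  rw [entireExp_eq_zero_iff_of_norm_eq_one n (norm_circleZero n), circleZero_pow,
    mul_div_cancel_right₀ _ (Nat.cast_ne_zero.mpr n.pos.ne'), Complex.exp_pi_mul_I]

theorem entireExp_circleZero_ne_zero {r n : ℕ+} (h : r < n) :
    entireExp r (circleZero n) ≠ 0 := by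
  rw [Ne, entireExp_eq_zero_iff_of_norm_eq_one r (norm_circleZero n), circleZero_pow]
  intro h1
  have h2 := congrArg Complex.im h1
  rw [Complex.exp_ofReal_mul_I_im, Complex.neg_im, Complex.one_im, neg_zero] at h2
  have : (0 : ℝ) < (r : ℕ) := Nat.cast_pos.mpr r.pos
  have hn : (0 : ℝ) < (n : ℕ) := Nat.cast_pos.mpr n.pos
  have hrn : ((r : ℕ) : ℝ) < (n : ℕ) := Nat.cast_lt.mpr (by exact_mod_cast h)
  refine (Real.sin_pos_of_pos_of_lt_pi (by positivity) ?_).ne' h2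
  rw [div_lt_iff₀ hn]
  exact mul_lt_mul_of_pos_left hrn Real.pi_pos

theorem transcendental_adjoin_ellD {n : ℕ+} {S : Set (disc → ℂ)}
    (hS : S ⊆ analyticSubalgebra (circleZero n)) :
    Transcendental (Algebra.adjoin ℂ S) (ellD n) :=
  (transcendental_ellD n (norm_circleZero n) (entireExp_circleZero n)).of_tower_top_of_subalgebra_le
    (Algebra.adjoin_le hS)

theorem algebraicIndependent_ellD : AlgebraicIndependent ℂ ellD := by
  refine algebraicIndependent_of_finite_type fun t ht => ?_
  lift t to Finset ℕ+ using ht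
  induction t using Finset.induction_on_max with
  | empty =>
    rw [Finset.coe_empty]
    exact algebraicIndependent_empty_type_iff.mpr (FaithfulSMul.algebraMap_injective _ _)
  | insert n t hn ih =>
    rw [Finset.coe_insert]
    refine AlgebraicIndepOn.insert ih (transcendental_adjoin_ellD ?_)
    rintro _ ⟨r, hr, rfl⟩
    exact ellD_mem_analyticSubalgebra r (entireExp_circleZero_ne_zero (hn r hr))

theorem algebraicIndependent_ellD_expEllD {r : ℕ+} (hr : Transcendental ℂ (expEllD r)) :
    AlgebraicIndependent ℂ ![ellD r, expEllD r] := by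
  have h0 : AlgebraicIndependent ℂ (fun _ : Fin 1 => expEllD r) :=
    (algebraicIndependent_singleton_iff 0).mpr hr
  have h1 := (h0.option_iff_transcendental (ellD r)).mpr
    (transcendental_adjoin_ellD (by
      rintro _ ⟨_, rfl⟩
      exact expEllD_mem_analyticSubalgebra r _))
  have h2 := h1.comp ![none, some 0] (by
    intro i j; fin_cases i <;> fin_cases j <;> simp)
  convert h2 using 1
  ext i : 1
  fin_cases i <;> rfl

end LogarithmicSingularities

section CotangentSums

theorem abs_rpow_neg_sub_rpow_neg_le {n : ℕ} (hn : 1 ≤ n) {x y s : ℝ}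
    (hx : x ∈ Set.Icc (n : ℝ) (n + 1)) (hy : y ∈ Set.Icc (n : ℝ) (n + 1))
    (hs : s ∈ Set.Icc (1 : ℝ) 2) : |x ^ (-s) - y ^ (-s)| ≤ 2 / (n : ℝ) ^ 2 := by
  have hn1 : (1 : ℝ) ≤ n := by exact_mod_cast hn
  have hmono : ∀ w ∈ Set.Icc (n : ℝ) (n + 1),
      w ^ (-s) ∈ Set.Icc (((n : ℝ) + 1) ^ (-s)) ((n : ℝ) ^ (-s)) := fun w hw =>
    ⟨Real.rpow_le_rpow_of_nonpos (by linarith [hw.1]) hw.2 (by linarith [hs.1]),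
      Real.rpow_le_rpow_of_nonpos (by linarith) hw.1 (by linarith [hs.1])⟩
  have hbernoulli : 1 - s / (n + 1) ≤ ((n : ℝ) / (n + 1)) ^ s := by
    have h1 := one_add_mul_self_le_rpow_one_add (s := -1 / ((n : ℝ) + 1))
      (by rw [le_div_iff₀ (by positivity)]; linarith) hs.1
    convert h1 using 1
    · ring
    · congr 1; field_simp; ring
  have hpow : ((n : ℝ) + 1) ^ (-s) = (n : ℝ) ^ (-s) * ((n : ℝ) / (n + 1)) ^ s := by
    rw [Real.div_rpow (by positivity) (by positivity), ← mul_div_assoc,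
      ← Real.rpow_add (by positivity), neg_add_cancel, Real.rpow_zero,
      Real.rpow_neg (by positivity), one_div]
  calc |x ^ (-s) - y ^ (-s)| ≤ (n : ℝ) ^ (-s) - ((n : ℝ) + 1) ^ (-s) :=
        abs_sub_le_of_le_of_le (hmono x hx).1 (hmono x hx).2 (hmono y hy).1 (hmono y hy).2
    _ = (n : ℝ) ^ (-s) * (1 - ((n : ℝ) / (n + 1)) ^ s) := by rw [hpow]; ring
    _ ≤ (n : ℝ) ^ (-1 : ℝ) * (2 / n) := by
        refine mul_le_mul (Real.rpow_le_rpow_of_exponent_le hn1 (by linarith [hs.1])) ?_ ?_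
          (by positivity)
        · calc 1 - ((n : ℝ) / (n + 1)) ^ s ≤ s / (n + 1) := by linarith
            _ ≤ 2 / n := by gcongr <;> linarith [hs.2]
        · have : ((n : ℝ) / (n + 1)) ^ s ≤ 1 := Real.rpow_le_one (by positivity)
            (by rw [div_le_one (by positivity)]; linarith) (by linarith [hs.1])
          linarith
    _ = 2 / (n : ℝ) ^ 2 := by rw [Real.rpow_neg_one]; field_simp

/-- The terms of the Dirichlet series of the odd Hurwitz zeta function, for real `s`. -/
noncomputable def hurwitzTerm (a s : ℝ) (n : ℕ) : ℝ := ((n + a) ^ (-s) - (n + 1 - a) ^ (-s)) / 2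

theorem hasSum_hurwitzTerm {a : ℝ} (ha : a ∈ Set.Icc (0 : ℝ) 1) {s : ℝ} (hs : 1 < s) :
    HasSum (fun n => (hurwitzTerm a s n : ℂ))
      (HurwitzZeta.hurwitzZetaOdd (a : UnitAddCircle) s) := by
  have hcpow : ∀ x : ℝ, 0 ≤ x → 1 / (x : ℂ) ^ (s : ℂ) = ((x ^ (-s) : ℝ) : ℂ) := fun x hx => by
    rw [Real.rpow_neg hx, Complex.ofReal_inv, Complex.ofReal_cpow hx, one_div]
  refine (HurwitzZeta.hasSum_nat_hurwitzZetaOdd_of_mem_Icc ha (s := (s : ℂ))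
    (by simpa using hs)).congr_fun fun n => ?_
  have : (0 : ℝ) ≤ n := n.cast_nonneg
  have h1 := hcpow (n + a) (by linarith [ha.1])
  have h2 := hcpow (n + 1 - a) (by linarith [ha.2])
  push_cast at h1 h2
  rw [h1, h2, hurwitzTerm]
  push_cast
  rfl

theorem continuous_hurwitzTerm {a : ℝ} (ha : a ∈ Set.Ioo (0 : ℝ) 1) (n : ℕ) :
    Continuous fun s => hurwitzTerm a s n := by
  have : (0 : ℝ) ≤ n := n.cast_nonneg
  refine Continuous.div_const (Continuous.sub ?_ ?_) 2
  · exact (Real.continuous_const_rpow (by linarith [ha.1])).comp continuous_neg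
  · exact (Real.continuous_const_rpow (by linarith [ha.2])).comp continuous_neg

theorem norm_hurwitzTerm_le {a : ℝ} (ha : a ∈ Set.Icc (0 : ℝ) 1) {s : ℝ}
    (hs : s ∈ Set.Icc (1 : ℝ) 2) (n : ℕ) :
    ‖(hurwitzTerm a s (n + 1) : ℂ)‖ ≤ 1 / ((n + 1 : ℕ) : ℝ) ^ 2 := by
  have h := abs_rpow_neg_sub_rpow_neg_le (Nat.le_add_left 1 n) (x := (n + 1 : ℕ) + a)
    (y := (n + 1 : ℕ) + 1 - a) ⟨by linarith [ha.1], by linarith [ha.2]⟩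
    ⟨by linarith [ha.2], by linarith [ha.1]⟩ hs
  rw [Complex.norm_real, Real.norm_eq_abs, hurwitzTerm, abs_div, abs_two, div_le_iff₀ two_pos]
  exact h.trans_eq (by ring)

theorem tendsto_tsum_hurwitzTerm_succ {a : ℝ} (ha : a ∈ Set.Ioo (0 : ℝ) 1) :
    Tendsto (fun s => ∑' n, (hurwitzTerm a s (n + 1) : ℂ)) (𝓝[>] 1)
      (𝓝 (∑' n, (hurwitzTerm a 1 (n + 1) : ℂ))) := by
  refine tendsto_tsum_of_dominated_convergence ((summable_nat_add_iff 1).mpr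
    (Real.summable_one_div_nat_pow.mpr one_lt_two)) (fun n => ?_) ?_
  · exact ((Complex.continuous_ofReal.comp (continuous_hurwitzTerm ha (n + 1))).tendsto 1).mono_left
      nhdsWithin_le_nhds
  · filter_upwards [Ioo_mem_nhdsGT (one_lt_two (α := ℝ))] with s hs n
    exact norm_hurwitzTerm_le (Set.Ioo_subset_Icc_self ha) ⟨hs.1.le, hs.2.le⟩ n

theorem hasSum_hurwitzTerm_one {a : ℝ} (ha : a ∈ Set.Ioo (0 : ℝ) 1) :
    HasSum (fun n => (hurwitzTerm a 1 n : ℂ))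
      (HurwitzZeta.hurwitzZetaOdd (a : UnitAddCircle) 1) := by
  have hIcc := Set.Ioo_subset_Icc_self ha
  have hL : Tendsto (fun s : ℝ => HurwitzZeta.hurwitzZetaOdd (a : UnitAddCircle) s) (𝓝[>] 1)
      (𝓝 (HurwitzZeta.hurwitzZetaOdd (a : UnitAddCircle) 1)) := by
    have h := ((HurwitzZeta.differentiable_hurwitzZetaOdd (a : UnitAddCircle)).continuous.comp
      Complex.continuous_ofReal).tendsto 1
    rw [Function.comp_apply, Complex.ofReal_one] at h
    exact h.mono_left nhdsWithin_le_nhds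
  have h0 : Tendsto (fun s : ℝ => (hurwitzTerm a s 0 : ℂ)) (𝓝[>] 1) (𝓝 (hurwitzTerm a 1 0)) :=
    ((Complex.continuous_ofReal.comp (continuous_hurwitzTerm ha 0)).tendsto 1).mono_left
      nhdsWithin_le_nhds
  have hval : HurwitzZeta.hurwitzZetaOdd (a : UnitAddCircle) 1
      = hurwitzTerm a 1 0 + ∑' n, (hurwitzTerm a 1 (n + 1) : ℂ) := by
    refine tendsto_nhds_unique hL ((h0.add (tendsto_tsum_hurwitzTerm_succ ha)).congr' ?_)
    filter_upwards [self_mem_nhdsWithin] with s hs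
    rw [← (hasSum_hurwitzTerm hIcc hs).tsum_eq,
      (hasSum_hurwitzTerm hIcc hs).summable.tsum_eq_zero_add]
  have hsum : Summable fun n => (hurwitzTerm a 1 n : ℂ) := (summable_nat_add_iff 1).mp
    (Summable.of_norm_bounded ((summable_nat_add_iff 1).mpr
      (Real.summable_one_div_nat_pow.mpr one_lt_two))
      fun n => norm_hurwitzTerm_le hIcc ⟨le_rfl, one_le_two⟩ n)
  rw [hval, ← hsum.tsum_eq_zero_add]
  exact hsum.hasSum

theorem sum_range_hurwitzTerm_one (a : ℝ) (m : ℕ) :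
    ∑ n ∈ Finset.range m, (hurwitzTerm a 1 n : ℂ)
      = (∑ n ∈ Finset.range m, cotTerm a n + 1 / a - 1 / (m + a)) / 2 := by
  induction m with
  | zero => simp
  | succ m ih =>
    have h1 : (hurwitzTerm a 1 m : ℂ) = (1 / (m + a) - 1 / (m + 1 - a)) / 2 := by
      simp only [hurwitzTerm, Real.rpow_neg_one, one_div]
      push_cast
      rfl
    have h2 : (1 : ℂ) / (a - (m + 1)) = -(1 / (m + 1 - a)) := by
      rw [← neg_sub, one_div_neg_eq_neg_one_div]
    rw [Finset.sum_range_succ, Finset.sum_range_succ, ih, h1, cotTerm, h2]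
    push_cast
    ring

theorem ofReal_mem_integerComplement {a : ℝ} (ha : a ∈ Set.Ioo (0 : ℝ) 1) :
    (a : ℂ) ∈ Complex.integerComplement := by
  rintro ⟨m, hm⟩
  obtain rfl : (m : ℝ) = a := by exact_mod_cast hm
  have h0 : 0 < m := by exact_mod_cast ha.1
  have h1 : m < 1 := by exact_mod_cast ha.2
  omega

theorem hurwitzZetaOdd_one {a : ℝ} (ha : a ∈ Set.Ioo (0 : ℝ) 1) :
    HurwitzZeta.hurwitzZetaOdd (a : UnitAddCircle) 1 = Real.pi / 2 * Complex.cot (Real.pi * a) := by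
  have hcot := (summable_cotTerm (ofReal_mem_integerComplement ha)).hasSum.tendsto_sum_nat
  rw [← cot_series_rep' (ofReal_mem_integerComplement ha)] at hcot
  have hinv : Tendsto (fun m : ℕ => (1 : ℂ) / (m + a)) atTop (𝓝 0) := by
    have h := (Complex.continuous_ofReal.tendsto 0).comp
      (tendsto_const_nhds (x := (1 : ℝ)) |>.div_atTop
        (tendsto_atTop_add_const_right atTop a tendsto_natCast_atTop_atTop))
    simpa [Function.comp_def] using h
  have h := ((hcot.add_const (1 / (a : ℂ))).sub hinv).div_const 2
  simp_rw [← sum_range_hurwitzTerm_one] at h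
  rw [tendsto_nhds_unique (hasSum_hurwitzTerm_one ha).tendsto_sum_nat h]
  ring

/-- The value `cot (π k / N)`. -/
noncomputable def cotVal (N k : ℕ) : ℂ := Complex.cot (Real.pi * ((k / N : ℝ) : ℂ))

theorem cotVal_periodic {N : ℕ} (hN : N ≠ 0) : Function.Periodic (cotVal N) N := fun k => by
  rw [cotVal, cotVal, Nat.cast_add, add_div, div_self (Nat.cast_ne_zero.mpr hN), Complex.ofReal_add,
    mul_add, Complex.ofReal_one, mul_one, Complex.cot, Complex.cot, Complex.cos_add_pi,
    Complex.sin_add_pi, neg_div_neg_eq]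

theorem cotVal_congr {N k m : ℕ} (hN : N ≠ 0) (h : k ≡ m [MOD N]) : cotVal N k = cotVal N m := by
  rw [← (cotVal_periodic hN).map_mod_nat k, ← (cotVal_periodic hN).map_mod_nat m, h]

theorem apply_zero_of_odd {N : ℕ} {χ : DirichletCharacter ℂ N} (hχ : χ.Odd) : χ 0 = 0 := by
  have h := DirichletCharacter.Odd.eval_neg χ 0 hχ
  rw [neg_zero] at h
  linear_combination h / 2

theorem ne_one_of_odd {N : ℕ} {χ : DirichletCharacter ℂ N} (hχ : χ.Odd) : χ ≠ 1 := by
  rintro rfl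
  have h : (1 : DirichletCharacter ℂ N) (-1) = -1 := hχ
  rw [MulChar.one_apply isUnit_one.neg] at h
  norm_num at h

theorem sum_mul_cotVal_ne_zero {N : ℕ} [NeZero N] {χ : DirichletCharacter ℂ N} (hχ : χ.Odd) :
    ∑ j : ZMod N, χ j * cotVal N j.val ≠ 0 := by
  have hL := DirichletCharacter.LFunction_apply_one_ne_zero (ne_one_of_odd hχ)
  rw [DirichletCharacter.LFunction, ZMod.LFunction_def_odd hχ.to_fun] at hL
  have hodd := right_ne_zero_of_mul hL
  contrapose! hodd
  rw [← mul_zero (Real.pi / 2 : ℂ), ← hodd, Finset.mul_sum]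
  refine Finset.sum_congr rfl fun j _ => ?_
  by_cases hj : j = 0
  · simp [hj, apply_zero_of_odd hχ]
  · have hN : (0 : ℝ) < N := Nat.cast_pos.mpr (NeZero.pos N)
    have hj0 : 0 < j.val := Nat.pos_of_ne_zero ((ZMod.val_eq_zero j).not.mpr hj)
    rw [ZMod.toAddCircle_apply, hurwitzZetaOdd_one ⟨by positivity,
      (div_lt_one hN).mpr (by exact_mod_cast ZMod.val_lt j)⟩, cotVal]
    ring

end CotangentSums

section GaloisConjugation

theorem inv_sub_one_eq_sum {K : Type*} [Field K] [CharZero K] {N : ℕ} (hN : N ≠ 0) {ω : K}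
    (h : ω ^ N = 1) (h1 : ω ≠ 1) :
    (ω - 1)⁻¹ = ∑ j ∈ Finset.range N, ((j / N : ℚ) : K) * ω ^ j := by
  have hsum : ∀ n : ℕ, (ω - 1) * ∑ j ∈ Finset.range n, (j : K) * ω ^ j
      = n * ω ^ n - ω * ∑ j ∈ Finset.range n, ω ^ j := by
    intro n
    induction n with
    | zero => simp
    | succ n ih =>
      rw [Finset.sum_range_succ, mul_add, ih, Finset.sum_range_succ]
      push_cast
      ring
  have hN' : (N : K) ≠ 0 := Nat.cast_ne_zero.mpr hN
  have hfactor : ∑ j ∈ Finset.range N, ((j / N : ℚ) : K) * ω ^ j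
      = (∑ j ∈ Finset.range N, (j : K) * ω ^ j) / N := by
    rw [Finset.sum_div]
    refine Finset.sum_congr rfl fun j _ => ?_
    push_cast
    ring
  refine inv_eq_of_mul_eq_one_right ?_
  rw [hfactor, ← mul_div_assoc, hsum N, geom_sum_eq h1, h, sub_self, zero_div, mul_zero, mul_one,
    sub_zero, div_self hN']

theorem exp_pow_ne_one {N k : ℕ} (hN : 2 ≤ N) (hk : k.Coprime N) :
    Complex.exp (2 * Real.pi * Complex.I / N) ^ k ≠ 1 := by
  rw [Ne, (Complex.isPrimitiveRoot_exp N (by omega)).pow_eq_one_iff_dvd]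
  intro h
  have := Nat.Coprime.eq_one_of_dvd hk.symm h
  omega

theorem cotVal_eq_inv {N k : ℕ} (hN : 2 ≤ N) (hk : k.Coprime N) :
    cotVal N k = Complex.I * (1 + 2 *
      (Complex.exp (2 * Real.pi * Complex.I / N) ^ k - 1)⁻¹) := by
  have h1 := exp_pow_ne_one hN hk
  have h2 : Complex.exp (2 * Real.pi * Complex.I / N) ^ k
      = Complex.exp (2 * Complex.I * (Real.pi * ((k / N : ℝ) : ℂ))) := by
    rw [← Complex.exp_nat_mul]
    congr 1
    push_cast
    ring
  rw [cotVal, Complex.cot_eq_exp_ratio, ← h2]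
  generalize Complex.exp (2 * Real.pi * Complex.I / N) ^ k = ω at h1
  have h3 : ω - 1 ≠ 0 := sub_ne_zero.mpr h1
  have h4 : 1 - ω ≠ 0 := sub_ne_zero.mpr h1.symm
  have hI := Complex.I_ne_zero
  field_simp
  linear_combination -(ω + 1) * (1 - ω) * Complex.I_sq

theorem cotVal_eq_aeval {N d : ℕ} (hN : 2 ≤ N) (hd : d ≠ 0) {k : ℕ} (hk : k.Coprime N) :
    cotVal N k = Complex.I * Polynomial.aeval
      (Complex.exp (2 * Real.pi * Complex.I / (N * d : ℕ)) ^ k)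
      (1 + 2 * ∑ j ∈ Finset.range N,
        Polynomial.C (j / N : ℚ) * Polynomial.X ^ (d * j)) := by
  have hpow : (Complex.exp (2 * Real.pi * Complex.I / (N * d : ℕ)) ^ k) ^ d
      = Complex.exp (2 * Real.pi * Complex.I / N) ^ k := by
    rw [← pow_mul, mul_comm k, pow_mul, ← Complex.exp_nat_mul]
    congr 2
    have : (d : ℂ) ≠ 0 := Nat.cast_ne_zero.mpr hd
    push_cast
    field_simp
  have hroot : (Complex.exp (2 * Real.pi * Complex.I / N) ^ k) ^ N = 1 := by
    rw [← pow_mul, mul_comm k N, pow_mul,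
      (Complex.isPrimitiveRoot_exp N (by omega)).pow_eq_one, one_pow]
  rw [cotVal_eq_inv hN hk, inv_sub_one_eq_sum (by omega) hroot (exp_pow_ne_one hN hk)]
  simp only [map_mul, map_add, map_one, map_sum, map_pow, Polynomial.aeval_X,
    Polynomial.aeval_C, map_ofNat, pow_mul, hpow, eq_ratCast]

theorem aeval_pow_eq_zero {K : Type*} [Field K] [CharZero K] {ζ : K} {M : ℕ} (hM : 0 < M)
    (hζ : IsPrimitiveRoot ζ M) {k : ℕ} (hk : k.Coprime M) {P : Polynomial ℚ}
    (h : Polynomial.aeval ζ P = 0) : Polynomial.aeval (ζ ^ k) P = 0 := by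
  refine Polynomial.aeval_eq_zero_of_dvd_aeval_eq_zero
    (p := Polynomial.cyclotomic M ℚ) ?_ ?_
  · rw [Polynomial.cyclotomic_eq_minpoly_rat hζ hM]
    exact minpoly.dvd ℚ ζ h
  · rw [Polynomial.cyclotomic_eq_minpoly_rat (hζ.pow_of_coprime k hk) hM]
    exact minpoly.aeval ℚ _

theorem sum_cotVal_eq_zero_of_coprime {S : Finset ℕ} {b : ℕ → ℚ} {M : ℕ} (hM : M ≠ 0)
    (hS : ∀ N ∈ S, 2 ≤ N ∧ N ∣ M) (h : ∑ N ∈ S, (b N : ℂ) * cotVal N 1 = 0)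
    {k : ℕ} (hk : k.Coprime M) : ∑ N ∈ S, (b N : ℂ) * cotVal N k = 0 := by
  set ζ := Complex.exp (2 * Real.pi * Complex.I / M) with hζ
  set P : Polynomial ℚ := ∑ N ∈ S, Polynomial.C (b N) * (1 + 2 *
    ∑ j ∈ Finset.range N, Polynomial.C (j / N : ℚ) * Polynomial.X ^ (M / N * j)) with hP
  have hPk : ∀ k : ℕ, k.Coprime M →
      ∑ N ∈ S, (b N : ℂ) * cotVal N k = Complex.I * Polynomial.aeval (ζ ^ k) P := by
    intro k hk
    rw [hP, map_sum, Finset.mul_sum]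
    refine Finset.sum_congr rfl fun N hN => ?_
    obtain ⟨hN2, d, rfl⟩ := hS N hN
    rw [cotVal_eq_aeval hN2 (right_ne_zero_of_mul hM) (Nat.Coprime.coprime_mul_right_right hk),
      Nat.mul_div_cancel_left d (by omega), map_mul, Polynomial.aeval_C, eq_ratCast]
    ring
  rw [hPk 1 (Nat.coprime_one_left M), pow_one] at h
  rw [hPk k hk, aeval_pow_eq_zero (Nat.pos_of_ne_zero hM) (Complex.isPrimitiveRoot_exp M hM) hk
    ((mul_eq_zero.mp h).resolve_left Complex.I_ne_zero), mul_zero]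

end GaloisConjugation

section OddPrimitiveCharacters

open ArithmeticFunction

/-- The sum of `χ a` over the primitive Dirichlet characters `χ` modulo `n`. A finite sum over a
set, so that no `NeZero n` is needed and Möbius inversion applies to it as a function of `n`. -/
noncomputable def primitiveCharSum (a : ℤ) (n : ℕ) : ℂ :=
  ∑ᶠ χ ∈ {χ : DirichletCharacter ℂ n | χ.IsPrimitive}, χ a

theorem bijOn_changeLevel_isPrimitive {n d : ℕ} [NeZero n] (h : d ∣ n) :
    Set.BijOn (DirichletCharacter.changeLevel h) {χ : DirichletCharacter ℂ d | χ.IsPrimitive}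
      {χ : DirichletCharacter ℂ n | χ.conductor = d} := by
  refine ⟨fun χ hχ => ?_, (DirichletCharacter.changeLevel_injective h).injOn, ?_⟩
  · exact (DirichletCharacter.conductor_changeLevel χ h).trans hχ
  · rintro χ rfl
    exact ⟨χ.primitiveCharacter, χ.primitiveCharacter_isPrimitive,
      χ.changeLevel_primitiveCharacter⟩

theorem primitiveCharSum_eq_finsum_conductor {a : ℤ} (ha : IsUnit a) {n d : ℕ} [NeZero n]
    (h : d ∣ n) :
    primitiveCharSum a d = ∑ᶠ χ ∈ {χ : DirichletCharacter ℂ n | χ.conductor = d}, χ a :=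
  finsum_mem_eq_of_bijOn _ (bijOn_changeLevel_isPrimitive h) fun χ _ =>
    (χ.changeLevel_eq_cast_of_dvd' h (isCoprime_one_left.of_isCoprime_of_dvd_left ha.dvd)).symm

theorem sum_divisors_primitiveCharSum {a : ℤ} (ha : IsUnit a) {n : ℕ} (hn : 0 < n) :
    ∑ d ∈ n.divisors, primitiveCharSum a d = if (n : ℤ) ∣ a - 1 then (n.totient : ℂ) else 0 := by
  classical
  have : NeZero n := ⟨hn.ne'⟩
  have hmaps : ∀ χ ∈ (Finset.univ : Finset (DirichletCharacter ℂ n)), χ.conductor ∈ n.divisors :=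
    fun χ _ => Nat.mem_divisors.mpr ⟨χ.conductor_dvd_level, hn.ne'⟩
  have hone : (a : ZMod n) = 1 ↔ (n : ℤ) ∣ a - 1 := by
    rw [← ZMod.intCast_zmod_eq_zero_iff_dvd, Int.cast_sub, Int.cast_one, sub_eq_zero]
  rw [← if_congr hone rfl rfl, ← DirichletCharacter.sum_characters_eq ℂ (a : ZMod n),
    ← Finset.sum_fiberwise_of_maps_to hmaps]
  refine Finset.sum_congr rfl fun d hd => ?_
  rw [primitiveCharSum_eq_finsum_conductor ha (Nat.dvd_of_mem_divisors hd),
    ← finsum_mem_finset_eq_sum]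
  simp only [Set.mem_ofPred_eq, Finset.mem_filter, Finset.mem_univ, true_and]

theorem primitiveCharSum_eq_sum_moebius {a : ℤ} (ha : IsUnit a) {n : ℕ} (hn : 0 < n) :
    primitiveCharSum a n = ∑ x ∈ n.divisorsAntidiagonal,
      (moebius x.1 : ℂ) * if (x.2 : ℤ) ∣ a - 1 then (x.2.totient : ℂ) else 0 :=
  (sum_eq_iff_sum_mul_moebius_eq.mp (fun _ hm => sum_divisors_primitiveCharSum ha hm) n hn).symm

/-- Euler's totient as an integer-valued arithmetic function. -/
def totientFun : ArithmeticFunction ℤ where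
  toFun n := n.totient
  map_zero' := by simp

theorem totientFun_apply (n : ℕ) : totientFun n = n.totient := rfl

theorem isMultiplicative_totientFun : totientFun.IsMultiplicative :=
  ⟨by simp [totientFun_apply], fun h => by simp [totientFun_apply, Nat.totient_mul h]⟩

/-- The number of primitive Dirichlet characters modulo `n`, as the Dirichlet convolution of the
Möbius function with Euler's totient. -/
def primitiveCount : ArithmeticFunction ℤ :=
  moebius * totientFun

theorem isMultiplicative_primitiveCount : primitiveCount.IsMultiplicative :=
  isMultiplicative_moebius.mul isMultiplicative_totientFun

theorem primitiveCharSum_one {n : ℕ} (hn : 0 < n) : primitiveCharSum 1 n = primitiveCount n := by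
  rw [primitiveCharSum_eq_sum_moebius isUnit_one hn, primitiveCount, mul_apply]
  simp [totientFun_apply]

theorem primitiveCount_prime_pow_succ {p : ℕ} (hp : p.Prime) (k : ℕ) :
    primitiveCount (p ^ (k + 1)) = (p ^ (k + 1)).totient - (p ^ k).totient := by
  have hvanish : ∀ i ∈ Finset.range k, moebius (p ^ (i + 1 + 1)) = 0 := fun i _ => by
    rw [moebius_apply_prime_pow hp (Nat.succ_ne_zero _), if_neg (by omega)]
  rw [primitiveCount, mul_apply, Nat.sum_divisorsAntidiagonal fun d e => moebius d * totientFun e,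
    Nat.sum_divisors_prime_pow hp, Finset.sum_range_succ', Finset.sum_range_succ',
    Finset.sum_eq_zero fun i hi => by rw [hvanish i hi, zero_mul]]
  simp only [zero_add, pow_one, pow_zero, moebius_apply_prime hp, moebius_apply_one,
    Nat.div_one, totientFun_apply, pow_succ p k, Nat.mul_div_cancel _ hp.pos]
  ring

theorem primitiveCount_prime {p : ℕ} (hp : p.Prime) : primitiveCount p = p - 2 := by
  have h := primitiveCount_prime_pow_succ hp 0
  rw [zero_add, pow_one, pow_zero, Nat.totient_one, Nat.totient_prime hp,
    Nat.cast_sub hp.one_le] at h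
  linear_combination h

theorem primitiveCount_prime_pow_add_two {p : ℕ} (hp : p.Prime) (k : ℕ) :
    primitiveCount (p ^ (k + 2)) = p ^ k * (p - 1) ^ 2 := by
  rw [primitiveCount_prime_pow_succ hp (k + 1), Nat.totient_prime_pow_succ hp,
    Nat.totient_prime_pow_succ hp]
  push_cast [Nat.cast_sub hp.one_le]
  ring

theorem primitiveCount_pos {n : ℕ} (hn : n ≠ 0) (h4 : 2 ∣ n → 4 ∣ n) : 0 < primitiveCount n := by
  induction n using Nat.recOnPosPrimePosCoprime with
  | zero => exact absurd rfl hn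
  | one => rw [isMultiplicative_primitiveCount.map_one]; exact one_pos
  | prime_pow p k hp hk =>
    have hp1 : (0 : ℤ) < p - 1 := by have := hp.two_le; omega
    match k with
    | 1 =>
      rw [pow_one, primitiveCount_prime hp]
      have : p ≠ 2 := by rintro rfl; omega
      have := hp.two_le
      omega
    | k + 2 =>
      rw [primitiveCount_prime_pow_add_two hp]
      have := hp.pos
      positivity
  | coprime a b ha hb hab iha ihb =>
    rw [isMultiplicative_primitiveCount.map_mul_of_coprime hab]
    refine mul_pos (iha (by omega) fun h => ?_) (ihb (by omega) fun h => ?_)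
    · exact ((hab.coprime_dvd_left h).pow_left 2).dvd_of_dvd_mul_right (h4 (h.mul_right b))
    · exact ((hab.symm.coprime_dvd_left h).pow_left 2).dvd_of_dvd_mul_left (h4 (h.mul_left a))

theorem dvd_twelve_of_primitiveCount_le_one {n : ℕ} (hn : n ≠ 0) (h4 : 2 ∣ n → 4 ∣ n)
    (h : primitiveCount n ≤ 1) : n ∣ 12 := by
  induction n using Nat.recOnPosPrimePosCoprime with
  | zero => exact absurd rfl hn
  | one => exact one_dvd _
  | prime_pow p k hp hk =>
    have hp2 := hp.two_le
    match k with
    | 1 =>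
      rw [pow_one, primitiveCount_prime hp] at h
      have : p ≠ 2 := by rintro rfl; omega
      obtain rfl : p = 3 := by omega
      norm_num
    | k + 2 =>
      rw [primitiveCount_prime_pow_add_two hp] at h
      obtain rfl : p = 2 := by
        by_contra hne
        have : (3 : ℤ) ≤ p := by omega
        nlinarith [one_le_pow₀ (n := k) (show (1 : ℤ) ≤ p by omega)]
      obtain rfl : k = 0 := by
        by_contra hk
        have := one_lt_pow₀ (show (1 : ℤ) < 2 by norm_num) hk
        norm_num at h
        omega
      norm_num
  | coprime a b ha hb hab iha ihb =>
    have ha4 : 2 ∣ a → 4 ∣ a := fun h =>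
      ((hab.coprime_dvd_left h).pow_left 2).dvd_of_dvd_mul_right (h4 (h.mul_right b))
    have hb4 : 2 ∣ b → 4 ∣ b := fun h =>
      ((hab.symm.coprime_dvd_left h).pow_left 2).dvd_of_dvd_mul_left (h4 (h.mul_left a))
    rw [isMultiplicative_primitiveCount.map_mul_of_coprime hab] at h
    have hapos := primitiveCount_pos (by omega) ha4
    have hbpos := primitiveCount_pos (by omega) hb4
    exact hab.mul_dvd_of_dvd_of_dvd (iha (by omega) ha4 (by nlinarith))
      (ihb (by omega) hb4 (by nlinarith))

theorem primitiveCharSum_neg_one {n : ℕ} (hn : 0 < n) :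
    primitiveCharSum (-1) n = moebius n + if 2 ∣ n then (moebius (n / 2) : ℂ) else 0 := by
  rw [primitiveCharSum_eq_sum_moebius isUnit_one.neg hn,
    Nat.sum_divisorsAntidiagonal' fun d e =>
      (moebius d : ℂ) * if (e : ℤ) ∣ -1 - 1 then (e.totient : ℂ) else 0]
  have hdvd : ∀ e : ℕ, (e : ℤ) ∣ -1 - 1 ↔ e ∈ ({1, 2} : Finset ℕ) := fun e => by
    rw [← Int.dvd_neg, Finset.mem_insert, Finset.mem_singleton, ← Nat.dvd_prime Nat.prime_two]
    exact Int.natCast_dvd_natCast (n := 2)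
  simp only [hdvd, mul_ite, mul_zero]
  rw [← Finset.sum_filter, Finset.filter_mem_eq_inter, Finset.inter_comm,
    ← Finset.filter_mem_eq_inter, Finset.sum_filter, Finset.sum_pair (by norm_num)]
  simp [hn.ne']

theorem moebius_eq_zero_of_four_dvd {n : ℕ} (hn : 4 ∣ n) : moebius n = 0 :=
  moebius_eq_zero_of_not_squarefree fun h => by
    simpa using Nat.isUnit_iff.mp (h 2 hn)

theorem exists_odd_isPrimitive {n : ℕ} (hn : Odd n ∨ 4 ∣ n) (hn0 : n ≠ 0) (hn1 : n ≠ 1)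
    (hn12 : n ≠ 12) : ∃ χ : DirichletCharacter ℂ n, χ.Odd ∧ χ.IsPrimitive := by
  by_contra! heven
  have hsum : primitiveCharSum 1 n = primitiveCharSum (-1) n :=
    finsum_mem_congr rfl fun χ hχ => by
      rw [Int.cast_neg, Int.cast_one, χ.even_or_odd.resolve_right fun h => heven χ h hχ, map_one]
  have h4 : 2 ∣ n → 4 ∣ n := fun h => hn.resolve_left fun hodd =>
    Nat.not_even_iff_odd.mpr hodd (even_iff_two_dvd.mpr h)
  have hcount : primitiveCount n = moebius n + if 2 ∣ n then moebius (n / 2) else 0 := by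
    rw [primitiveCharSum_one (Nat.pos_of_ne_zero hn0),
      primitiveCharSum_neg_one (Nat.pos_of_ne_zero hn0)] at hsum
    exact_mod_cast hsum
  have hpos := primitiveCount_pos hn0 h4
  have hle : primitiveCount n ≤ 1 := by
    rw [hcount]
    split_ifs with h2
    · rw [moebius_eq_zero_of_four_dvd (h4 h2), zero_add]
      exact (abs_le.mp abs_moebius_le_one).2
    · rw [add_zero]
      exact (abs_le.mp abs_moebius_le_one).2
  have hdvd := dvd_twelve_of_primitiveCount_le_one hn0 h4 hle
  obtain rfl | rfl : n = 3 ∨ n = 4 := by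
    have := Nat.le_of_dvd (by norm_num) hdvd
    interval_cases n <;> omega
  · rw [moebius_apply_prime Nat.prime_three, if_neg (by norm_num)] at hcount
    omega
  · rw [moebius_eq_zero_of_four_dvd dvd_rfl, if_pos (by norm_num),
      moebius_apply_prime Nat.prime_two] at hcount
    omega

end OddPrimitiveCharacters

section CotRelations

theorem cotVal_unitsMap {M N : ℕ} [NeZero M] [NeZero N] (h : N ∣ M) (u : (ZMod M)ˣ) :
    cotVal N (ZMod.unitsMap h u : ZMod N).val = cotVal N (u : ZMod M).val := by
  refine cotVal_congr (NeZero.ne N) ?_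
  rw [← ZMod.natCast_eq_natCast_iff, ZMod.natCast_zmod_val, ZMod.unitsMap_val, ZMod.natCast_val]

theorem exists_unitsMap_eq_and_unitsMap_eq_one {M N N' : ℕ} [NeZero M] [NeZero N]
    (hN : N ∣ M) (hN' : N' ∣ M) {u : (ZMod N)ˣ} (hu : ZMod.unitsMap (N.gcd_dvd_left N') u = 1) :
    ∃ v : (ZMod M)ˣ, ZMod.unitsMap hN v = u ∧ ZMod.unitsMap hN' v = 1 := by
  have hmod : (u : ZMod N).val ≡ 1 [MOD N.gcd N'] := by
    rw [← ZMod.natCast_eq_natCast_iff, ZMod.natCast_val, ← ZMod.unitsMap_val (N.gcd_dvd_left N'),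
      hu, Units.val_one, Nat.cast_one]
  obtain ⟨k, hk, hk'⟩ := Nat.chineseRemainder' hmod
  have hkN : k.Coprime N := by
    rw [Nat.Coprime, hk.gcd_eq]
    exact ZMod.val_coe_unit_coprime u
  have hkN' : k.Coprime N' := by
    rw [Nat.Coprime, hk'.gcd_eq]
    exact Nat.gcd_one_left _
  have hlcm : k.Coprime (N.lcm N') :=
    (hkN.mul_right hkN').coprime_dvd_right (Nat.lcm_dvd_mul N N')
  obtain ⟨v, hv⟩ := ZMod.unitsMap_surjective (Nat.lcm_dvd hN hN') (ZMod.unitOfCoprime k hlcm)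
  have hval : ∀ {d : ℕ} (hd : d ∣ N.lcm N'),
      (ZMod.unitsMap (hd.trans (Nat.lcm_dvd hN hN')) v : ZMod d) = k := fun hd => by
    rw [← ZMod.unitsMap_comp hd (Nat.lcm_dvd hN hN'), MonoidHom.comp_apply, hv, ZMod.unitsMap_def]
    simp
  refine ⟨v, Units.ext ?_, Units.ext ?_⟩
  · rw [hval (Nat.dvd_lcm_left N N'), ← ZMod.natCast_zmod_val (u : ZMod N),
      ZMod.natCast_eq_natCast_iff]
    exact hk
  · rw [hval (Nat.dvd_lcm_right N N'), Units.val_one, ← Nat.cast_one, ZMod.natCast_eq_natCast_iff]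
    exact hk'

theorem exists_unitsMap_eq_one_and_apply_ne_one {N d : ℕ} [NeZero N] {χ : DirichletCharacter ℂ N}
    (hχ : χ.IsPrimitive) (hd : d ∣ N) (hne : d ≠ N) :
    ∃ u : (ZMod N)ˣ, ZMod.unitsMap hd u = 1 ∧ χ u ≠ 1 := by
  have hker : ¬ (ZMod.unitsMap hd).ker ≤ χ.toUnitHom.ker := fun h => by
    have hcond := χ.conductor_dvd_of_mem_conductorSet
      ((DirichletCharacter.factorsThrough_iff_ker_unitsMap hd).mpr h)
    rw [(χ.isPrimitive_def).mp hχ] at hcond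
    exact hne (Nat.dvd_antisymm hd hcond)
  obtain ⟨u, hu, hχu⟩ := SetLike.not_le_iff_exists.mp hker
  refine ⟨u, hu, fun h => hχu (Units.ext ?_)⟩
  rw [MulChar.coe_toUnitHom, h, Units.val_one]

theorem sum_unitsMap_cotVal_eq_zero {M N N' : ℕ} [NeZero M] [NeZero N] [NeZero N']
    (hN : N ∣ M) (hN' : N' ∣ M) (h : ¬ N ∣ N') {χ : DirichletCharacter ℂ N} (hχ : χ.IsPrimitive) :
    ∑ u : (ZMod M)ˣ, χ (ZMod.unitsMap hN u : ZMod N) * cotVal N' (u : ZMod M).val = 0 := by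
  obtain ⟨u, hu, hχu⟩ := exists_unitsMap_eq_one_and_apply_ne_one hχ (N.gcd_dvd_left N')
    fun hgcd => h (Nat.gcd_eq_left_iff_dvd.mp hgcd)
  obtain ⟨v, hv, hv'⟩ := exists_unitsMap_eq_and_unitsMap_eq_one hN hN' hu
  have hshift : ∑ w : (ZMod M)ˣ, χ (ZMod.unitsMap hN w : ZMod N) * cotVal N' (w : ZMod M).val
      = χ u * ∑ w : (ZMod M)ˣ, χ (ZMod.unitsMap hN w : ZMod N) * cotVal N' (w : ZMod M).val := by
    rw [Finset.mul_sum, ← Equiv.sum_comp (Equiv.mulRight v)]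
    refine Finset.sum_congr rfl fun w _ => ?_
    rw [Equiv.coe_mulRight, ← cotVal_unitsMap hN', ← cotVal_unitsMap hN', map_mul, map_mul, hv,
      hv', mul_one, Units.val_mul, map_mul]
    ring
  by_contra h0
  exact hχu (mul_right_cancel₀ h0 (by rw [one_mul]; exact hshift.symm))

theorem sum_units_mul_eq_sum {N : ℕ} [NeZero N] (χ : DirichletCharacter ℂ N) (f : ZMod N → ℂ) :
    ∑ w : (ZMod N)ˣ, χ w * f w = ∑ j : ZMod N, χ j * f j := by
  refine Finset.sum_of_injOn Units.val (fun _ _ _ _ h => Units.ext h)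
    (fun _ _ => Finset.mem_coe.mpr (Finset.mem_univ _)) (fun j _ hj => ?_) (fun _ _ => rfl)
  rw [χ.map_nonunit, zero_mul]
  rintro ⟨w, rfl⟩
  exact hj ⟨w, by simp, rfl⟩

theorem sum_comp_monoidHom_of_surjective {G H R : Type*} [Group G] [Group H] [Fintype G] [Fintype H]
    [DecidableEq H] [CommSemiring R] {φ : G →* H} (hφ : Function.Surjective φ) (f : H → R) :
    ∑ g, f (φ g) = (Finset.univ.filter fun g => φ g = 1).card * ∑ h, f h := by
  rw [Finset.mul_sum, ← Finset.sum_fiberwise Finset.univ φ]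
  refine Finset.sum_congr rfl fun h _ => ?_
  rw [Finset.sum_congr rfl fun g hg => congrArg f (Finset.mem_filter.mp hg).2, Finset.sum_const,
    nsmul_eq_mul, MonoidHom.card_fiber_eq_of_mem_range φ (hφ h) (hφ 1)]

theorem sum_unitsMap_cotVal_ne_zero {M N : ℕ} [NeZero M] [NeZero N] (hN : N ∣ M)
    {χ : DirichletCharacter ℂ N} (hχ : χ.Odd) :
    ∑ u : (ZMod M)ˣ, χ (ZMod.unitsMap hN u : ZMod N) * cotVal N (u : ZMod M).val ≠ 0 := by
  have hsum := sum_comp_monoidHom_of_surjective (ZMod.unitsMap_surjective hN)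
    fun w => χ w * cotVal N (w : ZMod N).val
  simp only [cotVal_unitsMap] at hsum
  rw [hsum, sum_units_mul_eq_sum χ fun j => cotVal N j.val]
  refine mul_ne_zero (Nat.cast_ne_zero.mpr ?_) (sum_mul_cotVal_ne_zero hχ)
  exact Finset.card_ne_zero_of_mem
    (Finset.mem_filter.mpr ⟨Finset.mem_univ 1, map_one (ZMod.unitsMap hN)⟩)

theorem eq_zero_of_sum_mul_cotVal_one_eq_zero {S : Finset ℕ} {b : ℕ → ℚ} (hS : ∀ N ∈ S, 2 ≤ N)
    (h : ∑ N ∈ S, (b N : ℂ) * cotVal N 1 = 0) {N : ℕ} (hN : N ∈ S) (hmod : Odd N ∨ 4 ∣ N)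
    (h12 : N ≠ 12) (hmax : ∀ N' ∈ S, N ∣ N' → N' = N) : b N = 0 := by
  set M := ∏ N ∈ S, N
  have hne : ∀ N ∈ S, NeZero N := fun N hN => ⟨by have := hS N hN; omega⟩
  have : NeZero M := ⟨Finset.prod_ne_zero_iff.mpr fun N hN => (hne N hN).out⟩
  have := hne N hN
  have hdvd : ∀ N ∈ S, N ∣ M := fun N hN => Finset.dvd_prod_of_mem _ hN
  obtain ⟨χ, hodd, hprim⟩ := exists_odd_isPrimitive hmod (NeZero.ne N)
    (by have := hS N hN; omega) h12
  have hconj : ∀ u : (ZMod M)ˣ, ∑ N' ∈ S, (b N' : ℂ) * cotVal N' (u : ZMod M).val = 0 := fun u =>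
    sum_cotVal_eq_zero_of_coprime (NeZero.ne M) (fun N hN => ⟨hS N hN, hdvd N hN⟩) h
      (ZMod.val_coe_unit_coprime u)
  have hproj : ∑ N' ∈ S, (b N' : ℂ) * ∑ u : (ZMod M)ˣ,
      χ (ZMod.unitsMap (hdvd N hN) u : ZMod N) * cotVal N' (u : ZMod M).val = 0 := by
    simp_rw [Finset.mul_sum]
    rw [Finset.sum_comm]
    refine Finset.sum_eq_zero fun u _ => ?_
    rw [← mul_zero (χ (ZMod.unitsMap (hdvd N hN) u : ZMod N)), ← hconj u, Finset.mul_sum]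
    exact Finset.sum_congr rfl fun N' _ => by ring
  rw [Finset.sum_eq_single_of_mem N hN] at hproj
  · exact_mod_cast (mul_eq_zero.mp hproj).resolve_right (sum_unitsMap_cotVal_ne_zero _ hodd)
  · intro N' hN' hne'
    have := hne N' hN'
    rw [sum_unitsMap_cotVal_eq_zero (hdvd N hN) (hdvd N' hN') (mt (hmax N' hN') hne') hprim,
      mul_zero]

end CotRelations

section GrowthConstants

/-- The limit of `log |F_r (-x)| / (π x)` along the half-integers `x`, where `F_r` is the entire
extension of `e^{ℓ_r}` and `r ≥ 2`. -/
noncomputable def growthConst (r : ℕ+) : ℝ :=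
  if Even (r : ℕ) then 1 / Real.sin (Real.pi / r) else Real.cot (Real.pi / r)

/-- The largest index `N` such that `cot (π / N)` occurs in `growthConst r`. -/
def growthIndex (r : ℕ+) : ℕ := if Even (r : ℕ) then 2 * r else r

/-- The coefficient of `cot (π / N)` in `growthConst r`. -/
def cotCoeff (r : ℕ+) (N : ℕ) : ℚ :=
  (if N = growthIndex r then 1 else 0) - if Even (r : ℕ) ∧ N = r then 1 else 0

theorem growthConst_two : growthConst 2 = 1 := by
  rw [growthConst, if_pos (by decide), PNat.val_ofNat, Nat.cast_ofNat, Real.sin_pi_div_two, div_one]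

theorem growthConst_six : growthConst 6 = 2 := by
  rw [growthConst, if_pos (by decide), PNat.val_ofNat, Nat.cast_ofNat, Real.sin_pi_div_six,
    one_div_one_div]

theorem cot_half_sub_cot {x : ℝ} (hx : Real.sin x ≠ 0) :
    Real.cot (x / 2) - Real.cot x = 1 / Real.sin x := by
  obtain ⟨y, rfl⟩ : ∃ y, x = 2 * y := ⟨x / 2, by ring⟩
  rw [mul_div_cancel_left₀ _ (two_ne_zero' ℝ), Real.cot_eq_cos_div_sin, Real.cot_eq_cos_div_sin,
    Real.cos_two_mul]
  rw [Real.sin_two_mul] at hx ⊢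
  have hsin : Real.sin y ≠ 0 := fun h => hx (by rw [h]; ring)
  have hcos : Real.cos y ≠ 0 := fun h => hx (by rw [h]; ring)
  field_simp
  ring

theorem sin_pi_div_pos {x : ℝ} (hx : 1 < x) : 0 < Real.sin (Real.pi / x) :=
  Real.sin_pos_of_pos_of_lt_pi (div_pos Real.pi_pos (by linarith)) (div_lt_self Real.pi_pos hx)

theorem growthIndex_injective : Function.Injective growthIndex := by
  intro r s h
  rw [growthIndex, growthIndex] at h
  apply PNat.coe_injective
  split_ifs at h with hr hs hs
  · omega
  · exact absurd (h ▸ even_two_mul _) hs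
  · exact absurd (h ▸ even_two_mul _) hr
  · exact h

theorem le_growthIndex (r : ℕ+) : (r : ℕ) ≤ growthIndex r := by
  rw [growthIndex]
  split_ifs <;> omega

theorem odd_growthIndex_or_four_dvd (r : ℕ+) : Odd (growthIndex r) ∨ 4 ∣ growthIndex r := by
  rw [growthIndex]
  split_ifs with hr
  · obtain ⟨k, hk⟩ := hr
    exact Or.inr ⟨k, by omega⟩
  · exact Or.inl (Nat.not_even_iff_odd.mp hr)

theorem cotCoeff_growthIndex_self (r : ℕ+) : cotCoeff r (growthIndex r) = 1 := by
  rw [cotCoeff, if_pos rfl, if_neg, sub_zero]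
  rintro ⟨hr, h⟩
  rw [growthIndex, if_pos hr] at h
  have := r.pos
  omega

theorem le_growthIndex_of_cotCoeff_ne_zero {r : ℕ+} {N : ℕ} (h : cotCoeff r N ≠ 0) :
    N ≤ growthIndex r := by
  by_contra! hlt
  refine h ?_
  have := le_growthIndex r
  rw [cotCoeff, if_neg (by omega), if_neg (by omega), sub_zero]

theorem cotCoeff_growthIndex_of_le {r s : ℕ+} (hne : r ≠ s) (hle : growthIndex r ≤ growthIndex s) :
    cotCoeff r (growthIndex s) = 0 := by
  by_contra h
  exact hne (growthIndex_injective (hle.antisymm (le_growthIndex_of_cotCoeff_ne_zero h)))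

theorem cotVal_one (N : ℕ) : cotVal N 1 = (Real.cot (Real.pi / N) : ℂ) := by
  rw [cotVal, Nat.cast_one, ← Complex.ofReal_mul, mul_one_div, Complex.ofReal_cot]

theorem sum_cotCoeff_mul_cotVal {r : ℕ+} (hr : r ≠ 1) {S : Finset ℕ} (hrS : (r : ℕ) ∈ S)
    (hS : growthIndex r ∈ S) : ∑ N ∈ S, (cotCoeff r N : ℂ) * cotVal N 1 = growthConst r := by
  have hsum : ∑ N ∈ S, (cotCoeff r N : ℂ) * cotVal N 1
      = cotVal (growthIndex r) 1 - if Even (r : ℕ) then cotVal r 1 else 0 := by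
    simp only [cotCoeff, Rat.cast_sub, sub_mul, Finset.sum_sub_distrib]
    split_ifs with heven <;> simp [heven, hrS, hS, apply_ite (Rat.cast : ℚ → ℂ)]
  rw [hsum, growthConst, growthIndex]
  split_ifs
  · have hsin := (sin_pi_div_pos (x := r) (by exact_mod_cast two_le_of_ne_one hr)).ne'
    rw [cotVal_one, cotVal_one, ← cot_half_sub_cot hsin, Complex.ofReal_sub, Nat.cast_mul,
      Nat.cast_ofNat, mul_comm, div_div]
  · rw [cotVal_one, sub_zero]

theorem eq_zero_of_sum_mul_growthConst_eq_zero {T : Finset ℕ+} {d : ℕ+ → ℚ} (h1 : 1 ∉ T)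
    (h6 : 6 ∉ T) (h : ∑ r ∈ T, (d r : ℝ) * growthConst r = 0) : ∀ r ∈ T, d r = 0 := by
  by_contra! hne
  obtain ⟨r₁, hr₁, hd₁⟩ := hne
  set T' := T.filter fun r => d r ≠ 0
  obtain ⟨r₀, hr₀, hmax⟩ := T'.exists_max_image growthIndex ⟨r₁, Finset.mem_filter.mpr ⟨hr₁, hd₁⟩⟩
  have hT' : ∀ r ∈ T', r ≠ 1 := fun r hr hr1 => h1 (hr1 ▸ Finset.mem_of_mem_filter r hr)
  set S := Finset.Icc 2 (growthIndex r₀)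
  have hmem : ∀ r ∈ T', (r : ℕ) ∈ S ∧ growthIndex r ∈ S := fun r hr => by
    have := two_le_of_ne_one (hT' r hr)
    have := le_growthIndex r
    have := hmax r hr
    constructor <;> exact Finset.mem_Icc.mpr (by omega)
  have hsum : ∑ N ∈ S, ((∑ r ∈ T', d r * cotCoeff r N : ℚ) : ℂ) * cotVal N 1 = 0 := by
    calc ∑ N ∈ S, ((∑ r ∈ T', d r * cotCoeff r N : ℚ) : ℂ) * cotVal N 1
        = ∑ r ∈ T', (d r : ℂ) * ∑ N ∈ S, (cotCoeff r N : ℂ) * cotVal N 1 := by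
          simp only [Rat.cast_sum, Rat.cast_mul, Finset.sum_mul, Finset.mul_sum, mul_assoc]
          exact Finset.sum_comm
      _ = ((∑ r ∈ T', (d r : ℝ) * growthConst r : ℝ) : ℂ) := by
          rw [Complex.ofReal_sum]
          refine Finset.sum_congr rfl fun r hr => ?_
          rw [sum_cotCoeff_mul_cotVal (hT' r hr) (hmem r hr).1 (hmem r hr).2]
          push_cast
          rfl
      _ = 0 := by
          have hfilter : ∀ r ∈ T, (d r : ℝ) * growthConst r ≠ 0 → d r ≠ 0 := fun r _ hr hd =>
            hr (by rw [hd, Rat.cast_zero, zero_mul])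
          rw [Finset.sum_filter_of_ne hfilter, h, Complex.ofReal_zero]
  have hlead := eq_zero_of_sum_mul_cotVal_one_eq_zero (fun N hN => (Finset.mem_Icc.mp hN).1) hsum
    (hmem r₀ hr₀).2 (odd_growthIndex_or_four_dvd r₀)
    (fun h12 => h6
      (growthIndex_injective (a₁ := r₀) (a₂ := 6) h12 ▸ Finset.mem_of_mem_filter r₀ hr₀))
    fun N hN hdvd => (Finset.mem_Icc.mp hN).2.antisymm
      (Nat.le_of_dvd (zero_lt_two.trans_le (Finset.mem_Icc.mp hN).1) hdvd)
  rw [Finset.sum_eq_single_of_mem r₀ hr₀ fun r hr hne => by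
    rw [cotCoeff_growthIndex_of_le hne (hmax r hr), mul_zero], cotCoeff_growthIndex_self,
    mul_one] at hlead
  exact (Finset.mem_filter.mp hr₀).2 hlead

theorem sum_mul_growthConst_eq_zero {T : Finset ℕ+} {d : ℕ+ → ℤ} (h1 : 1 ∉ T) (h2 : 2 ∈ T)
    (h6 : 6 ∈ T) (h : ∑ r ∈ T, (d r : ℝ) * growthConst r = 0) :
    (∀ r ∈ T, r ≠ 2 → r ≠ 6 → d r = 0) ∧ d 2 + 2 * d 6 = 0 := by
  have h26 : (2 : ℕ+) ∈ T.erase 6 := Finset.mem_erase.mpr ⟨by decide, h2⟩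
  set d' : ℕ+ → ℚ := Function.update (fun r => (d r : ℚ)) 2 (d 2 + 2 * d 6)
  have hsum : ∑ r ∈ T.erase 6, (d' r : ℝ) * growthConst r = 0 := by
    rw [← Finset.add_sum_erase _ _ h6, ← Finset.add_sum_erase _ _ h26, growthConst_two,
      growthConst_six] at h
    rw [← Finset.add_sum_erase _ _ h26, growthConst_two, ← h, Finset.sum_congr rfl fun r hr => by
      rw [show d' r = d r from Function.update_of_ne (Finset.ne_of_mem_erase hr) _ _,
        Rat.cast_intCast], show d' 2 = d 2 + 2 * d 6 from Function.update_self _ _ _]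
    push_cast
    ring
  have hd' := eq_zero_of_sum_mul_growthConst_eq_zero
    (fun h => h1 (Finset.mem_of_mem_erase h)) (Finset.notMem_erase _ _) hsum
  refine ⟨fun r hr hr2 hr6 => ?_, ?_⟩
  · exact_mod_cast (Function.update_of_ne hr2 _ _).symm.trans
      (hd' r (Finset.mem_erase.mpr ⟨hr6, hr⟩))
  · exact_mod_cast (Function.update_self _ _ _).symm.trans (hd' 2 h26)

end GrowthConstants

section PositiveAxis

open MeasureTheory

theorem integral_exp_neg_mul_exp_neg_mul_rpow {r t : ℝ} (hr : 0 < r) (ht : 0 < t) :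
    ∫ u in Set.Ioi 0, Real.exp (-t) * Real.exp (-t * u ^ r)
      = Real.exp (-t) * t ^ ((1 - 1 / r) - 1) * Real.Gamma (1 / r + 1) := by
  rw [integral_const_mul, integral_exp_neg_mul_rpow hr ht, ← mul_assoc]
  ring_nf

theorem integrable_exp_neg_mul_exp_neg_mul_rpow {r : ℝ} (hr : 1 < r) :
    Integrable (Function.uncurry fun u t : ℝ => Real.exp (-t) * Real.exp (-t * u ^ r))
      ((volume.restrict (Set.Ioi 0)).prod (volume.restrict (Set.Ioi 0))) := by
  have hr0 : 0 < r := one_pos.trans hr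
  have hs : 0 < 1 - 1 / r := sub_pos.mpr ((div_lt_one hr0).mpr hr)
  have : 0 < Real.Gamma (1 / r + 1) := Real.Gamma_pos_of_pos (by positivity)
  refine (integrable_prod_iff' (by fun_prop)).mpr ⟨?_, ?_⟩
  · filter_upwards [self_mem_ae_restrict measurableSet_Ioi] with t (ht : 0 < t)
    refine Integrable.of_integral_ne_zero ?_
    simp only [Function.uncurry_apply_pair]
    rw [integral_exp_neg_mul_exp_neg_mul_rpow hr0 ht]
    positivity
  · refine ((Real.GammaIntegral_convergent hs).mul_const (Real.Gamma (1 / r + 1))).congr ?_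
    filter_upwards [self_mem_ae_restrict measurableSet_Ioi] with t (ht : 0 < t)
    simp only [Function.uncurry_apply_pair, norm_mul, Real.norm_eq_abs, Real.abs_exp]
    rw [integral_exp_neg_mul_exp_neg_mul_rpow hr0 ht]

/-- Writing `1 / (1 + u ^ r)` as a Laplace integral turns the left side into the product
`Γ (1 + 1 / r) Γ (1 - 1 / r)`. -/
theorem integral_inv_one_add_rpow {r : ℝ} (hr : 1 < r) :
    ∫ u in Set.Ioi 0, (1 + u ^ r)⁻¹ = Real.pi / r / Real.sin (Real.pi / r) := by
  have hr0 : 0 < r := one_pos.trans hr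
  have hs : 0 < 1 - 1 / r := sub_pos.mpr ((div_lt_one hr0).mpr hr)
  calc ∫ u in Set.Ioi 0, (1 + u ^ r)⁻¹
      = ∫ u in Set.Ioi 0, ∫ t in Set.Ioi 0, Real.exp (-t) * Real.exp (-t * u ^ r) := by
        refine setIntegral_congr_fun measurableSet_Ioi fun u (hu : 0 < u) => ?_
        have hneg : -(1 + u ^ r) < 0 := neg_lt_zero.mpr (by positivity)
        have h := integral_exp_mul_Ioi hneg 0
        rw [mul_zero, Real.exp_zero, neg_div_neg_eq, one_div] at h
        rw [← h]
        refine setIntegral_congr_fun measurableSet_Ioi fun t _ => ?_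
        rw [← Real.exp_add]
        ring_nf
    _ = ∫ t in Set.Ioi 0, ∫ u in Set.Ioi 0, Real.exp (-t) * Real.exp (-t * u ^ r) :=
        integral_integral_swap (integrable_exp_neg_mul_exp_neg_mul_rpow hr)
    _ = ∫ t in Set.Ioi 0, Real.exp (-t) * t ^ ((1 - 1 / r) - 1) * Real.Gamma (1 / r + 1) :=
        setIntegral_congr_fun measurableSet_Ioi fun t ht =>
          integral_exp_neg_mul_exp_neg_mul_rpow hr0 ht
    _ = Real.pi / r / Real.sin (Real.pi / r) := by
        rw [integral_mul_const, ← Real.Gamma_eq_integral hs, Real.Gamma_add_one (by positivity),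
          mul_comm, mul_assoc, Real.Gamma_mul_Gamma_one_sub, mul_one_div, one_div, ← div_eq_inv_mul,
          div_right_comm]

variable {r : ℕ} {x : ℝ}

theorem integral_inv_one_add_pow (hr : 2 ≤ r) :
    ∫ u in Set.Ioi (0 : ℝ), (1 + u ^ r)⁻¹ = Real.pi / r / Real.sin (Real.pi / r) := by
  rw [← integral_inv_one_add_rpow (by exact_mod_cast hr)]
  simp only [Real.rpow_natCast]

theorem integrableOn_inv_one_add_pow (hr : 2 ≤ r) :
    IntegrableOn (fun u : ℝ => (1 + u ^ r)⁻¹) (Set.Ioi 0) := by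
  refine Integrable.of_integral_ne_zero ?_
  rw [integral_inv_one_add_pow hr]
  have : 0 < Real.sin (Real.pi / r) := sin_pi_div_pos (by exact_mod_cast hr)
  positivity

theorem log_one_add_div_pow_le {u : ℝ} (hx : 0 < x) (hu : 0 < u) :
    Real.log (1 + (x / u) ^ r) ≤ (x / u) ^ r := by
  have := Real.log_le_sub_one_of_pos (x := 1 + (x / u) ^ r) (by positivity)
  linarith

theorem integrableOn_log_one_add_div_pow (hr : 2 ≤ r) (hx : 0 < x) :
    IntegrableOn (fun u => Real.log (1 + (x / u) ^ r)) (Set.Ioi 1) := by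
  have hpow : IntegrableOn (fun u : ℝ => x ^ r * u ^ (-r : ℝ)) (Set.Ioi 1) :=
    (integrableOn_Ioi_rpow_of_lt (neg_lt_neg (by exact_mod_cast hr)) one_pos).const_mul _
  refine hpow.mono' (Real.measurable_log.comp (by fun_prop)).aestronglyMeasurable ?_
  filter_upwards [self_mem_ae_restrict measurableSet_Ioi] with u (hu : 1 < u)
  have hu0 : 0 < u := one_pos.trans hu
  rw [Real.norm_of_nonneg (Real.log_nonneg (le_add_of_nonneg_right (by positivity))),
    Real.rpow_neg hu0.le, Real.rpow_natCast, ← div_eq_mul_inv, ← div_pow]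
  exact log_one_add_div_pow_le hx hu0

theorem hasDerivAt_mul_log_one_add_div_pow {u : ℝ} (hx : 0 < x) (hu : 0 < u) :
    HasDerivAt (fun u => u * Real.log (1 + (x / u) ^ r))
      (Real.log (1 + (x / u) ^ r) - r * (1 + (x⁻¹ * u) ^ r)⁻¹) u := by
  rcases r.eq_zero_or_pos with rfl | hr
  · simpa using (hasDerivAt_id u).mul_const (Real.log (1 + 1))
  have hdiv := ((hasDerivAt_inv hu.ne').const_mul x).pow r |>.const_add 1
  have hlog := hdiv.log (show 1 + (x * u⁻¹) ^ r ≠ 0 by positivity)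
  refine ((hasDerivAt_id u).mul hlog).congr_deriv ?_
  obtain ⟨k, rfl⟩ : ∃ k, r = k + 1 := ⟨r - 1, by omega⟩
  simp only [Pi.pow_apply, id, Nat.add_sub_cancel, one_mul, sub_eq_add_neg, ← div_eq_mul_inv,
    div_pow, inv_mul_eq_div]
  field_simp
  ring

theorem tendsto_mul_log_one_add_div_pow (hr : 2 ≤ r) (hx : 0 < x) :
    Tendsto (fun u => u * Real.log (1 + (x / u) ^ r)) atTop (𝓝 0) := by
  refine squeeze_zero' (g := fun u => x ^ 2 / u) ?_ ?_ (tendsto_const_nhds.div_atTop tendsto_id)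
  · filter_upwards [eventually_gt_atTop 0] with u hu
    exact mul_nonneg hu.le (Real.log_nonneg (le_add_of_nonneg_right (by positivity)))
  · filter_upwards [eventually_ge_atTop x] with u hu
    have hu0 : 0 < u := hx.trans_le hu
    calc u * Real.log (1 + (x / u) ^ r) ≤ u * (x / u) ^ r := by
          gcongr
          exact log_one_add_div_pow_le hx hu0
      _ ≤ u * (x / u) ^ 2 := by
          gcongr u * ?_
          exact pow_le_pow_of_le_one (by positivity) ((div_le_one hu0).mpr hu) hr
      _ = x ^ 2 / u := by field_simp

theorem integral_log_one_add_div_pow (hr : 2 ≤ r) (hx : 0 < x) :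
    ∫ u in Set.Ioi 1, Real.log (1 + (x / u) ^ r)
      = r * x * (∫ u in Set.Ioi x⁻¹, (1 + u ^ r)⁻¹) - Real.log (1 + x ^ r) := by
  have hint : IntegrableOn (fun u => r * (1 + (x⁻¹ * u) ^ r)⁻¹) (Set.Ioi 1) := by
    refine Integrable.const_mul ?_ _
    refine IntegrableOn.mono_set ?_ (Set.Ioi_subset_Ioi zero_le_one)
    have := (integrableOn_Ioi_comp_mul_left_iff (fun u : ℝ => (1 + u ^ r)⁻¹) 0
      (inv_pos.mpr hx)).mpr
    rw [mul_zero] at this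
    exact this (integrableOn_inv_one_add_pow hr)
  have hlog := integrableOn_log_one_add_div_pow hr hx
  have h := integral_Ioi_of_hasDerivAt_of_tendsto' (a := 1)
    (fun u hu => hasDerivAt_mul_log_one_add_div_pow (r := r) hx (one_pos.trans_le hu))
    (hlog.sub hint) (tendsto_mul_log_one_add_div_pow hr hx)
  rw [integral_sub hlog hint, integral_const_mul,
    integral_comp_mul_left_Ioi (fun u => (1 + u ^ r)⁻¹) 1 (inv_pos.mpr hx), inv_inv, smul_eq_mul,
    mul_one, one_mul, div_one] at h
  linarith

theorem antitoneOn_log_one_add_div_pow (hx : 0 < x) :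
    AntitoneOn (fun u => Real.log (1 + (x / u) ^ r)) (Set.Ici 1) := by
  intro u (hu : 1 ≤ u) v (hv : 1 ≤ v) huv
  have : 0 < u := one_pos.trans_le hu
  have : 0 < v := one_pos.trans_le hv
  exact Real.log_le_log (by positivity) (by gcongr)

theorem summable_log_one_add_div_pow (hr : 2 ≤ r) (x : ℝ) :
    Summable fun n : ℕ => Real.log (1 + (x / n) ^ r) := by
  refine Real.summable_log_one_add_of_summable ?_
  simp only [div_pow, div_eq_mul_inv (x ^ r)]
  exact (Real.summable_nat_pow_inv.mpr hr).mul_left _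

theorem integral_Ioi_inv_inv_one_add_pow_le (hr : 2 ≤ r) (hx : 0 < x) :
    ∫ u in Set.Ioi x⁻¹, (1 + u ^ r)⁻¹ ≤ Real.pi / r / Real.sin (Real.pi / r) := by
  rw [← integral_inv_one_add_pow hr]
  refine setIntegral_mono_set (integrableOn_inv_one_add_pow hr) ?_
    (Set.Ioi_subset_Ioi (inv_pos.mpr hx).le).eventuallyLE
  filter_upwards [self_mem_ae_restrict measurableSet_Ioi] with u (hu : 0 < u)
  positivity

theorem le_integral_Ioi_inv_inv_one_add_pow (hr : 2 ≤ r) (hx : 0 < x) :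
    Real.pi / r / Real.sin (Real.pi / r) - x⁻¹ ≤ ∫ u in Set.Ioi x⁻¹, (1 + u ^ r)⁻¹ := by
  have hx' : 0 < x⁻¹ := inv_pos.mpr hx
  have hint := integrableOn_inv_one_add_pow hr
  have hsplit := setIntegral_union (μ := volume) (f := fun u : ℝ => (1 + u ^ r)⁻¹)
    Set.Ioc_disjoint_Ioi_same measurableSet_Ioi
    (hint.mono_set Set.Ioc_subset_Ioi_self) (hint.mono_set (Set.Ioi_subset_Ioi hx'.le))
  rw [Set.Ioc_union_Ioi_eq_Ioi hx'.le, integral_inv_one_add_pow hr] at hsplit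
  have hle : ∫ u in Set.Ioc 0 x⁻¹, (1 + u ^ r)⁻¹ ≤ x⁻¹ := by
    calc ∫ u in Set.Ioc 0 x⁻¹, (1 + u ^ r)⁻¹ ≤ ∫ _ in Set.Ioc 0 x⁻¹, (1 : ℝ) := by
          refine setIntegral_mono_on (hint.mono_set Set.Ioc_subset_Ioi_self) (by simp)
            measurableSet_Ioc fun u hu => inv_le_one_of_one_le₀ ?_
          have := hu.1
          exact le_add_of_nonneg_right (by positivity)
      _ = x⁻¹ := by simp [hx'.le]
  linarith

theorem tsum_log_one_add_div_pow_le (hr : 2 ≤ r) (hx : 0 < x) :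
    ∑' n : ℕ, Real.log (1 + (x / (n + 1 : ℕ)) ^ r) ≤ Real.pi * x / Real.sin (Real.pi / r) := by
  have hsum := (summable_nat_add_iff 1).mpr (summable_log_one_add_div_pow hr x)
  have hle := AntitoneOn.tsum_comp_add_le_integral (f := fun u => Real.log (1 + (x / u) ^ r)) 1
    (by simpa using antitoneOn_log_one_add_div_pow hx)
    (by simpa using integrableOn_log_one_add_div_pow hr hx)
    fun u hu => Real.log_nonneg (le_add_of_nonneg_right (by
      have : (0 : ℝ) < u := one_pos.trans (by simpa using hu)
      positivity))
  rw [Nat.cast_one, integral_log_one_add_div_pow hr hx] at hle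
  have hbound := mul_le_mul_of_nonneg_left (integral_Ioi_inv_inv_one_add_pow_le hr hx)
    (by positivity : 0 ≤ r * x)
  have hr0 : (r : ℝ) ≠ 0 := by positivity
  rw [hsum.tsum_eq_zero_add, zero_add, Nat.cast_one, div_one]
  calc _ ≤ r * x * (Real.pi / r / Real.sin (Real.pi / r)) := by linarith
    _ = _ := by field_simp

theorem le_tsum_log_one_add_div_pow (hr : 2 ≤ r) (hx : 0 < x) :
    Real.pi * x / Real.sin (Real.pi / r) - r - Real.log (1 + x ^ r)
      ≤ ∑' n : ℕ, Real.log (1 + (x / (n + 1 : ℕ)) ^ r) := by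
  have hle := AntitoneOn.integral_le_tsum_comp_add (f := fun u => Real.log (1 + (x / u) ^ r)) 1
    (by simpa using antitoneOn_log_one_add_div_pow hx) (summable_log_one_add_div_pow hr x)
    fun u hu => Real.log_nonneg (le_add_of_nonneg_right (by
      have : (0 : ℝ) < u := one_pos.trans (by simpa using hu)
      positivity))
  rw [Nat.cast_one, integral_log_one_add_div_pow hr hx] at hle
  have hbound := mul_le_mul_of_nonneg_left (le_integral_Ioi_inv_inv_one_add_pow hr hx)
    (by positivity : 0 ≤ r * x)
  have hr0 : (r : ℝ) ≠ 0 := by positivity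
  calc _ = r * x * (Real.pi / r / Real.sin (Real.pi / r) - x⁻¹) - Real.log (1 + x ^ r) := by
        field_simp
    _ ≤ _ := by linarith

theorem tendsto_log_one_add_pow_div (r : ℕ) :
    Tendsto (fun x : ℝ => Real.log (1 + x ^ r) / x) atTop (𝓝 0) := by
  have hlog : Tendsto (fun x : ℝ => Real.log x / x) atTop (𝓝 0) :=
    Real.isLittleO_log_id_atTop.tendsto_div_nhds_zero
  have hupper : Tendsto (fun x : ℝ => Real.log 2 / x + r * (Real.log x / x)) atTop (𝓝 0) := by
    simpa using (tendsto_const_nhds.div_atTop tendsto_id).add (hlog.const_mul (r : ℝ))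
  refine squeeze_zero' ?_ ?_ hupper <;> filter_upwards [eventually_ge_atTop 1] with x hx
  · have : 0 ≤ Real.log (1 + x ^ r) := Real.log_nonneg (le_add_of_nonneg_right (by positivity))
    positivity
  · rw [mul_div_assoc', ← add_div, ← Real.log_pow, ← Real.log_mul two_ne_zero (by positivity)]
    gcongr
    linarith [one_le_pow₀ (n := r) hx]

theorem tendsto_tsum_log_one_add_div_pow (hr : 2 ≤ r) :
    Tendsto (fun x : ℝ => (∑' n : ℕ, Real.log (1 + (x / (n + 1 : ℕ)) ^ r)) / x) atTop
      (𝓝 (Real.pi / Real.sin (Real.pi / r))) := by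
  have hlower : Tendsto (fun x : ℝ => Real.pi / Real.sin (Real.pi / r) - r / x
      - Real.log (1 + x ^ r) / x) atTop (𝓝 (Real.pi / Real.sin (Real.pi / r))) := by
    simpa using (tendsto_const_nhds.sub (tendsto_const_nhds.div_atTop tendsto_id)).sub
      (tendsto_log_one_add_pow_div r)
  refine tendsto_of_tendsto_of_tendsto_of_le_of_le' hlower tendsto_const_nhds ?_ ?_ <;>
    filter_upwards [eventually_gt_atTop 0] with x hx
  · rw [le_div_iff₀ hx]
    refine le_of_eq_of_le ?_ (le_tsum_log_one_add_div_pow hr hx)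
    field_simp
  · rw [div_le_iff₀ hx]
    exact (tsum_log_one_add_div_pow_le hr hx).trans_eq (by ring)

theorem hasSum_log_norm_entireExp {r : ℕ+} (h : r ≠ 1) {x : ℝ} (hx : 0 < x) :
    HasSum (fun n : ℕ => Real.log (1 + (x / (n + 1 : ℕ)) ^ (r : ℕ)))
      (Real.log ‖entireExp r x‖) := by
  have hsum := ((summable_nat_add_iff 1).mpr
    (summable_log_one_add_div_pow (two_le_of_ne_one h) x)).hasSum
  have hprod := Real.hasProd_of_hasSum_log (fun n => by positivity) hsum
  have hnorm : HasProd (fun n : ℕ => 1 + (x / (n + 1 : ℕ)) ^ (r : ℕ)) ‖entireExp r x‖ := by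
    convert (hasProd_entireExp h (x : ℂ)).norm using 2 with n
    rw [← div_pow, ← Complex.ofReal_natCast, ← Complex.ofReal_div, ← Complex.ofReal_pow,
      ← Complex.ofReal_one, ← Complex.ofReal_add, Complex.norm_real,
      Real.norm_of_nonneg (by positivity)]
  rwa [hnorm.unique hprod, Real.log_exp]

theorem tendsto_log_norm_entireExp_div {r : ℕ+} (h : r ≠ 1) :
    Tendsto (fun x : ℝ => Real.log ‖entireExp r x‖ / x) atTop
      (𝓝 (Real.pi / Real.sin (Real.pi / r))) := by
  refine (tendsto_tsum_log_one_add_div_pow (two_le_of_ne_one h)).congr' ?_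
  filter_upwards [eventually_gt_atTop 0] with x hx
  rw [(hasSum_log_norm_entireExp h hx).tsum_eq]

end PositiveAxis

section SineProducts

/-- The normalised cardinal sine, the value at its removable singularity `0` being left as junk. -/
noncomputable def sincPi (z : ℂ) : ℂ := Complex.sin (Real.pi * z) / (Real.pi * z)

theorem hasProd_one_sub_div_sq {z : ℂ} (hz : z ≠ 0) :
    HasProd (fun n : ℕ => 1 - (z / (n + 1 : ℕ)) ^ 2) (sincPi z) := by
  have h := (multipliable_sineTerm z).hasProd
  rw [tendsto_nhds_unique h.tendsto_prod_nat (tendsto_euler_sin_prod' hz)] at h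
  refine h.congr_fun fun n => ?_
  rw [sineTerm, div_pow, Nat.cast_succ, neg_div, sub_eq_add_neg]

theorem one_sub_pow_eq_prod {ζ : ℂ} {s : ℕ} (hζ : IsPrimitiveRoot ζ s) (hs : 0 < s) (t : ℂ) :
    1 - t ^ s = ∏ k ∈ Finset.range s, (1 - ζ ^ k * t) := by
  simpa [Polynomial.eval_prod] using
    congrArg (Polynomial.eval 1) (X_pow_sub_C_eq_prod hζ hs (α := t) rfl)

theorem hasProd_one_sub_div_pow {ω : ℂ} {s : ℕ} (hω : IsPrimitiveRoot ω (2 * s)) (hs : 0 < s)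
    {z : ℂ} (hz : z ≠ 0) :
    HasProd (fun n : ℕ => 1 - (z / (n + 1 : ℕ)) ^ (2 * s))
      (∏ k ∈ Finset.range s, sincPi (ω ^ k * z)) := by
  have hω0 : ω ≠ 0 := hω.ne_zero (by positivity)
  refine (hasProd_prod fun k _ => hasProd_one_sub_div_sq
    (mul_ne_zero (pow_ne_zero k hω0) hz)).congr_fun fun n => ?_
  rw [pow_mul, one_sub_pow_eq_prod (hω.pow (by positivity) rfl) hs]
  exact Finset.prod_congr rfl fun k _ => by ring

theorem entireExp_eq_prod_sincPi {r : ℕ+} {s : ℕ} (hrs : (r : ℕ) = 2 * s) {η : ℂ}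
    (hη : IsPrimitiveRoot η (4 * s)) {z : ℂ} (hz : z ≠ 0) :
    entireExp r z = ∏ k ∈ Finset.range s, sincPi (η ^ (2 * k + 1) * z) := by
  have hs : 0 < s := by have := r.pos; omega
  have hη0 : η ≠ 0 := hη.ne_zero (by positivity)
  have hr : r ≠ 1 := by rintro rfl; simp at hrs; omega
  have hneg : η ^ (2 * s) = -1 := by
    have : IsPrimitiveRoot (η ^ (2 * s)) 2 := hη.pow (by positivity) (by ring)
    exact this.eq_neg_one_of_two_right
  have h := hasProd_one_sub_div_pow (hη.pow (a := 2) (b := 2 * s) (by positivity) (by ring)) hs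
    (mul_ne_zero hη0 hz)
  simp only [← mul_assoc, ← pow_mul, ← pow_succ] at h
  refine (hasProd_entireExp hr z).unique (h.congr_fun fun n => ?_)
  rw [hrs, mul_div_assoc, mul_pow, hneg, div_pow]
  ring

theorem entireExp_mul_entireExp_neg {r : ℕ+} (hr : r ≠ 1) (hodd : Odd (r : ℕ)) {ω : ℂ}
    (hω : IsPrimitiveRoot ω (2 * r)) {z : ℂ} (hz : z ≠ 0) :
    entireExp r z * entireExp r (-z) = ∏ k ∈ Finset.range r, sincPi (ω ^ k * z) := by
  refine ((hasProd_entireExp hr z).mul (hasProd_entireExp hr (-z))).unique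
    ((hasProd_one_sub_div_pow hω r.pos hz).congr_fun fun n => ?_)
  rw [hodd.neg_pow, mul_comm 2, pow_mul, div_pow]
  ring

theorem entireExp_neg_of_even {r : ℕ+} (heven : Even (r : ℕ)) (z : ℂ) :
    entireExp r (-z) = entireExp r z := by
  have hr : r ≠ 1 := by rintro rfl; simp at heven
  simp only [entireExp_of_ne_one hr, heven.neg_pow]

theorem norm_sin_le (w : ℂ) : ‖Complex.sin w‖ ≤ Real.exp |w.im| := by
  rw [Complex.sin, norm_div, norm_mul, Complex.norm_I, mul_one, Complex.norm_ofNat,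
    div_le_iff₀ two_pos, mul_two]
  refine (norm_sub_le _ _).trans ?_
  simp only [Complex.norm_exp, neg_mul, Complex.neg_re, Complex.mul_I_re, neg_neg]
  gcongr
  exacts [le_abs_self _, neg_le_abs _]

theorem le_norm_sin {w : ℂ} (hw : 1 / 2 ≤ w.im) : Real.exp w.im / 4 ≤ ‖Complex.sin w‖ := by
  have hsub := norm_sub_norm_le (Complex.exp (-w * Complex.I)) (Complex.exp (w * Complex.I))
  simp only [Complex.norm_exp, neg_mul, Complex.neg_re, Complex.mul_I_re, neg_neg] at hsub
  have htwo : 2 ≤ Real.exp w.im * Real.exp w.im := by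
    rw [← Real.exp_add]
    linarith [Real.add_one_le_exp (w.im + w.im)]
  have hinv : Real.exp (-w.im) ≤ Real.exp w.im / 2 := by
    rw [Real.exp_neg, inv_le_iff_one_le_mul₀ (Real.exp_pos _)]
    linarith
  rw [Complex.sin, norm_div, norm_mul, Complex.norm_I, mul_one, Complex.norm_ofNat, neg_mul,
    le_div_iff₀ two_pos]
  linarith

variable {χ : ℂ} {x : ℝ}

theorem norm_sincPi_mul (hχ : ‖χ‖ = 1) (hx : 0 < x) :
    ‖sincPi (χ * x)‖ = ‖Complex.sin (Real.pi * (χ * x))‖ / (Real.pi * x) := by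
  rw [sincPi, norm_div, norm_mul, norm_mul, hχ, one_mul, Complex.norm_real, Complex.norm_real,
    Real.norm_of_nonneg Real.pi_pos.le, Real.norm_of_nonneg hx.le]

theorem im_pi_mul_mul_ofReal (χ : ℂ) (x : ℝ) : (Real.pi * (χ * x)).im = Real.pi * χ.im * x := by
  rw [Complex.im_ofReal_mul, Complex.im_mul_ofReal, mul_assoc]

theorem norm_sincPi_le (hχ : ‖χ‖ = 1) (him : 0 ≤ χ.im) (hx : 0 < x) :
    ‖sincPi (χ * x)‖ ≤ Real.exp (Real.pi * χ.im * x) / (Real.pi * x) := by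
  rw [norm_sincPi_mul hχ hx]
  gcongr
  refine (norm_sin_le _).trans_eq ?_
  rw [im_pi_mul_mul_ofReal, abs_of_nonneg (by positivity)]

theorem le_norm_sincPi (hχ : ‖χ‖ = 1) (hx : 0 < x) (him : 1 / 2 ≤ Real.pi * χ.im * x) :
    Real.exp (Real.pi * χ.im * x) / 4 / (Real.pi * x) ≤ ‖sincPi (χ * x)‖ := by
  rw [norm_sincPi_mul hχ hx]
  gcongr
  rw [← im_pi_mul_mul_ofReal] at him ⊢
  exact le_norm_sin him

theorem tendsto_log_const_mul_div (c : ℝ) :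
    Tendsto (fun x => Real.log (c * x) / x) atTop (𝓝 0) := by
  rcases eq_or_ne c 0 with rfl | hc
  · simp
  have h := (tendsto_const_nhds (x := Real.log c).div_atTop tendsto_id).add
    (Real.isLittleO_log_id_atTop.tendsto_div_nhds_zero)
  rw [zero_add] at h
  refine h.congr' ?_
  filter_upwards [eventually_gt_atTop 0] with x hx
  rw [Real.log_mul hc hx.ne', add_div, id]

theorem tendsto_log_norm_sincPi_div (hχ : ‖χ‖ = 1) (him : 0 < χ.im) :
    Tendsto (fun x : ℝ => Real.log ‖sincPi (χ * x)‖ / x) atTop (𝓝 (Real.pi * χ.im)) := by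
  have hpos : 0 < Real.pi * χ.im := by positivity
  have hlower : Tendsto (fun x => Real.pi * χ.im - Real.log (4 * Real.pi * x) / x) atTop
      (𝓝 (Real.pi * χ.im)) := by
    simpa using tendsto_const_nhds.sub (tendsto_log_const_mul_div (4 * Real.pi))
  have hupper : Tendsto (fun x => Real.pi * χ.im - Real.log (Real.pi * x) / x) atTop
      (𝓝 (Real.pi * χ.im)) := by
    simpa using tendsto_const_nhds.sub (tendsto_log_const_mul_div Real.pi)
  have hlarge : ∀ᶠ x : ℝ in atTop, 0 < x ∧ 1 / 2 ≤ Real.pi * χ.im * x :=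
    (eventually_gt_atTop 0).and
      ((tendsto_id.const_mul_atTop hpos).eventually (eventually_ge_atTop _))
  refine tendsto_of_tendsto_of_tendsto_of_le_of_le' hlower hupper ?_ ?_ <;>
    filter_upwards [hlarge] with x ⟨hx, hx'⟩ <;>
    have hle := le_norm_sincPi hχ hx hx' <;>
    have hsinc : 0 < ‖sincPi (χ * x)‖ := lt_of_lt_of_le (by positivity) hle
  · have := Real.log_le_log (by positivity) hle
    rw [div_div, Real.log_div (by positivity) (by positivity), Real.log_exp, ← mul_assoc] at this
    rwa [le_div_iff₀ hx, sub_mul, div_mul_cancel₀ _ hx.ne']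
  · have := Real.log_le_log hsinc (norm_sincPi_le hχ him.le hx)
    rw [Real.log_div (by positivity) (by positivity), Real.log_exp] at this
    rwa [div_le_iff₀ hx, sub_mul, div_mul_cancel₀ _ hx.ne']

theorem im_exp_two_pi_I_div_pow (n k : ℕ) :
    (Complex.exp (2 * Real.pi * Complex.I / n) ^ k).im = Real.sin (2 * Real.pi * k / n) := by
  rw [← Complex.exp_nat_mul,
    show k * (2 * Real.pi * Complex.I / n) = (2 * Real.pi * k / n : ℝ) * Complex.I by
      push_cast; ring, Complex.exp_ofReal_mul_I_im]

theorem norm_exp_two_pi_I_div_pow {n : ℕ} (hn : n ≠ 0) (k : ℕ) :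
    ‖Complex.exp (2 * Real.pi * Complex.I / n) ^ k‖ = 1 := by
  rw [norm_pow, (Complex.isPrimitiveRoot_exp n hn).norm'_eq_one hn, one_pow]

theorem sum_sin_mul_two_sin_half (θ : ℝ) (n : ℕ) :
    (∑ k ∈ Finset.range n, Real.sin (k * θ)) * (2 * Real.sin (θ / 2))
      = Real.cos (θ / 2) - Real.cos (n * θ - θ / 2) := by
  induction n with
  | zero => simp
  | succ n ih =>
    have hn : ((n + 1 : ℕ) : ℝ) * θ - θ / 2 = n * θ + θ / 2 := by push_cast; ring
    rw [Finset.sum_range_succ, add_mul, ih, hn, Real.cos_add, Real.cos_sub]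
    ring

theorem sum_sin_pi_mul_div {r : ℕ} (hr : 0 < r) :
    ∑ k ∈ Finset.range r, Real.sin (Real.pi * k / r) = Real.cot (Real.pi / r / 2) := by
  have hr1 : (1 : ℝ) ≤ r := by exact_mod_cast hr
  have hsin : 0 < Real.sin (Real.pi / r / 2) := by
    rw [div_div]
    exact sin_pi_div_pos (by linarith)
  have h := sum_sin_mul_two_sin_half (Real.pi / r) r
  rw [mul_div_cancel₀ _ (by positivity), Real.cos_pi_sub] at h
  rw [Real.cot_eq_cos_div_sin, eq_div_iff hsin.ne']
  simp only [mul_comm Real.pi, mul_div_assoc]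
  linarith

end SineProducts

section GrowthOnNegativeAxis

/-- The absolute values of the points of the negative axis at which growth is measured: no entire
extension of an `e^{ℓ_r}` vanishes at a point of such absolute value. -/
noncomputable def halfInt (m : ℕ) : ℝ := m + 1 / 2

/-- `log |F_r (-x)|`, where `F_r` is the entire extension of `e^{ℓ_r}`. -/
noncomputable def logNorm (r : ℕ+) (x : ℝ) : ℝ := Real.log ‖entireExp r (-x)‖

theorem halfInt_pos (m : ℕ) : 0 < halfInt m := by
  rw [halfInt]
  positivity

theorem tendsto_halfInt_atTop : Tendsto halfInt atTop atTop :=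
  tendsto_atTop_add_const_right _ _ tendsto_natCast_atTop_atTop

theorem entireExp_ne_zero_of_norm_eq_halfInt (r : ℕ+) {z : ℂ} {m : ℕ} (hz : ‖z‖ = halfInt m) :
    entireExp r z ≠ 0 := by
  rw [Ne, entireExp_eq_zero_iff]
  intro hmem
  simp only [Set.mem_iUnion, exists_prop] at hmem
  obtain ⟨χ, hχ, n, -, rfl⟩ := hmem
  rw [norm_mul, norm_eq_one_of_mem_rootsG hχ, one_mul, Complex.norm_intCast, halfInt] at hz
  have htwo : ((2 * |n| : ℤ) : ℝ) = (2 * m + 1 : ℤ) := by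
    push_cast
    linarith
  have : 2 * |n| = 2 * m + 1 := by exact_mod_cast htwo
  omega

theorem entireExp_neg_halfInt_ne_zero (r : ℕ+) (m : ℕ) : entireExp r (-(halfInt m : ℂ)) ≠ 0 :=
  entireExp_ne_zero_of_norm_eq_halfInt r (m := m) (by
    rw [norm_neg, Complex.norm_real, Real.norm_of_nonneg (halfInt_pos m).le])

theorem exp_logNorm_halfInt (r : ℕ+) (m : ℕ) :
    Real.exp (logNorm r (halfInt m)) = ‖entireExp r (-(halfInt m : ℂ))‖ :=
  Real.exp_log (norm_pos_iff.mpr (entireExp_neg_halfInt_ne_zero r m))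

theorem norm_sin_pi_mul_halfInt (m : ℕ) : ‖Complex.sin (Real.pi * halfInt m)‖ = 1 := by
  rw [halfInt, show ((Real.pi : ℂ) * (m + 1 / 2 : ℝ)) = Real.pi / 2 + m * Real.pi by
      push_cast; ring, Complex.sin_antiperiodic.add_nat_mul_eq, Complex.sin_pi_div_two]
  simp

theorem tendsto_log_norm_sincPi_halfInt_div :
    Tendsto (fun m => Real.log ‖sincPi (halfInt m)‖ / halfInt m) atTop (𝓝 0) := by
  have h := ((tendsto_log_const_mul_div Real.pi).comp tendsto_halfInt_atTop).neg
  rw [neg_zero] at h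
  refine h.congr fun m => ?_
  have hnorm := norm_sincPi_mul norm_one (halfInt_pos m)
  rw [one_mul, norm_sin_pi_mul_halfInt] at hnorm
  rw [hnorm, one_div, Real.log_inv, neg_div, Function.comp_apply]

theorem logNorm_of_even {r : ℕ+} (heven : Even (r : ℕ)) (x : ℝ) :
    logNorm r x = Real.log ‖entireExp r x‖ := by
  rw [logNorm, entireExp_neg_of_even heven]

theorem tendsto_logNorm_div_of_even {r : ℕ+} (heven : Even (r : ℕ)) :
    Tendsto (fun x => logNorm r x / x) atTop (𝓝 (Real.pi * growthConst r)) := by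
  have hr : r ≠ 1 := by rintro rfl; simp at heven
  simp only [logNorm_of_even heven, growthConst, if_pos heven, mul_one_div]
  exact tendsto_log_norm_entireExp_div hr

theorem tendsto_log_norm_entireExp_mul_entireExp_neg_div {r : ℕ+} (hr : r ≠ 1)
    (hodd : Odd (r : ℕ)) :
    Tendsto (fun m => Real.log ‖entireExp r (halfInt m) * entireExp r (-(halfInt m : ℂ))‖
      / halfInt m) atTop (𝓝 (Real.pi * Real.cot (Real.pi / r / 2))) := by
  have h2r : 2 * (r : ℕ) ≠ 0 := by positivity
  set ω : ℂ := Complex.exp (2 * Real.pi * Complex.I / (2 * r : ℕ)) with hω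
  have him (k : ℕ) : (ω ^ k).im = Real.sin (Real.pi * k / r) := by
    rw [hω, im_exp_two_pi_I_div_pow, Nat.cast_mul, Nat.cast_ofNat, mul_assoc,
      mul_div_mul_left _ _ two_ne_zero]
  have hfactor : ∀ k ∈ Finset.range r, Tendsto
      (fun m => Real.log ‖sincPi (ω ^ k * halfInt m)‖ / halfInt m) atTop
      (𝓝 (Real.pi * Real.sin (Real.pi * k / r))) := by
    intro k hk
    rcases k.eq_zero_or_pos with rfl | hk0
    · simpa using tendsto_log_norm_sincPi_halfInt_div
    · rw [← him]
      refine (tendsto_log_norm_sincPi_div (norm_exp_two_pi_I_div_pow h2r k) ?_).comp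
        tendsto_halfInt_atTop
      rw [him, mul_div_assoc]
      have hkr : (k : ℝ) / r < 1 := by
        rw [div_lt_one (by positivity)]
        exact_mod_cast Finset.mem_range.mp hk
      exact Real.sin_pos_of_pos_of_lt_pi (by positivity) (mul_lt_of_lt_one_right Real.pi_pos hkr)
  have hsum := tendsto_finsetSum _ hfactor
  rw [← Finset.mul_sum, sum_sin_pi_mul_div r.pos] at hsum
  refine hsum.congr fun m => ?_
  have hne : (halfInt m : ℂ) ≠ 0 := Complex.ofReal_ne_zero.mpr (halfInt_pos m).ne'
  have hprod := entireExp_mul_entireExp_neg hr hodd (Complex.isPrimitiveRoot_exp _ h2r) hne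
  have hprod0 := mul_ne_zero (entireExp_ne_zero_of_norm_eq_halfInt r (m := m)
    (by rw [Complex.norm_real, Real.norm_of_nonneg (halfInt_pos m).le]))
    (entireExp_neg_halfInt_ne_zero r m)
  rw [hprod, Finset.prod_ne_zero_iff] at hprod0
  rw [hprod, norm_prod, Real.log_prod fun k hk => norm_ne_zero_iff.mpr (hprod0 k hk),
    Finset.sum_div]

theorem tendsto_logNorm_halfInt_div_of_odd {r : ℕ+} (hr : r ≠ 1) (hodd : Odd (r : ℕ)) :
    Tendsto (fun m => logNorm r (halfInt m) / halfInt m) atTop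
      (𝓝 (Real.pi * growthConst r)) := by
  have h := (tendsto_log_norm_entireExp_mul_entireExp_neg_div hr hodd).sub
    ((tendsto_log_norm_entireExp_div hr).comp tendsto_halfInt_atTop)
  have hsin := sin_pi_div_pos (x := r) (by exact_mod_cast two_le_of_ne_one hr)
  have hconst : Real.pi * Real.cot (Real.pi / r / 2) - Real.pi / Real.sin (Real.pi / r)
      = Real.pi * growthConst r := by
    rw [growthConst, if_neg (Nat.not_even_iff_odd.mpr hodd),
      ← mul_one_div Real.pi (Real.sin _), ← cot_half_sub_cot hsin.ne']
    ring
  rw [hconst] at h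
  refine h.congr fun m => ?_
  have hne := entireExp_ne_zero_of_norm_eq_halfInt r (z := halfInt m) (m := m)
    (by rw [Complex.norm_real, Real.norm_of_nonneg (halfInt_pos m).le])
  rw [Function.comp_apply, norm_mul, Real.log_mul (norm_ne_zero_iff.mpr hne)
    (norm_ne_zero_iff.mpr (entireExp_neg_halfInt_ne_zero r m)), ← sub_div, add_sub_cancel_left,
    logNorm]

theorem tendsto_logNorm_halfInt_div {r : ℕ+} (hr : r ≠ 1) :
    Tendsto (fun m => logNorm r (halfInt m) / halfInt m) atTop
      (𝓝 (Real.pi * growthConst r)) := by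
  rcases Nat.even_or_odd (r : ℕ) with heven | hodd
  · exact (tendsto_logNorm_div_of_even heven).comp tendsto_halfInt_atTop
  · exact tendsto_logNorm_halfInt_div_of_odd hr hodd

theorem norm_entireExp_one_neg_halfInt (m : ℕ) :
    ‖entireExp 1 (-(halfInt m : ℂ))‖ = Real.Gamma (halfInt m) / Real.pi := by
  have hGamma : 0 < Real.Gamma (halfInt m) := Real.Gamma_pos_of_pos (halfInt_pos m)
  have hreflect := congrArg norm (Complex.Gamma_mul_Gamma_one_sub (halfInt m))
  rw [norm_mul, norm_div, norm_sin_pi_mul_halfInt, div_one, Complex.Gamma_ofReal,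
    Complex.norm_real, Complex.norm_real, Real.norm_of_nonneg Real.pi_pos.le,
    Real.norm_of_nonneg hGamma.le] at hreflect
  rw [entireExp_one, norm_inv, ← sub_eq_add_neg, inv_eq_iff_eq_inv, inv_div,
    eq_div_iff hGamma.ne', mul_comm, hreflect]

theorem factorial_le_Gamma_halfInt {n : ℕ} (hn : n ≠ 0) :
    (n.factorial : ℝ) ≤ Real.Gamma (halfInt (n + 1)) := by
  have hn' : (1 : ℝ) ≤ n := by exact_mod_cast Nat.one_le_iff_ne_zero.mpr hn
  rw [← Real.Gamma_nat_eq_factorial, halfInt, Nat.cast_succ]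
  exact Real.Gamma_strictMonoOn_Ici.monotoneOn (Set.mem_Ici.mpr (by linarith))
    (Set.mem_Ici.mpr (by linarith)) (by linarith)

theorem tendsto_logNorm_one_halfInt_div :
    Tendsto (fun m => logNorm 1 (halfInt m) / halfInt m) atTop atTop := by
  refine (tendsto_add_atTop_iff_nat 1).mp (tendsto_atTop.mpr fun C => ?_)
  have hsmall := (FloorSemiring.tendsto_pow_div_factorial_atTop (Real.exp C)).const_mul
    (Real.pi * Real.exp (C * (3 / 2)))
  rw [mul_zero] at hsmall
  filter_upwards [eventually_ne_atTop 0, hsmall.eventually_le_const one_pos] with n hn hle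
  rw [← mul_div_assoc, div_le_one (by positivity)] at hle
  rw [le_div_iff₀ (halfInt_pos _), logNorm, norm_entireExp_one_neg_halfInt, Real.le_log_iff_exp_le
    (div_pos (Real.Gamma_pos_of_pos (halfInt_pos _)) Real.pi_pos), le_div_iff₀ Real.pi_pos]
  refine le_trans (le_of_eq ?_) (hle.trans (factorial_le_Gamma_halfInt hn))
  rw [← Real.exp_nat_mul, mul_assoc, ← Real.exp_add, mul_comm, halfInt]
  push_cast
  ring_nf

theorem le_norm_entireExp_two {x : ℝ} (hx : 1 / 2 ≤ x) :
    Real.exp (Real.pi * x) / 4 / (Real.pi * x) ≤ ‖entireExp 2 x‖ := by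
  have hx0 : 0 < x := by linarith
  have hprod := entireExp_eq_prod_sincPi (r := 2) (s := 1) rfl
    Complex.isPrimitiveRoot_I (Complex.ofReal_ne_zero.mpr hx0.ne')
  rw [Finset.prod_range_one, mul_zero, zero_add, pow_one] at hprod
  rw [hprod]
  simpa using le_norm_sincPi Complex.norm_I hx0 (by
    rw [Complex.I_im, mul_one]
    nlinarith [Real.pi_gt_three])

theorem norm_entireExp_six_le {x : ℝ} (hx : 0 < x) :
    ‖entireExp 6 x‖ ≤ Real.exp (2 * (Real.pi * x)) / (Real.pi * x) ^ 3 := by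
  set η : ℂ := Complex.exp (2 * Real.pi * Complex.I / (12 : ℕ)) with hη
  have him (k : ℕ) : (η ^ k).im = Real.sin (k * Real.pi / 6) := by
    rw [hη, im_exp_two_pi_I_div_pow]
    congr 1
    push_cast
    ring
  have him1 : (η ^ 1).im = 1 / 2 := by rw [him, Nat.cast_one, one_mul, Real.sin_pi_div_six]
  have him3 : (η ^ 3).im = 1 := by
    rw [him, ← Real.sin_pi_div_two]
    congr 1
    push_cast
    ring
  have him5 : (η ^ 5).im = 1 / 2 := by
    rw [him, ← Real.sin_pi_div_six, ← Real.sin_pi_sub]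
    congr 1
    push_cast
    ring
  have hbound {k : ℕ} (hk : 0 ≤ (η ^ k).im) :=
    norm_sincPi_le (norm_exp_two_pi_I_div_pow (n := 12) (by norm_num) k) hk hx
  rw [entireExp_eq_prod_sincPi (r := 6) (s := 3) rfl (Complex.isPrimitiveRoot_exp 12 (by norm_num))
    (Complex.ofReal_ne_zero.mpr hx.ne'), Finset.prod_range_succ, Finset.prod_range_succ,
    Finset.prod_range_one, norm_mul, norm_mul]
  calc _ ≤ Real.exp (Real.pi * (η ^ 1).im * x) / (Real.pi * x)
          * (Real.exp (Real.pi * (η ^ 3).im * x) / (Real.pi * x))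
          * (Real.exp (Real.pi * (η ^ 5).im * x) / (Real.pi * x)) := by
        gcongr
        exacts [hbound (him1 ▸ by norm_num), hbound (him3 ▸ zero_le_one),
          hbound (him5 ▸ by norm_num)]
    _ = Real.exp (2 * (Real.pi * x)) / (Real.pi * x) ^ 3 := by
        rw [him1, him3, him5, div_mul_div_comm, div_mul_div_comm, ← Real.exp_add, ← Real.exp_add]
        ring_nf

/-- The exponential orders cancel; what remains is the quotient of the algebraic factors
`x ^ (-3)` and `(x ^ (-1)) ^ 2`. -/
theorem tendsto_logNorm_six_sub_two_mul_logNorm_two :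
    Tendsto (fun m => logNorm 6 (halfInt m) - 2 * logNorm 2 (halfInt m)) atTop atBot := by
  have hbound : Tendsto (fun x => Real.log 16 - Real.log (Real.pi * x)) atTop atBot :=
    tendsto_const_nhds.add_atBot (tendsto_neg_atTop_atBot.comp
      (Real.tendsto_log_atTop.comp (tendsto_id.const_mul_atTop Real.pi_pos)))
  refine tendsto_atBot_mono (fun m => ?_) (hbound.comp tendsto_halfInt_atTop)
  have hx : 0 < halfInt m := halfInt_pos m
  have hy : 0 < Real.pi * halfInt m := by positivity
  have htwo := Real.log_le_log (by positivity)
    (le_norm_entireExp_two (x := halfInt m) (le_add_of_nonneg_left m.cast_nonneg))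
  have hsix := Real.log_le_log (norm_pos_iff.mpr (entireExp_ne_zero_of_norm_eq_halfInt 6 (m := m)
    (by rw [Complex.norm_real, Real.norm_of_nonneg hx.le]))) (norm_entireExp_six_le hx)
  have h16 : Real.log 16 = 2 * Real.log 4 := by
    rw [← Nat.cast_two, ← Real.log_pow]
    norm_num
  rw [Real.log_div (by positivity) hy.ne', Real.log_div (by positivity) four_ne_zero,
    Real.log_exp] at htwo
  rw [Real.log_div (by positivity) (by positivity), Real.log_exp, Real.log_pow,
    Nat.cast_ofNat] at hsix
  rw [logNorm_of_even (by decide), logNorm_of_even (by decide), Function.comp_apply]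
  linarith

end GrowthOnNegativeAxis

section Dominance

variable {ι α E : Type*} [NormedAddCommGroup E] {l : Filter α} {T : Finset ι} {a : ι → α → E}

theorem exists_isLittleO_max (hT : T.Nonempty)
    (h : (T : Set ι).Pairwise fun s t => a s =o[l] a t ∨ a t =o[l] a s) :
    ∃ s ∈ T, ∀ t ∈ T, t ≠ s → a t =o[l] a s := by
  induction hT using Finset.Nonempty.cons_induction with
  | singleton i =>
    exact ⟨i, Finset.mem_singleton_self i, fun t ht hti => (hti (Finset.mem_singleton.mp ht)).elim⟩
  | cons i T hi _ ih =>
    rw [Finset.coe_cons] at h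
    obtain ⟨s, hs, hmax⟩ := ih (h.mono (Set.subset_insert _ _))
    have his : i ≠ s := fun h => hi (h ▸ hs)
    rcases h (Set.mem_insert _ _) (Set.mem_insert_of_mem _ hs) his with hlt | hlt
    · refine ⟨s, Finset.mem_cons_of_mem hs, fun t ht hts => ?_⟩
      rcases Finset.mem_cons.mp ht with rfl | ht
      exacts [hlt, hmax t ht hts]
    · refine ⟨i, Finset.mem_cons_self _ _, fun t ht hti => ?_⟩
      by_cases hts : t = s
      · exact hts ▸ hlt
      · exact (hmax t ((Finset.mem_cons.mp ht).resolve_left hti) hts).trans hlt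

theorem not_sum_eventuallyEq_zero [l.NeBot] (hT : T.Nonempty)
    (hne : ∀ s ∈ T, ∃ᶠ x in l, a s x ≠ 0)
    (h : (T : Set ι).Pairwise fun s t => a s =o[l] a t ∨ a t =o[l] a s) :
    ¬ (fun x => ∑ s ∈ T, a s x) =ᶠ[l] 0 := by
  classical
  intro hzero
  obtain ⟨s, hs, hmax⟩ := exists_isLittleO_max hT h
  have hrest : (fun x => ∑ t ∈ T.erase s, a t x) =o[l] a s :=
    IsLittleO.fun_sum fun t ht => hmax t (Finset.mem_of_mem_erase ht) (Finset.ne_of_mem_erase ht)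
  have hself : (fun x => -a s x) =o[l] a s := by
    refine hrest.congr' ?_ EventuallyEq.rfl
    filter_upwards [hzero] with x hx
    rw [← Finset.add_sum_erase T _ hs] at hx
    exact eq_neg_of_add_eq_zero_right hx
  exact isLittleO_irrefl (hne s hs) (isLittleO_neg_left.mp hself)

end Dominance

section MonomialGrowth

variable {T : Finset ℕ+} {d : ℕ+ → ℤ}

theorem tendsto_sum_mul_logNorm_div (h1 : 1 ∉ T) (d : ℕ+ → ℝ) :
    Tendsto (fun m => (∑ r ∈ T, d r * logNorm r (halfInt m)) / halfInt m) atTop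
      (𝓝 (Real.pi * ∑ r ∈ T, d r * growthConst r)) := by
  simp only [Finset.sum_div, Finset.mul_sum, mul_left_comm Real.pi, mul_div_assoc]
  exact tendsto_finsetSum _ fun r hr =>
    (tendsto_logNorm_halfInt_div (ne_of_mem_of_not_mem hr h1)).const_mul (d r)

theorem sum_mul_logNorm_eq_of_sum_mul_growthConst_eq_zero (h1 : 1 ∉ T) (h2 : 2 ∈ T) (h6 : 6 ∈ T)
    (h : ∑ r ∈ T, (d r : ℝ) * growthConst r = 0) (x : ℝ) :
    ∑ r ∈ T, (d r : ℝ) * logNorm r x = d 6 * (logNorm 6 x - 2 * logNorm 2 x) := by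
  obtain ⟨hzero, htie⟩ := sum_mul_growthConst_eq_zero h1 h2 h6 h
  have htie' : (d 2 : ℝ) = -(2 * d 6) := by exact_mod_cast eq_neg_of_add_eq_zero_left htie
  rw [← Finset.add_sum_erase _ _ h2,
    Finset.sum_eq_single_of_mem 6 (Finset.mem_erase.mpr ⟨by decide, h6⟩), htie']
  · ring
  · intro r hr hr6
    rw [hzero r (Finset.mem_of_mem_erase hr) (Finset.ne_of_mem_erase hr) hr6, Int.cast_zero,
      zero_mul]

theorem ne_zero_six_of_sum_mul_growthConst_eq_zero (h1 : 1 ∉ T) (h2 : 2 ∈ T) (h6 : 6 ∈ T)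
    (h : ∑ r ∈ T, (d r : ℝ) * growthConst r = 0) (hd : ∃ r ∈ T, d r ≠ 0) : d 6 ≠ 0 := by
  obtain ⟨hzero, htie⟩ := sum_mul_growthConst_eq_zero h1 h2 h6 h
  obtain ⟨r, hr, hdr⟩ := hd
  by_cases hr2 : r = 2
  · subst hr2
    omega
  by_cases hr6 : r = 6
  · exact hr6 ▸ hdr
  · exact (hdr (hzero r hr hr2 hr6)).elim

theorem tendsto_sum_mul_logNorm_of_one_notMem (h1 : 1 ∉ T) (h2 : 2 ∈ T) (h6 : 6 ∈ T)
    (hd : ∃ r ∈ T, d r ≠ 0) :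
    Tendsto (fun m => ∑ r ∈ T, (d r : ℝ) * logNorm r (halfInt m)) atTop atTop ∨
      Tendsto (fun m => ∑ r ∈ T, (d r : ℝ) * logNorm r (halfInt m)) atTop atBot := by
  have hlim := tendsto_sum_mul_logNorm_div h1 fun r => (d r : ℝ)
  have hcancel (m : ℕ) := div_mul_cancel₀ (∑ r ∈ T, (d r : ℝ) * logNorm r (halfInt m))
    (halfInt_pos m).ne'
  rcases lt_trichotomy (∑ r ∈ T, (d r : ℝ) * growthConst r) 0 with hneg | hzero | hpos
  · exact .inr ((hlim.neg_mul_atTop (mul_neg_of_pos_of_neg Real.pi_pos hneg)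
      tendsto_halfInt_atTop).congr hcancel)
  · simp only [sum_mul_logNorm_eq_of_sum_mul_growthConst_eq_zero h1 h2 h6 hzero]
    rcases (ne_zero_six_of_sum_mul_growthConst_eq_zero h1 h2 h6 hzero hd).lt_or_gt with hlt | hgt
    · exact .inl (tendsto_logNorm_six_sub_two_mul_logNorm_two.const_mul_atBot_of_neg
        (Int.cast_lt_zero.mpr hlt))
    · exact .inr (tendsto_logNorm_six_sub_two_mul_logNorm_two.const_mul_atBot
        (Int.cast_pos.mpr hgt))
  · exact .inl ((hlim.pos_mul_atTop (mul_pos Real.pi_pos hpos) tendsto_halfInt_atTop).congr hcancel)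

theorem tendsto_sum_mul_logNorm (h1 : 1 ∈ T) (h2 : 2 ∈ T) (h6 : 6 ∈ T) (hd : ∃ r ∈ T, d r ≠ 0) :
    Tendsto (fun m => ∑ r ∈ T, (d r : ℝ) * logNorm r (halfInt m)) atTop atTop ∨
      Tendsto (fun m => ∑ r ∈ T, (d r : ℝ) * logNorm r (halfInt m)) atTop atBot := by
  have hlim := tendsto_sum_mul_logNorm_div (Finset.notMem_erase 1 T) fun r => (d r : ℝ)
  have hsplit (m : ℕ) : (d 1 * (logNorm 1 (halfInt m) / halfInt m)
      + (∑ r ∈ T.erase 1, (d r : ℝ) * logNorm r (halfInt m)) / halfInt m) * halfInt m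
        = ∑ r ∈ T, (d r : ℝ) * logNorm r (halfInt m) := by
    rw [← mul_div_assoc, ← add_div, div_mul_cancel₀ _ (halfInt_pos m).ne',
      Finset.add_sum_erase _ (fun r => (d r : ℝ) * logNorm r (halfInt m)) h1]
  rcases lt_trichotomy (d 1) 0 with hneg | hzero | hpos
  · exact .inr ((((tendsto_logNorm_one_halfInt_div.const_mul_atTop_of_neg
      (Int.cast_lt_zero.mpr hneg)).atBot_add hlim).atBot_mul_atTop₀ tendsto_halfInt_atTop).congr
        hsplit)
  · obtain ⟨r, hr, hdr⟩ := hd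
    have hr1 : r ≠ 1 := fun h => hdr (h ▸ hzero)
    simpa only [← Finset.add_sum_erase _ _ h1, hzero, Int.cast_zero, zero_mul, zero_add] using
      tendsto_sum_mul_logNorm_of_one_notMem (Finset.notMem_erase 1 T)
        (Finset.mem_erase.mpr ⟨by decide, h2⟩) (Finset.mem_erase.mpr ⟨by decide, h6⟩)
        ⟨r, Finset.mem_erase.mpr ⟨hr1, hr⟩, hdr⟩
  · exact .inl ((((tendsto_logNorm_one_halfInt_div.const_mul_atTop
      (Int.cast_pos.mpr hpos)).atTop_add hlim).atTop_mul_atTop₀ tendsto_halfInt_atTop).congr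
        hsplit)

theorem norm_prod_entireExp_pow {e : ℕ+ →₀ ℕ} (he : e.support ⊆ T) (m : ℕ) :
    ‖e.prod fun r k => entireExp r (-(halfInt m : ℂ)) ^ k‖
      = Real.exp (∑ r ∈ T, (e r : ℝ) * logNorm r (halfInt m)) := by
  rw [Finsupp.prod_of_support_subset _ he _ fun _ _ => pow_zero _, norm_prod, Real.exp_sum]
  exact Finset.prod_congr rfl fun r _ => by
    rw [norm_pow, Real.exp_nat_mul, exp_logNorm_halfInt]

theorem isLittleO_prod_entireExp_pow {e e' : ℕ+ →₀ ℕ} (he : e.support ⊆ T) (he' : e'.support ⊆ T)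
    (h : Tendsto (fun m => ∑ r ∈ T, ((e' r - e r : ℤ) : ℝ) * logNorm r (halfInt m)) atTop atTop) :
    (fun m => e.prod fun r k => entireExp r (-(halfInt m : ℂ)) ^ k) =o[atTop]
      fun m => e'.prod fun r k => entireExp r (-(halfInt m : ℂ)) ^ k := by
  rw [← isLittleO_norm_norm]
  simp only [norm_prod_entireExp_pow he, norm_prod_entireExp_pow he']
  refine Real.isLittleO_exp_comp_exp_comp.mpr (h.congr fun m => ?_)
  simp only [Int.cast_sub, Int.cast_natCast, sub_mul, Finset.sum_sub_distrib]

theorem isLittleO_prod_entireExp_pow_or {e e' : ℕ+ →₀ ℕ} (hne : e ≠ e') :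
    ((fun m => e.prod fun r k => entireExp r (-(halfInt m : ℂ)) ^ k) =o[atTop]
      fun m => e'.prod fun r k => entireExp r (-(halfInt m : ℂ)) ^ k) ∨
    ((fun m => e'.prod fun r k => entireExp r (-(halfInt m : ℂ)) ^ k) =o[atTop]
      fun m => e.prod fun r k => entireExp r (-(halfInt m : ℂ)) ^ k) := by
  set T : Finset ℕ+ := (e.support ∪ e'.support) ∪ {1, 2, 6}
  have he : e.support ⊆ T := Finset.subset_union_left.trans Finset.subset_union_left
  have he' : e'.support ⊆ T := Finset.subset_union_right.trans Finset.subset_union_left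
  have hspecial {r : ℕ+} (hr : r ∈ ({1, 2, 6} : Finset ℕ+)) : r ∈ T :=
    Finset.mem_union_right _ hr
  have hd : ∃ r ∈ T, (e' r - e r : ℤ) ≠ 0 := by
    obtain ⟨r, hr⟩ := Finsupp.ne_iff.mp hne
    refine ⟨r, ?_, by omega⟩
    by_contra hrT
    rw [Finsupp.notMem_support_iff.mp (mt (@he r) hrT),
      Finsupp.notMem_support_iff.mp (mt (@he' r) hrT)] at hr
    exact hr rfl
  rcases tendsto_sum_mul_logNorm (hspecial (by decide)) (hspecial (by decide))
    (hspecial (by decide)) hd with h | h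
  · exact .inl (isLittleO_prod_entireExp_pow he he' h)
  · refine .inr (isLittleO_prod_entireExp_pow he' he
      ((tendsto_neg_atBot_atTop.comp h).congr fun m => ?_))
    rw [Function.comp_apply, ← Finset.sum_neg_distrib]
    exact Finset.sum_congr rfl fun r _ => by rw [← neg_mul, ← Int.cast_neg, neg_sub]

end MonomialGrowth

section AlgebraicIndependence

theorem eq_zero_of_eval_entireExp_eq_zero {p : MvPolynomial ℕ+ ℂ}
    (h : ∀ z, MvPolynomial.eval (fun r => entireExp r z) p = 0) : p = 0 := by
  by_contra hp
  refine not_sum_eventuallyEq_zero (l := atTop) (T := p.support)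
    (a := fun e m => p.coeff e * e.prod fun r k => entireExp r (-(halfInt m : ℂ)) ^ k)
    (MvPolynomial.support_nonempty.mpr hp) (fun e he => Frequently.of_forall fun m => ?_)
    (fun e he e' he' hne => ?_) (Eventually.of_forall fun m => ?_)
  · exact mul_ne_zero (MvPolynomial.mem_support_iff.mp he) (Finset.prod_ne_zero_iff.mpr fun r _ =>
      pow_ne_zero _ (entireExp_neg_halfInt_ne_zero r m))
  · have hc := MvPolynomial.mem_support_iff.mp he
    have hc' := MvPolynomial.mem_support_iff.mp he'
    exact (isLittleO_prod_entireExp_pow_or hne).imp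
      (fun hlt => (hlt.const_mul_left _).trans_isBigO (isBigO_self_const_mul hc' _ _))
      (fun hlt => (hlt.const_mul_left _).trans_isBigO (isBigO_self_const_mul hc _ _))
  · rw [Pi.zero_apply, ← h (-(halfInt m : ℂ)), MvPolynomial.eval_eq]
    rfl

theorem aeval_expEllD_apply (p : MvPolynomial ℕ+ ℂ) (z : disc) :
    MvPolynomial.aeval expEllD p z = MvPolynomial.eval (fun r => entireExp r z) p := by
  have heval : (fun r => Pi.evalAlgHom ℂ (fun _ : disc => ℂ) z (expEllD r))
      = fun r => entireExp r z := funext fun r => exp_ell r z.2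
  have hcomp := MvPolynomial.comp_aeval_apply (f := expEllD) (Pi.evalAlgHom ℂ (fun _ => ℂ) z) p
  rwa [heval, MvPolynomial.aeval_eq_eval] at hcomp

theorem algebraicIndependent_expEllD : AlgebraicIndependent ℂ expEllD := by
  rw [algebraicIndependent_iff]
  intro p hp
  have hanalytic : AnalyticOnNhd ℂ (fun z => MvPolynomial.eval (fun r => entireExp r z) p)
      Set.univ := fun w _ => by
    simp only [MvPolynomial.eval_eq]
    exact Finset.analyticAt_fun_sum _ fun e _ => analyticAt_const.mul
      (Finset.analyticAt_fun_prod _ fun r _ => (analyticAt_entireExp r w).pow _)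
  have hdisc : ∀ᶠ z in 𝓝 (0 : ℂ), MvPolynomial.eval (fun r => entireExp r z) p = 0 := by
    filter_upwards [Metric.ball_mem_nhds (0 : ℂ) one_pos] with z hz
    rw [← aeval_expEllD_apply p ⟨z, hz⟩, hp, Pi.zero_apply]
  exact eq_zero_of_eval_entireExp_eq_zero fun z =>
    hanalytic.eqOn_zero_of_preconnected_of_eventuallyEq_zero isPreconnected_univ (Set.mem_univ 0)
      hdisc (Set.mem_univ z)

end AlgebraicIndependence

section LinearIndependence

variable {ι K A : Type*} [Field K] [CommRing A] [Algebra K A] {v : ι → A}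

theorem one_notMem_span_of_algebraicIndependent (hv : AlgebraicIndependent K v) :
    (1 : A) ∉ Submodule.span K (Set.range v) := by
  intro hmem
  obtain ⟨c, hc⟩ := Finsupp.mem_span_range_iff_exists_finsupp.mp hmem
  have hzero : 1 - c.sum (fun i a => a • MvPolynomial.X i) = (0 : MvPolynomial ι K) :=
    algebraicIndependent_iff.mp hv _ (by
      simp only [map_sub, map_one, map_finsuppSum, map_smul, MvPolynomial.aeval_X, hc, sub_self])
  have hconst := congrArg MvPolynomial.constantCoeff hzero
  simp only [map_sub, map_one, Finsupp.sum, map_sum, MvPolynomial.constantCoeff_smul,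
    MvPolynomial.constantCoeff_X, smul_zero, Finset.sum_const_zero, sub_zero, map_zero] at hconst
  exact one_ne_zero hconst

theorem linearIndependent_sub_one (hv : AlgebraicIndependent K v) :
    LinearIndependent K fun i => v i - 1 := by
  rw [linearIndependent_iff]
  intro c hc
  have hsum : Finsupp.linearCombination K v c = (c.sum fun _ a => a) • (1 : A) := by
    simpa only [Finsupp.linearCombination_apply, smul_sub, Finsupp.sum_sub, Finsupp.sum,
      Finset.sum_sub_distrib, Finset.sum_smul, sub_eq_zero] using hc
  by_cases hs : (c.sum fun _ a => a) = 0
  · rw [hs, zero_smul] at hsum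
    exact linearIndependent_iff.mp hv.linearIndependent c hsum
  · refine absurd ?_ (one_notMem_span_of_algebraicIndependent hv)
    rw [← inv_smul_smul₀ hs (1 : A), ← hsum]
    exact Submodule.smul_mem _ _ (Finsupp.mem_span_range_iff_exists_finsupp.mpr ⟨c, rfl⟩)

end LinearIndependence

section KleeneStar

theorem conc_letter_cons (r : ℕ+) (T : Series) (a : ℕ+) (w : Word) :
    conc (letter r) T (a :: w) = if a = r then T w else 0 := by
  rw [conc, Finset.sum_eq_single_of_mem 1 (by simp)]
  · simp [letter]
  · intro i hi hi1
    refine mul_eq_zero_of_left (if_neg fun h => hi1 ?_) _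
    have hlen := congrArg List.length h
    rw [List.length_take, List.length_singleton] at hlen
    have := Finset.mem_range.mp hi
    omega

theorem concPow_letter (r : ℕ+) (n : ℕ) (w : Word) :
    concPow (letter r) n w = if w = List.replicate n r then 1 else 0 := by
  induction n generalizing w with
  | zero => rfl
  | succ n ih =>
    cases w with
    | nil => simp [concPow, conc, letter]
    | cons a w =>
      rw [concPow, conc_letter_cons, ih, List.replicate_succ, ← ite_and]
      simp only [List.cons.injEq]

theorem kleeneStar_letter_replicate (r : ℕ+) (n : ℕ) :
    kleeneStar (letter r) (List.replicate n r) = 1 := by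
  rw [kleeneStar, Finset.sum_eq_single_of_mem n (by simp)]
  · rw [concPow_letter, if_pos rfl]
  · intro m _ hm
    rw [concPow_letter, if_neg fun h => hm (List.replicate_left_injective r h).symm]

theorem kleeneStar_letter_of_notMem_range (r : ℕ+) {w : Word}
    (hw : w ∉ Set.range fun n => List.replicate n r) : kleeneStar (letter r) w = 0 :=
  Finset.sum_eq_zero fun n _ => by
    rw [concPow_letter, if_neg fun h => hw ⟨n, h.symm⟩]

end KleeneStar

section IteratedIntegrals

variable {u : ℕ+ → ℂ → ℂ} {r : ℕ+} {G : ℂ → ℂ}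

theorem ofReal_mul_mem_disc {t : ℝ} (ht : t ∈ Set.Icc 0 1) {z : ℂ} (hz : z ∈ disc) :
    (t : ℂ) * z ∈ disc :=
  balanced_ball_zero.smul_mem (by
    rw [Complex.norm_real, Real.norm_of_nonneg ht.1]
    exact ht.2) hz

theorem mul_integral_deriv_eq_sub (hG : DifferentiableOn ℂ G disc) {z : ℂ} (hz : z ∈ disc) :
    z * ∫ t in (0 : ℝ)..1, deriv G (t * z) = G z - G 0 := by
  have hmaps : Set.MapsTo (fun t : ℝ => (t : ℂ) * z) (Set.Icc 0 1) disc := fun t ht =>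
    ofReal_mul_mem_disc ht hz
  have h := intervalIntegral.integral_unitInterval_deriv_eq_sub (f := G) (f' := deriv G)
    (z₀ := 0) (z₁ := z)
  simp only [zero_add, Complex.real_smul, smul_eq_mul] at h
  exact h ((hG.deriv Metric.isOpen_ball).continuousOn.comp (by fun_prop) hmaps) fun t ht =>
    (hG.differentiableAt (Metric.isOpen_ball.mem_nhds (hmaps ht))).hasDerivAt

theorem iterInt_replicate (hG : DifferentiableOn ℂ G disc) (h0 : G 0 = 0)
    (hu : Set.EqOn (u r) (deriv G) disc) (n : ℕ) {z : ℂ} (hz : z ∈ disc) :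
    iterInt u (List.replicate n r) z = G z ^ n / n.factorial := by
  induction n generalizing z with
  | zero => simp [iterInt]
  | succ n ih =>
    have hderiv {w : ℂ} (hw : w ∈ disc) : u r w * iterInt u (List.replicate n r) w
        = deriv (fun w => G w ^ (n + 1) / (n + 1).factorial) w := by
      have hGw := (hG.differentiableAt (Metric.isOpen_ball.mem_nhds hw)).hasDerivAt
      rw [((hGw.fun_pow (n + 1)).div_const _).deriv, hu hw, ih hw, Nat.factorial_succ]
      have := n.factorial_ne_zero
      push_cast
      field_simp
    rw [List.replicate_succ, iterInt, intervalIntegral.integral_congr fun t ht =>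
        hderiv (ofReal_mul_mem_disc (Set.uIcc_of_le (zero_le_one' ℝ) ▸ ht) hz),
      mul_integral_deriv_eq_sub ((hG.fun_pow (n + 1)).div_const _) hz, h0,
      zero_pow n.succ_ne_zero, zero_div, sub_zero]

theorem hasSum_letter (hG : DifferentiableOn ℂ G disc) (h0 : G 0 = 0)
    (hu : Set.EqOn (u r) (deriv G) disc) {z : ℂ} (hz : z ∈ disc) :
    HasSum (fun w : Word => letter r w * iterInt u w z) (G z) := by
  have hsum := hasSum_single (f := fun w : Word => letter r w * iterInt u w z) [r] fun w hw => by
    rw [letter, if_neg hw, zero_mul]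
  rwa [letter, if_pos rfl, one_mul, ← List.replicate_one, iterInt_replicate hG h0 hu 1 hz, pow_one,
    Nat.factorial_one, Nat.cast_one, div_one] at hsum

theorem hasSum_kleeneStar_letter (hG : DifferentiableOn ℂ G disc) (h0 : G 0 = 0)
    (hu : Set.EqOn (u r) (deriv G) disc) {z : ℂ} (hz : z ∈ disc) :
    HasSum (fun w : Word => kleeneStar (letter r) w * iterInt u w z) (Complex.exp (G z)) := by
  refine ((List.replicate_left_injective r).hasSum_iff fun w hw => ?_).mp ?_
  · rw [kleeneStar_letter_of_notMem_range r hw, zero_mul]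
  · have hterm : ((fun w : Word => kleeneStar (letter r) w * iterInt u w z) ∘
        fun n => List.replicate n r) = fun n => G z ^ n / n.factorial := by
      ext n
      rw [Function.comp_apply, kleeneStar_letter_replicate, one_mul,
        iterInt_replicate hG h0 hu n hz]
    rw [hterm, Complex.exp_eq_exp_ℂ]
    exact NormedSpace.expSeries_div_hasSum_exp (G z)

variable {ι : Type*} {s : ι → Series} {f : ι → disc → ℂ}

theorem alpha_linearCombination
    (h : ∀ i (z : disc), HasSum (fun w : Word => s i w * iterInt u w z) (f i z)) (c : ι →₀ ℂ) :
    alpha u (Finsupp.linearCombination ℂ s c) = Finsupp.linearCombination ℂ f c := by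
  ext z
  have hsum := hasSum_sum fun i (_ : i ∈ c.support) => (h i z).mul_left (c i)
  simp only [← mul_assoc, ← Finset.sum_mul] at hsum
  simpa only [alpha, Finsupp.linearCombination_apply, Finsupp.sum, Finset.sum_apply, Pi.smul_apply,
    smul_eq_mul] using hsum.tsum_eq

theorem mapsTo_alpha_span
    (h : ∀ i (z : disc), HasSum (fun w : Word => s i w * iterInt u w z) (f i z))
    {V : Submodule ℂ (disc → ℂ)} (hf : ∀ i, f i ∈ V) :
    Set.MapsTo (alpha u) (Submodule.span ℂ (Set.range s) : Set Series) V := by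
  intro S hS
  obtain ⟨c, rfl⟩ := Finsupp.mem_span_range_iff_exists_finsupp.mp hS
  rw [← Finsupp.linearCombination_apply, alpha_linearCombination h,
    Finsupp.linearCombination_apply]
  exact V.sum_mem fun i _ => V.smul_mem _ (hf i)

theorem injOn_alpha_span
    (h : ∀ i (z : disc), HasSum (fun w : Word => s i w * iterInt u w z) (f i z))
    (hf : LinearIndependent ℂ f) :
    Set.InjOn (alpha u) (Submodule.span ℂ (Set.range s) : Set Series) := by
  intro S hS S' hS' heq
  obtain ⟨c, rfl⟩ := Finsupp.mem_span_range_iff_exists_finsupp.mp hS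
  obtain ⟨c', rfl⟩ := Finsupp.mem_span_range_iff_exists_finsupp.mp hS'
  rw [← Finsupp.linearCombination_apply, ← Finsupp.linearCombination_apply,
    alpha_linearCombination h, alpha_linearCombination h] at heq
  rw [hf heq]

end IteratedIntegrals

section Inputs

theorem hasSum_letter_inputLog (r : ℕ+) (z : disc) :
    HasSum (fun w : Word => letter r w * iterInt inputLog w z) (ellD r z) :=
  hasSum_letter (differentiableOn_ell r) (ell_zero r) (fun _ _ => rfl) z.2

theorem hasSum_kleeneStar_inputLog (r : ℕ+) (z : disc) :
    HasSum (fun w : Word => kleeneStar (letter r) w * iterInt inputLog w z) (expEllD r z) :=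
  hasSum_kleeneStar_letter (differentiableOn_ell r) (ell_zero r) (fun _ _ => rfl) z.2

theorem differentiableOn_exp_ell_sub_one (r : ℕ+) :
    DifferentiableOn ℂ (fun z => Complex.exp (ell r z) - 1) disc :=
  (differentiableOn_ell r).cexp.sub_const 1

theorem exp_ell_zero_sub_one (r : ℕ+) : Complex.exp (ell r 0) - 1 = 0 := by
  rw [ell_zero, Complex.exp_zero, sub_self]

theorem eqOn_inputExp_deriv (r : ℕ+) :
    Set.EqOn (inputExp r) (deriv fun z => Complex.exp (ell r z) - 1) disc := fun _ hz =>
  (((differentiableOn_ell r).differentiableAt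
    (Metric.isOpen_ball.mem_nhds hz)).hasDerivAt.cexp.sub_const 1).deriv.symm

theorem hasSum_letter_inputExp (r : ℕ+) (z : disc) :
    HasSum (fun w : Word => letter r w * iterInt inputExp w z) ((expEllD r - 1) z) :=
  hasSum_letter (differentiableOn_exp_ell_sub_one r) (exp_ell_zero_sub_one r)
    (eqOn_inputExp_deriv r) z.2

theorem hasSum_kleeneStar_inputExp (r : ℕ+) (z : disc) :
    HasSum (fun w : Word => kleeneStar (letter r) w * iterInt inputExp w z)
      (Complex.exp (Complex.exp (ell r z) - 1)) :=
  hasSum_kleeneStar_letter (differentiableOn_exp_ell_sub_one r) (exp_ell_zero_sub_one r)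
    (eqOn_inputExp_deriv r) z.2

end Inputs

end Eulerian

open Eulerian

theorem mainTheorem2 :
    -- the families are linearly free, and free from the constant function 1
    (LinearIndependent ℂ Eulerian.ellD ∧ (1 : Eulerian.disc → ℂ) ∉ Eulerian.spanL ∧
      LinearIndependent ℂ Eulerian.expEllD ∧ (1 : Eulerian.disc → ℂ) ∉ Eulerian.spanE) ∧
    -- the inputs `e^{ℓ_r} ∂ℓ_r`
    ((∀ (r : ℕ+) (z : Eulerian.disc),
        Eulerian.alpha Eulerian.inputExp (Eulerian.letter r) z =
          Complex.exp (Eulerian.ell r z) - 1 ∧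
        HasSum (fun w : Eulerian.Word => Eulerian.kleeneStar (Eulerian.letter r) w *
            Eulerian.iterInt Eulerian.inputExp w z)
          (Complex.exp (Complex.exp (Eulerian.ell r z) - 1))) ∧
      Set.MapsTo (Eulerian.alpha Eulerian.inputExp) (Eulerian.spanY : Set Eulerian.Series)
        (Eulerian.spanE ⊔ Submodule.span ℂ {(1 : Eulerian.disc → ℂ)} :
          Submodule ℂ (Eulerian.disc → ℂ)) ∧
      Set.InjOn (Eulerian.alpha Eulerian.inputExp) (Eulerian.spanY : Set Eulerian.Series)) ∧
    -- the inputs `∂ℓ_r`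
    ((∀ (r : ℕ+) (z : Eulerian.disc),
        Eulerian.alpha Eulerian.inputLog (Eulerian.letter r) z = Eulerian.ell r z ∧
        HasSum (fun w : Eulerian.Word => Eulerian.kleeneStar (Eulerian.letter r) w *
            Eulerian.iterInt Eulerian.inputLog w z)
          (Complex.exp (Eulerian.ell r z))) ∧
      Set.MapsTo (Eulerian.alpha Eulerian.inputLog) (Eulerian.spanY : Set Eulerian.Series)
        (Eulerian.spanL : Set (Eulerian.disc → ℂ)) ∧
      Set.InjOn (Eulerian.alpha Eulerian.inputLog) (Eulerian.spanY : Set Eulerian.Series) ∧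
      Set.MapsTo (Eulerian.alpha Eulerian.inputLog) (Eulerian.spanYStar : Set Eulerian.Series)
        (Eulerian.spanE : Set (Eulerian.disc → ℂ)) ∧
      Set.InjOn (Eulerian.alpha Eulerian.inputLog)
        (Eulerian.spanYStar : Set Eulerian.Series)) ∧
    -- algebraic independence of each of the two families
    (AlgebraicIndependent ℂ Eulerian.ellD ∧ AlgebraicIndependent ℂ Eulerian.expEllD) ∧
    (∀ r : ℕ+,
      AlgebraicIndependent ℂ ![Eulerian.ellD r, Eulerian.expEllD r] ∧
      -- `ℓ_r` is holomorphic on the disc (where its defining series converges)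
      ((∀ z ∈ Eulerian.disc, Summable (Eulerian.ellTerm r z)) ∧
        DifferentiableOn ℂ (Eulerian.ell r) Eulerian.disc) ∧
      -- `e^{ℓ_r}` is entire
      (∃ F : ℂ → ℂ, Differentiable ℂ F ∧
        (∀ z ∈ Eulerian.disc, F z = Complex.exp (Eulerian.ell r z) ∧
          F z = (Eulerian.gammaY r (1 + z))⁻¹) ∧
        {z | F z = 0} = ⋃ χ ∈ Eulerian.rootsG r, Eulerian.negRay χ) ∧
      -- `e^{-ℓ_r}` is meromorphic on the plane
      (∃ M : ℂ → ℂ, MeromorphicOn M Set.univ ∧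
        (∀ z ∈ Eulerian.disc, M z = Complex.exp (-Eulerian.ell r z) ∧
          M z = Eulerian.gammaY r (1 + z)) ∧
        {z | meromorphicOrderAt M z < 0} = ⋃ χ ∈ Eulerian.rootsG r, Eulerian.negRay χ) ∧
      -- the union is disjoint, countable, and consists of isolated points
      (Eulerian.rootsG r).PairwiseDisjoint Eulerian.negRay ∧
      (⋃ χ ∈ Eulerian.rootsG r, Eulerian.negRay χ).Countable ∧
      (∀ z ∈ ⋃ χ ∈ Eulerian.rootsG r, Eulerian.negRay χ,
        ∀ᶠ w in 𝓝[≠] z, w ∉ ⋃ χ ∈ Eulerian.rootsG r, Eulerian.negRay χ)) := by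
  have hell := algebraicIndependent_ellD
  have hexp := algebraicIndependent_expEllD
  refine ⟨⟨hell.linearIndependent, one_notMem_span_of_algebraicIndependent hell,
      hexp.linearIndependent, one_notMem_span_of_algebraicIndependent hexp⟩,
    ⟨fun r z => ⟨(hasSum_letter_inputExp r z).tsum_eq, hasSum_kleeneStar_inputExp r z⟩,
      mapsTo_alpha_span hasSum_letter_inputExp fun r => ?_,
      injOn_alpha_span hasSum_letter_inputExp (linearIndependent_sub_one hexp)⟩,
    ⟨fun r z => ⟨(hasSum_letter_inputLog r z).tsum_eq, hasSum_kleeneStar_inputLog r z⟩,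
      mapsTo_alpha_span hasSum_letter_inputLog fun r => Submodule.subset_span ⟨r, rfl⟩,
      injOn_alpha_span hasSum_letter_inputLog hell.linearIndependent,
      mapsTo_alpha_span hasSum_kleeneStar_inputLog fun r => Submodule.subset_span ⟨r, rfl⟩,
      injOn_alpha_span hasSum_kleeneStar_inputLog hexp.linearIndependent⟩,
    ⟨hell, hexp⟩, fun r => ⟨algebraicIndependent_ellD_expEllD (hexp.transcendental r),
      ⟨fun z hz => summable_ellTerm r hz, differentiableOn_ell r⟩,
      ⟨entireExp r, differentiable_entireExp r, fun z hz => ?_,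
        Set.ext fun z => entireExp_eq_zero_iff r z⟩,
      ⟨(entireExp r)⁻¹, fun z _ => (analyticAt_entireExp r z).meromorphicAt.inv,
        fun z hz => ?_, Set.ext fun z => (meromorphicOrderAt_inv_entireExp_neg_iff r z).trans
          (entireExp_eq_zero_iff r z)⟩,
      pairwiseDisjoint_negRay r, countable_iUnion_negRay r,
      fun z _ => eventually_notMem_iUnion_negRay r z⟩⟩
  · refine Submodule.sub_mem _ (Submodule.mem_sup_left (Submodule.subset_span ⟨r, rfl⟩))
      (Submodule.mem_sup_right (Submodule.mem_span_singleton_self _))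
  · rw [gammaY, add_sub_cancel_left, Complex.exp_neg, inv_inv, exp_ell r hz]
    exact ⟨rfl, rfl⟩
  · rw [gammaY, add_sub_cancel_left, Complex.exp_neg, exp_ell r hz]
    exact ⟨rfl, rfl⟩
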